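/- **Proposition 4.1.** For $R>0$ let $B_R=\{x\in\mathbb R^3: |x|\le R\}$, $\dot B_R=B_R\setminus\{0\}$, $S_1=\{|x|=1\}$. Let $S$ be the set consisting of all rotations about the $x_3$-axis and the reflection $(x_1,x_2,x_3)\mapsto(x_1,x_2,-x_3)$, and $C_S(B_R)=\{f\in C(B_R): f(Ax)=f(x)\ \text{for } A\in S,\ x\in B_R\}$. Let $$X=\Big\{f\in C_S(B_3)\cap C^1(\dot B_3): f(0)=0,\ \nabla f \text{ bounded on } \dot B_3,\ \lim_{t\searrow0}\nabla f(tx)\text{ exists uniformly in }x\in S_1\Big\},\quad \|f\|_X=\sup_{\dot B_3}|\nabla f|,$$ $$Y=\Big\{f\in C_S(B_3)\cap C^1(B_3): f(0)=0,\ \exists C\,\forall x\in B_3:\ |\nabla f(x)|\le C|x|,\ \lim_{t\searrow0}\tfrac{\nabla f(tx)}{t}\text{ exists uniformly in }x\in S_1\Big\},\quad \|f\|_Y=\sup_{x\in\dot B_3}\frac{|\nabla f(x)|}{|x|}.$$ Let $\varphi,\psi:\mathbb R\to[0,\infty[$ and $E_0\in\mathbb R$ satisfy: * $\varphi\in L^p_{loc}(\mathbb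 R)$ for some $p>2$, $\varphi(E)=0$ for a.e. $E\ge E_0$, and $\varphi(E)>0$ for a.e. $E<E_0$; * $f_0(x,v)=\varphi\big(\tfrac12|v|^2+U_0(x)\big)$ is a steady state $(f_0,\rho_0,U_0)$ of the Vlasov–Poisson system, i.e. $\rho_0=\int f_0(\cdot,v)\,dv$ and $\Delta U_0=4\pi\rho_0$ (the Vlasov equation holds since $f_0$ is a function of the particle energy), where $\rho_0$ and $U_0$ depend only on $|x|$, $\rho_0\in C^1_c(\mathbb R^3)$ with $\operatorname{supp}\rho_0=B_1$, $U_0\in C^2(\mathbb R^3)$, and $U_0(x)\to0$ as $|x|\to\infty$; * $\psi\in C^2(\mathbb R)$, $\psi'(0)=0$, and $\psi(P)=1\Leftrightarrow P=0$. Put $r(x)=\sqrt{x_1^2+x_2^2}$, $$h(\gamma,r,u)=2\pi\int_u^{E_0}\varphi(E)\int_{-\sqrt{2(E-u)}}^{\sqrt{2(E-u)}}\psi(\gamma r s)\,ds\,dE\ \ (u<E_0),\qquad h(\gamma,r,u)=0\ \ (u\ge E_0),$$ and, for $\zeta\in X$, $g_\zeta(x)=x+\zeta(x)\frac{x}{|x|}$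 for $x\in\dot B_3$, $g_\zeta(0)=0$. For $\zeta\in X$ of sufficiently small norm the map $g_\zeta$ is injective on $B_3$ with $B_2\subset g_\zeta(B_3)$, and $$T(0,\zeta)(x)=U_0(x)+\int_{B_2}\frac{h\big(0,r(y),U_0(g_\zeta^{-1}(y))\big)}{|g_\zeta(x)-y|}\,dy-U_0(0)-\int_{B_2}\frac{h\big(0,r(y),U_0(g_\zeta^{-1}(y))\big)}{|y|}\,dy,\quad x\in B_3,$$ defines an element of $Y$. The map $\zeta\mapsto T(0,\zeta)$, from a neighbourhood of $0$ in $X$ to $Y$, is Fréchet differentiable at $\zeta=0$, and its derivative $\partial_\zeta T(0,0):X\to Y$ is a linear isomorphism (a bounded linear bijection with bounded inverse). -/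

import Mathlib

open Set Filter Topology MeasureTheory

noncomputable section

namespace AxialVP

/-- Physical space (and velocity space) with the Euclidean norm. -/
abbrev E3 : Type := EuclideanSpace ℝ (Fin 3)

/-- The closed ball of radius `R` about the origin. -/
def B (R : ℝ) : Set E3 := Metric.closedBall 0 R

/-- The punctured closed ball. -/
def Bdot (R : ℝ) : Set E3 := B R \ {0}

/-- The unit sphere. -/
def S1 : Set E3 := Metric.sphere 0 1

/-- Rotation by the angle `θ` around the third axis. -/
def axisRotation (θ : ℝ) (x : E3) : E3 :=
  !₂[Real.cos θ * x 0 - Real.sin θ * x 1, Real.sin θ * x 0 + Real.cos θ * x 1, x 2]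

/-- Reflection at the plane where the third coordinate vanishes. -/
def planeReflection (x : E3) : E3 := !₂[x 0, x 1, - x 2]

/-- The set of transformations: all rotations around the third axis, and the reflection. -/
def S : Set (E3 → E3) := Set.range axisRotation ∪ {planeReflection}

/-- Membership in `C_S(B_R)`.  A function on `B_R` is represented throughout by its extension
by zero to the whole space, so that functions on `B_R` and their representatives correspond
one to one. -/
structure IsCS (R : ℝ) (f : E3 → ℝ) : Prop where
  zero_outside : ∀ x, x ∉ B R → f x = 0
  continuousOn : ContinuousOn f (B R)
  symm : ∀ A ∈ S, ∀ x ∈ B R, f (A x) = f x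

/-- The gradient of a function on `B_3` (one-sided at boundary points). -/
def grad (f : E3 → ℝ) (x : E3) : E3 := gradientWithin f (B 3) x

/-- Membership in the space `X`. -/
structure MemX (f : E3 → ℝ) : Prop where
  isCS : IsCS 3 f
  map_zero : f 0 = 0
  contDiffOn : ContDiffOn ℝ 1 f (Bdot 3)
  grad_bound : ∃ C : ℝ, ∀ x ∈ Bdot 3, ‖grad f x‖ ≤ C
  grad_limit : ∃ G : E3 → E3,
    TendstoUniformlyOn (fun (t : ℝ) (x : E3) => grad f (t • x)) G (𝓝[>] 0) S1

/-- Membership in the space `Y`. -/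
structure MemY (f : E3 → ℝ) : Prop where
  isCS : IsCS 3 f
  map_zero : f 0 = 0
  contDiffOn : ContDiffOn ℝ 1 f (B 3)
  grad_bound : ∃ C : ℝ, ∀ x ∈ B 3, ‖grad f x‖ ≤ C * ‖x‖
  grad_limit : ∃ G : E3 → E3,
    TendstoUniformlyOn (fun (t : ℝ) (x : E3) => t⁻¹ • grad f (t • x)) G (𝓝[>] 0) S1

/-! ### Elementary facts used to make `X` and `Y` normed spaces -/

theorem uniqueDiff_B3 : UniqueDiffOn ℝ (B 3) := by
  refine uniqueDiffOn_convex (convex_closedBall _ _) ?_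
  rw [B, interior_closedBall _ (by norm_num)]
  exact ⟨0, by simp⟩

theorem nhdsWithin_Bdot {x : E3} (hx : x ≠ 0) : 𝓝[Bdot 3] x = 𝓝[B 3] x := by
  have h : Bdot 3 = B 3 ∩ {0}ᶜ := rfl
  rw [h]
  exact nhdsWithin_inter_of_mem' (mem_nhdsWithin_of_mem_nhds (isOpen_compl_singleton.mem_nhds hx))

theorem differentiableWithinAt_of_contDiffOn_Bdot {f : E3 → ℝ} (h : ContDiffOn ℝ 1 f (Bdot 3))
    {x : E3} (hx : x ∈ Bdot 3) : DifferentiableWithinAt ℝ f (B 3) x := by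
  have h1 := h.differentiableOn one_ne_zero x hx
  have hs : Bdot 3 = B 3 ∩ {0}ᶜ := rfl
  rw [hs] at h1
  exact (differentiableWithinAt_inter (isOpen_compl_singleton.mem_nhds hx.2)).1 h1

theorem grad_add {f g : E3 → ℝ} {x : E3} (hx : x ∈ B 3)
    (hf : DifferentiableWithinAt ℝ f (B 3) x) (hg : DifferentiableWithinAt ℝ g (B 3) x) :
    grad (f + g) x = grad f x + grad g x := by
  simp only [grad, gradientWithin]
  rw [fderivWithin_add (uniqueDiff_B3 x hx) hf hg, _root_.map_add]

theorem grad_smul {f : E3 → ℝ} {x : E3} (c : ℝ) (hx : x ∈ B 3)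
    (hf : DifferentiableWithinAt ℝ f (B 3) x) :
    grad (c • f) x = c • grad f x := by
  simp only [grad, gradientWithin]
  rw [fderivWithin_const_smul (uniqueDiff_B3 x hx) hf]
  simp

theorem grad_zero (x : E3) : grad 0 x = 0 := by
  simp [grad, gradientWithin]

theorem smul_mem_Bdot {t : ℝ} (ht : t ∈ Ioc (0 : ℝ) 3) {x : E3} (hx : x ∈ S1) :
    t • x ∈ Bdot 3 := by
  have hx1 : ‖x‖ = 1 := by simpa [S1] using hx
  refine ⟨?_, ?_⟩
  · simp only [B, Metric.mem_closedBall, dist_zero_right, norm_smul, hx1, mul_one,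
      Real.norm_eq_abs, abs_of_pos ht.1]
    exact ht.2
  · have hx0 : x ≠ 0 := by
      intro h
      simp [h] at hx1
    simpa [ht.1.ne'] using hx0

theorem eventually_Ioc : ∀ᶠ t : ℝ in 𝓝[>] 0, t ∈ Ioc (0 : ℝ) 3 :=
  Ioc_mem_nhdsGT (by norm_num)

theorem isCS_add {f g : E3 → ℝ} (hf : IsCS 3 f) (hg : IsCS 3 g) : IsCS 3 (f + g) where
  zero_outside x hx := by simp [hf.zero_outside x hx, hg.zero_outside x hx]
  continuousOn := hf.continuousOn.add hg.continuousOn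
  symm A hA x hx := by simp [hf.symm A hA x hx, hg.symm A hA x hx]

theorem isCS_smul (c : ℝ) {f : E3 → ℝ} (hf : IsCS 3 f) : IsCS 3 (c • f) where
  zero_outside x hx := by simp [hf.zero_outside x hx]
  continuousOn := hf.continuousOn.const_smul c
  symm A hA x hx := by simp [hf.symm A hA x hx]

theorem isCS_zero : IsCS 3 0 where
  zero_outside _ _ := rfl
  continuousOn := continuousOn_const
  symm _ _ _ _ := rfl

theorem MemX.diff {f : E3 → ℝ} (hf : MemX f) {x : E3} (hx : x ∈ Bdot 3) :
    DifferentiableWithinAt ℝ f (B 3) x :=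
  differentiableWithinAt_of_contDiffOn_Bdot hf.contDiffOn hx

theorem MemY.diff {f : E3 → ℝ} (hf : MemY f) {x : E3} (hx : x ∈ B 3) :
    DifferentiableWithinAt ℝ f (B 3) x :=
  hf.contDiffOn.differentiableOn one_ne_zero x hx

theorem tendsto_smul_const {F : ℝ → E3 → E3} {G : E3 → E3} (c : ℝ)
    (h : TendstoUniformlyOn F G (𝓝[>] 0) S1) :
    TendstoUniformlyOn (fun t x => c • F t x) (fun x => c • G x) (𝓝[>] 0) S1 :=
  (uniformContinuous_const_smul c).comp_tendstoUniformlyOn h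

/-- `X` as a linear subspace of functions. -/
def XSub : Submodule ℝ (E3 → ℝ) where
  carrier := {f | MemX f}
  zero_mem' :=
    { isCS := isCS_zero
      map_zero := rfl
      contDiffOn := contDiffOn_const
      grad_bound := ⟨0, fun x _ => by simp [grad_zero]⟩
      grad_limit := ⟨0, by
        simp only [grad_zero]
        exact fun u hu => .of_forall fun _ _ _ => refl_mem_uniformity hu⟩ }
  add_mem' := by
    intro f g hf hg
    obtain ⟨C, hC⟩ := hf.grad_bound
    obtain ⟨D, hD⟩ := hg.grad_bound
    obtain ⟨F, hF⟩ := hf.grad_limit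
    obtain ⟨G, hG⟩ := hg.grad_limit
    refine ⟨isCS_add hf.isCS hg.isCS, by simp [hf.map_zero, hg.map_zero],
      hf.contDiffOn.add hg.contDiffOn, ⟨C + D, fun x hx => ?_⟩, ⟨F + G, ?_⟩⟩
    · rw [grad_add hx.1 (hf.diff hx) (hg.diff hx)]
      exact (norm_add_le _ _).trans (add_le_add (hC x hx) (hD x hx))
    · refine (hF.add hG).congr ?_
      filter_upwards [eventually_Ioc] with t ht x hx
      have hm := smul_mem_Bdot ht hx
      exact (grad_add hm.1 (hf.diff hm) (hg.diff hm)).symm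
  smul_mem' := by
    intro c f hf
    obtain ⟨C, hC⟩ := hf.grad_bound
    obtain ⟨F, hF⟩ := hf.grad_limit
    refine ⟨isCS_smul c hf.isCS, by simp [hf.map_zero],
      hf.contDiffOn.const_smul c, ⟨|c| * C, fun x hx => ?_⟩, ⟨fun x => c • F x, ?_⟩⟩
    · rw [grad_smul c hx.1 (hf.diff hx), norm_smul, Real.norm_eq_abs]
      exact mul_le_mul_of_nonneg_left (hC x hx) (abs_nonneg c)
    · refine (tendsto_smul_const c hF).congr ?_
      filter_upwards [eventually_Ioc] with t ht x hx
      have hm := smul_mem_Bdot ht hx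
      exact (grad_smul c hm.1 (hf.diff hm)).symm

/-- `Y` as a linear subspace of functions. -/
def YSub : Submodule ℝ (E3 → ℝ) where
  carrier := {f | MemY f}
  zero_mem' :=
    { isCS := isCS_zero
      map_zero := rfl
      contDiffOn := contDiffOn_const
      grad_bound := ⟨0, fun x _ => by simp [grad_zero]⟩
      grad_limit := ⟨0, by
        simp only [grad_zero, smul_zero]
        exact fun u hu => .of_forall fun _ _ _ => refl_mem_uniformity hu⟩ }
  add_mem' := by
    intro f g hf hg
    obtain ⟨C, hC⟩ := hf.grad_bound
    obtain ⟨D, hD⟩ := hg.grad_bound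
    obtain ⟨F, hF⟩ := hf.grad_limit
    obtain ⟨G, hG⟩ := hg.grad_limit
    refine ⟨isCS_add hf.isCS hg.isCS, by simp [hf.map_zero, hg.map_zero],
      hf.contDiffOn.add hg.contDiffOn, ⟨C + D, fun x hx => ?_⟩, ⟨F + G, ?_⟩⟩
    · rw [grad_add hx (hf.diff hx) (hg.diff hx), add_mul]
      exact (norm_add_le _ _).trans (add_le_add (hC x hx) (hD x hx))
    · refine (hF.add hG).congr ?_
      filter_upwards [eventually_Ioc] with t ht x hx
      have hm := (smul_mem_Bdot ht hx).1
      simp only [Pi.add_apply]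
      rw [grad_add hm (hf.diff hm) (hg.diff hm), smul_add]
  smul_mem' := by
    intro c f hf
    obtain ⟨C, hC⟩ := hf.grad_bound
    obtain ⟨F, hF⟩ := hf.grad_limit
    refine ⟨isCS_smul c hf.isCS, by simp [hf.map_zero],
      hf.contDiffOn.const_smul c, ⟨|c| * C, fun x hx => ?_⟩, ⟨fun x => c • F x, ?_⟩⟩
    · rw [grad_smul c hx (hf.diff hx), norm_smul, Real.norm_eq_abs, mul_assoc]
      exact mul_le_mul_of_nonneg_left (hC x hx) (abs_nonneg c)
    · refine (tendsto_smul_const c hF).congr ?_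
      filter_upwards [eventually_Ioc] with t ht x hx
      have hm := (smul_mem_Bdot ht hx).1
      simp only
      rw [grad_smul c hm (hf.diff hm), smul_comm]

/-- The space `X`.  (A separate type, so that its topology is the one of its norm and not the
topology of pointwise convergence.) -/
def X : Type := XSub

/-- The space `Y`. -/
def Y : Type := YSub

instance : AddCommGroup X := inferInstanceAs (AddCommGroup XSub)
instance : Module ℝ X := inferInstanceAs (Module ℝ XSub)
instance : AddCommGroup Y := inferInstanceAs (AddCommGroup YSub)
instance : Module ℝ Y := inferInstanceAs (Module ℝ YSub)

instance : CoeFun X (fun _ => E3 → ℝ) := ⟨fun f => f.1⟩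
instance : CoeFun Y (fun _ => E3 → ℝ) := ⟨fun f => f.1⟩

/-- The norm of `X`: the supremum over the punctured ball of `|∇f(x)|`. -/
def normX (f : X) : ℝ := ⨆ x : Bdot 3, ‖grad f x‖

/-- The norm of `Y`: the supremum over the punctured ball of `|∇f(x)| / |x|`. -/
def normY (f : Y) : ℝ := ⨆ x : Bdot 3, ‖grad f x‖ / ‖(x : E3)‖

theorem nonempty_Bdot : Nonempty (Bdot 3) := by
  refine ⟨⟨EuclideanSpace.single 0 1, ?_, ?_⟩⟩
  · simp [B]
  · intro h
    have := congrArg norm h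
    simp at this

theorem bddX (f : X) : BddAbove (Set.range fun x : Bdot 3 => ‖grad f x‖) := by
  obtain ⟨C, hC⟩ := f.2.grad_bound
  exact ⟨C, by rintro _ ⟨x, rfl⟩; exact hC x x.2⟩

theorem norm_pos_of_Bdot (x : Bdot 3) : 0 < ‖(x : E3)‖ := norm_pos_iff.2 x.2.2

theorem bddY (f : Y) : BddAbove (Set.range fun x : Bdot 3 => ‖grad f x‖ / ‖(x : E3)‖) := by
  obtain ⟨C, hC⟩ := f.2.grad_bound
  refine ⟨C, ?_⟩
  rintro _ ⟨x, rfl⟩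
  exact (div_le_iff₀ (norm_pos_of_Bdot x)).2 (hC x x.2.1)

/-- A function in `C_S(B_3)` that vanishes at the origin and has zero gradient away from it
is zero. -/
theorem eq_zero_of_grad {f : E3 → ℝ} (hf : IsCS 3 f) (h0 : f 0 = 0)
    (hd : ∀ x ∈ Bdot 3, DifferentiableWithinAt ℝ f (B 3) x)
    (hg : ∀ x ∈ Bdot 3, grad f x = 0) : f = 0 := by
  funext x
  by_cases hx : x ∈ B 3
  swap
  · exact hf.zero_outside x hx
  by_cases hx0 : x = 0
  · rw [hx0]
    exact h0
  have hxn : ‖x‖ ≤ 3 := by simpa [B] using hx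
  have hmem : ∀ t ∈ Icc (0 : ℝ) 1, t • x ∈ B 3 := by
    intro t ht
    simp only [B, Metric.mem_closedBall, dist_zero_right, norm_smul, Real.norm_eq_abs,
      abs_of_nonneg ht.1]
    nlinarith [ht.1, ht.2, norm_nonneg x]
  have hc : ContinuousOn (fun t : ℝ => f (t • x)) (Icc 0 1) :=
    hf.continuousOn.comp (by fun_prop) hmem
  have hder : ∀ t ∈ Ioo (0 : ℝ) 1, HasDerivAt (fun t : ℝ => f (t • x)) 0 t := by
    intro t ht
    have htm : t • x ∈ Bdot 3 :=
      ⟨hmem t ⟨ht.1.le, ht.2.le⟩, by simpa [ht.1.ne'] using hx0⟩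
    have h1 : HasFDerivWithinAt f (0 : E3 →L[ℝ] ℝ) (B 3) (t • x) := by
      have h2 := (hd _ htm).hasFDerivWithinAt
      have h3 : fderivWithin ℝ f (B 3) (t • x) = 0 := by
        have := hg _ htm
        simpa [grad, gradientWithin] using this
      rwa [h3] at h2
    have h4 : HasDerivWithinAt (fun t : ℝ => t • x) x (Ioo 0 1) t := by
      simpa using ((hasDerivAt_id t).smul_const x).hasDerivWithinAt
    have h5 := h1.comp_hasDerivWithinAt t h4 (fun s hs => hmem s ⟨hs.1.le, hs.2.le⟩)
    have h6 := h5.hasDerivAt (Ioo_mem_nhds ht.1 ht.2)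
    simpa [Function.comp_def] using h6
  obtain ⟨c, _, hcs⟩ := exists_hasDerivAt_eq_slope (fun t : ℝ => f (t • x)) (fun _ => 0)
    zero_lt_one hc hder
  simp [h0] at hcs
  exact hcs.symm

def normXAux : AddGroupNorm X where
  toFun := normX
  map_zero' := by
    have := nonempty_Bdot
    have : ∀ x, grad (0 : X) x = 0 := grad_zero
    simp [normX, this]
  add_le' f g := by
    have := nonempty_Bdot
    refine ciSup_le fun x => ?_
    have h : grad (f + g : X) x = grad f x + grad g x :=
      grad_add x.2.1 (f.2.diff x.2) (g.2.diff x.2)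
    rw [h]
    exact (norm_add_le _ _).trans (add_le_add (le_ciSup (bddX f) x) (le_ciSup (bddX g) x))
  neg' f := by
    have h : ∀ x : Bdot 3, grad (-f : X) x = - grad f x := fun x => by
      have := grad_smul (-1) x.2.1 (f.2.diff x.2)
      rw [neg_one_smul, neg_one_smul] at this
      exact this
    simp only [normX, h, norm_neg]
  eq_zero_of_map_eq_zero' f hf := by
    refine Subtype.ext (eq_zero_of_grad f.2.isCS f.2.map_zero (fun x hx => f.2.diff hx) ?_)
    intro x hx
    have h := le_ciSup (bddX f) ⟨x, hx⟩
    exact norm_le_zero_iff.1 (h.trans_eq hf)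

def normYAux : AddGroupNorm Y where
  toFun := normY
  map_zero' := by
    have := nonempty_Bdot
    have : ∀ x, grad (0 : Y) x = 0 := grad_zero
    simp [normY, this]
  add_le' f g := by
    have := nonempty_Bdot
    refine ciSup_le fun x => ?_
    have h : grad (f + g : Y) x = grad f x + grad g x :=
      grad_add x.2.1 (f.2.diff x.2.1) (g.2.diff x.2.1)
    rw [h]
    refine le_trans ?_ (add_le_add (le_ciSup (bddY f) x) (le_ciSup (bddY g) x))
    rw [← add_div]
    exact div_le_div_of_nonneg_right (norm_add_le _ _) (norm_nonneg _)
  neg' f := by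
    have h : ∀ x : Bdot 3, grad (-f : Y) x = - grad f x := fun x => by
      have := grad_smul (-1) x.2.1 (f.2.diff x.2.1)
      rw [neg_one_smul, neg_one_smul] at this
      exact this
    simp only [normY, h, norm_neg]
  eq_zero_of_map_eq_zero' f hf := by
    refine Subtype.ext (eq_zero_of_grad f.2.isCS f.2.map_zero (fun x hx => f.2.diff hx.1) ?_)
    intro x hx
    have h := (le_ciSup (bddY f) ⟨x, hx⟩).trans_eq hf
    have h2 := (div_le_iff₀ (norm_pos_iff.2 hx.2)).1 h
    rw [zero_mul] at h2
    exact norm_le_zero_iff.1 h2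

instance : NormedAddCommGroup X := normXAux.toNormedAddCommGroup
instance : NormedAddCommGroup Y := normYAux.toNormedAddCommGroup

theorem X.norm_def (f : X) : ‖f‖ = ⨆ x : Bdot 3, ‖grad f x‖ := rfl

theorem Y.norm_def (f : Y) : ‖f‖ = ⨆ x : Bdot 3, ‖grad f x‖ / ‖(x : E3)‖ := rfl

instance : NormedSpace ℝ X where
  norm_smul_le c f := by
    have := nonempty_Bdot
    rw [X.norm_def, X.norm_def]
    refine ciSup_le fun x => ?_
    have h : grad (c • f : X) x = c • grad f x := grad_smul c x.2.1 (f.2.diff x.2)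
    rw [h, norm_smul]
    exact mul_le_mul_of_nonneg_left (le_ciSup (bddX f) x) (norm_nonneg c)

instance : NormedSpace ℝ Y where
  norm_smul_le c f := by
    have := nonempty_Bdot
    rw [Y.norm_def, Y.norm_def]
    refine ciSup_le fun x => ?_
    have h : grad (c • f : Y) x = c • grad f x := grad_smul c x.2.1 (f.2.diff x.2.1)
    rw [h, norm_smul, mul_div_assoc]
    exact mul_le_mul_of_nonneg_left (le_ciSup (bddY f) x) (norm_nonneg c)

/-! ### The assumptions on the ansatz -/

/-- `φ ≥ 0` is locally in `L^p` for some `p > 2`, vanishes a.e. above the cut-off energy `E₀`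
and is positive a.e. below it. -/
structure EnergyProfile (φ : ℝ → ℝ) (E₀ : ℝ) : Prop where
  nonneg : ∀ E, 0 ≤ φ E
  memLp : ∃ p : ENNReal, 2 < p ∧ ∀ K : Set ℝ, IsCompact K → MemLp φ p (volume.restrict K)
  zero_above : ∀ᵐ E : ℝ, E₀ ≤ E → φ E = 0
  pos_below : ∀ᵐ E : ℝ, E < E₀ → 0 < φ E

/-- `ψ ≥ 0` is of class `C^2` with `ψ'(0) = 0`, and takes the value `1` exactly at `0`. -/
structure MomentumProfile (ψ : ℝ → ℝ) : Prop where
  nonneg : ∀ P, 0 ≤ ψ P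
  contDiff : ContDiff ℝ 2 ψ
  deriv_zero : deriv ψ 0 = 0
  eq_one_iff : ∀ P, ψ P = 1 ↔ P = 0

/-- `(f₀, ρ₀, U₀)` with `f₀(x,v) = φ(|v|²/2 + U₀(x))` is a spherically symmetric steady state
of the Vlasov-Poisson system, with `supp ρ₀ = B_1` (so it is nontrivial) and the regularity and
boundary condition at infinity that are required.  As a function of the particle energy alone,
`f₀` is constant along the characteristics `x' = v`, `v' = -∇U₀(x)`, which is the Vlasov
equation; what remains of the system are the density equation and the Poisson equation. -/
structure SphericalSteadyState (φ : ℝ → ℝ) (f₀ : E3 → E3 → ℝ) (ρ₀ U₀ : E3 → ℝ) : Prop where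
  ansatz : ∀ x v, f₀ x v = φ (‖v‖ ^ 2 / 2 + U₀ x)
  density : ∀ x, ρ₀ x = ∫ v : E3, f₀ x v
  poisson : ∀ x, Laplacian.laplacian U₀ x = 4 * Real.pi * ρ₀ x
  radial_density : ∀ x y : E3, ‖x‖ = ‖y‖ → ρ₀ x = ρ₀ y
  radial_potential : ∀ x y : E3, ‖x‖ = ‖y‖ → U₀ x = U₀ y
  contDiff_density : ContDiff ℝ 1 ρ₀
  support_density : tsupport ρ₀ = B 1
  contDiff_potential : ContDiff ℝ 2 U₀
  potential_at_infinity : Tendsto U₀ (cocompact E3) (𝓝 0)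

/-! ### The operator `T` -/

/-- Distance from the third axis. -/
def axisDist (x : E3) : ℝ := Real.sqrt (x 0 ^ 2 + x 1 ^ 2)

/-- The function `h(γ, r, u)` that gives the spatial density induced by the ansatz. -/
def h (φ ψ : ℝ → ℝ) (E₀ γ r u : ℝ) : ℝ :=
  if u < E₀ then
    2 * Real.pi * ∫ E in u..E₀, φ E *
      ∫ s in (-Real.sqrt (2 * (E - u)))..(Real.sqrt (2 * (E - u))), ψ (γ * r * s)
  else 0

/-- The deformation `g_ζ(x) = x + ζ(x) x / |x|` (and `g_ζ(0) = 0`). -/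
def deform (ζ : E3 → ℝ) (x : E3) : E3 := x + (ζ x / ‖x‖) • x

/-- The inverse of `g_ζ : B_3 → g_ζ(B_3)`. -/
def deformInv (ζ : E3 → ℝ) : E3 → E3 := Function.invFunOn (deform ζ) (B 3)

/-- The function `T(γ, ζ)` on `B_3` (extended by zero). -/
def T (φ ψ : ℝ → ℝ) (E₀ : ℝ) (U₀ : E3 → ℝ) (γ : ℝ) (ζ : E3 → ℝ) : E3 → ℝ :=
  (B 3).indicator fun x =>
    U₀ x + (∫ y in B 2, h φ ψ E₀ γ (axisDist y) (U₀ (deformInv ζ y)) / ‖deform ζ x - y‖)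
      - U₀ 0 - ∫ y in B 2, h φ ψ E₀ γ (axisDist y) (U₀ (deformInv ζ y)) / ‖y‖

open scoped Classical in
/-- `T(γ, ·)` as a map from `X` to `Y`.  (The value is the function `T(γ, ζ)` wherever that
function belongs to `Y`; the value `0` elsewhere is a mere convention.) -/
def TMap (φ ψ : ℝ → ℝ) (E₀ : ℝ) (U₀ : E3 → ℝ) (γ : ℝ) (ζ : X) : Y :=
  if hT : MemY (T φ ψ E₀ U₀ γ ζ) then ⟨T φ ψ E₀ U₀ γ ζ, hT⟩ else 0

end AxialVP

end

/-!
With `σ(y) = h(0, r(y), U₀(g_ζ⁻¹(y))) - ρ₀(y)` on `B_2`, and since `h(0, r, u)` is the density as a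
function of the potential (`h_zero_eq`) and `U₀ = -newton ρ₀`, the operator takes the form

`T(0, ζ) = (U₀ - U₀(0)) - (U₀ ∘ g_ζ - U₀(0)) + (newton σ ∘ g_ζ - newton σ 0)`   (`T_eq`).

If `R` and `V` denote the radial profiles of `ρ₀` and `U₀`, then `σ = R(|g_ζ⁻¹(y)|) - R(|y|)` is of
size `‖ζ‖ |y|`. Densities which are bounded by a multiple of `|y|` and even have fields that are
bounded by a multiple of `|x|`, differentiable at the origin and Hölder continuous in a way that
respects scaling (`IsLinSource.norm_field_le`, `IsLinSource.norm_field_sub_fieldDeriv_le`,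
`IsLinSource.norm_field_sub_le`). Hence their potentials are of class `Y`, also after composition
with `g_ζ`, and so is `T(0, ζ)`. Expanding `R` and `V'` to first order gives the derivative
`L ζ = K(V'ζ) - V'ζ` with `K w = newton (q w) - newton (q w) 0` and `q = -R'/V'`
(`RadialProfiles.hasFDerivAt_TMap`). Here `q` is bounded: for `φ` in `L^p` with `p > 2` the density
is a Lipschitz function of the potential (`densityOf_lipschitz`).

Since `V'(r)` is comparable to `r`, multiplication by `V'(|x|)` is an isomorphism of `X` onto `Y`,
and it remains to solve `w - K w = f` in `Y`. The operator `K` is compact on the continuous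
functions with the symmetries of the problem, so that uniqueness implies existence by the Fredholm
alternative (`RadialProfiles.exists_solution`); the equation itself then puts the solution into `Y`
(`RadialProfiles.exists_preimage`).

Uniqueness (`RadialProfiles.eq_zero_of_linearized`) does not need an expansion into spherical
harmonics. The derivative `∂₃U₀` of the potential solves `w = newton (q w)`, by translation
invariance, and has a sign in the half space `x₃ > 0`. As for the ground state of a Schrödinger
operator, every solution that is odd in `x₃` is a multiple of it
(`RadialProfiles.exists_eq_mul_dU3`). If `w = K w` has the symmetries of the problem, then the
difference of the rotations of `w` about the first axis by `θ` and by `-θ` is such an odd solution,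
and vanishes on the third axis; so it vanishes identically, and `w` is radial. For radial `w`,
Newton's shell theorem (`newton_radial`) turns the equation into a Volterra equation with the
normalization `w(0) = 0`, and hence `w = 0` (`RadialProfiles.eq_zero_of_radial`).
-/

noncomputable section

namespace AxialVP

/-! ### Estimates for the Newtonian kernel -/

/-- The vector field `z / |z|³`, the negative gradient of `1 / |z|`. -/
def riesz (z : E3) : E3 := (‖z‖⁻¹ ^ 3) • z

/-- The derivative of `riesz` at `b`, applied to `z`. -/
def rieszDeriv (b z : E3) : E3 := (‖b‖⁻¹ ^ 3) • z - (3 * ‖b‖⁻¹ ^ 5 * inner ℝ b z) • b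

/-- The kernel `1 + |z|^(-5/2)`. It is locally integrable in dimension three, and the exponent
leaves room for the half power of a distance that is gained in the Hölder estimates below; it
dominates all singular kernels of the argument. -/
def J (z : E3) : ℝ := 1 + (√‖z‖)⁻¹ ^ 5

theorem one_le_J (z : E3) : 1 ≤ J z := by
  have : 0 ≤ (√‖z‖)⁻¹ ^ 5 := by positivity
  unfold J; linarith

theorem J_nonneg (z : E3) : 0 ≤ J z := zero_le_one.trans (one_le_J z)

theorem inv_sqrt_sq (z : E3) : (√‖z‖)⁻¹ ^ 2 = ‖z‖⁻¹ := by
  rw [inv_pow, Real.sq_sqrt (norm_nonneg z)]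

theorem pow_le_one_add_pow_five {p : ℝ} (hp : 0 ≤ p) {k : ℕ} (hk : k ≤ 5) : p ^ k ≤ 1 + p ^ 5 := by
  rcases le_total p 1 with h | h
  · have := pow_le_one₀ hp h (n := k)
    have : 0 ≤ p ^ 5 := by positivity
    linarith
  · have := pow_le_pow_right₀ h hk
    linarith

theorem inv_norm_le_J (z : E3) : ‖z‖⁻¹ ≤ J z := by
  rw [← inv_sqrt_sq]
  exact pow_le_one_add_pow_five (by positivity) (by norm_num)

theorem inv_norm_sq_le_J (z : E3) : ‖z‖⁻¹ ^ 2 ≤ J z := by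
  rw [← inv_sqrt_sq, ← pow_mul]
  exact pow_le_one_add_pow_five (by positivity) (by norm_num)

theorem norm_riesz (z : E3) : ‖riesz z‖ = ‖z‖⁻¹ ^ 2 := by
  rcases eq_or_ne z 0 with rfl | hz
  · simp [riesz]
  · have : ‖z‖ ≠ 0 := norm_ne_zero_iff.2 hz
    rw [riesz, norm_smul, Real.norm_of_nonneg (by positivity)]
    field_simp

theorem riesz_neg (z : E3) : riesz (-z) = - riesz z := by simp [riesz]

theorem rieszDeriv_smul (b z : E3) (c : ℝ) : rieszDeriv b (c • z) = c • rieszDeriv b z := by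
  simp only [rieszDeriv, inner_smul_right, smul_sub, smul_smul]
  congr 2 <;> ring

theorem norm_rieszDeriv_le (b z : E3) : ‖rieszDeriv b z‖ ≤ 4 * ‖b‖⁻¹ ^ 3 * ‖z‖ := by
  rcases eq_or_ne b 0 with rfl | hb
  · simp [rieszDeriv]
  have h0 : 0 < ‖b‖ := norm_pos_iff.2 hb
  refine (norm_sub_le _ _).trans ?_
  rw [norm_smul, norm_smul, Real.norm_eq_abs, Real.norm_eq_abs, abs_mul, abs_mul,
    abs_of_nonneg (by positivity : (0:ℝ) ≤ ‖b‖⁻¹ ^ 3),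
    abs_of_nonneg (by positivity : (0:ℝ) ≤ ‖b‖⁻¹ ^ 5)]
  have h1 := abs_real_inner_le_norm b z
  have h2 : |(3:ℝ)| * ‖b‖⁻¹ ^ 5 * |inner ℝ b z| * ‖b‖ ≤ 3 * ‖b‖⁻¹ ^ 5 * (‖b‖ * ‖z‖) * ‖b‖ := by
    rw [abs_of_pos (by norm_num : (0:ℝ) < 3)]
    gcongr
  have h3 : 3 * ‖b‖⁻¹ ^ 5 * (‖b‖ * ‖z‖) * ‖b‖ = 3 * ‖b‖⁻¹ ^ 3 * ‖z‖ := by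
    field_simp
  linarith

/-- A quantity bounded both by `c y t²` and by `c y` is bounded by `c y t`. -/
theorem le_of_le_sq_of_le {E c y t : ℝ} (hc : 0 ≤ c) (hy : 0 ≤ y) (ht : 0 ≤ t)
    (h1 : E ≤ c * y * t ^ 2) (h2 : E ≤ c * y) : E ≤ c * y * t := by
  have hcy := mul_nonneg hc hy
  rcases le_total t 1 with h | h
  · refine h1.trans (mul_le_mul_of_nonneg_left ?_ hcy)
    nlinarith
  · refine h2.trans ?_
    nlinarith

theorem abs_inv_norm_sub_le {a b : E3} (ha : a ≠ 0) (hb : b ≠ 0) :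
    |‖a‖⁻¹ - ‖b‖⁻¹| ≤ ‖a - b‖ * (‖a‖⁻¹ * ‖b‖⁻¹) := by
  have ha0 : 0 < ‖a‖ := norm_pos_iff.2 ha
  have hb0 : 0 < ‖b‖ := norm_pos_iff.2 hb
  rw [inv_sub_inv ha0.ne' hb0.ne', abs_div, abs_of_pos (mul_pos ha0 hb0), div_eq_mul_inv, mul_inv]
  gcongr
  rw [abs_sub_comm]
  exact abs_norm_sub_norm_le a b

/-- The inversion `z ↦ z / |z|²` changes distances by the factor `1 / (|a| |b|)`; this gives the
Lipschitz estimate for `riesz` with the mildest possible singularities. -/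
theorem norm_riesz_sub_le {a b : E3} (ha : a ≠ 0) (hb : b ≠ 0) :
    ‖riesz a - riesz b‖ ≤ ‖a - b‖ * (‖a‖⁻¹ * ‖b‖⁻¹ * (‖a‖⁻¹ + ‖b‖⁻¹)) := by
  have ha0 : 0 < ‖a‖ := norm_pos_iff.2 ha
  have hb0 : 0 < ‖b‖ := norm_pos_iff.2 hb
  have h1 := dist_div_norm_sq_smul ha hb 1
  rw [dist_eq_norm, dist_eq_norm] at h1
  have h2 : riesz a - riesz b = ‖a‖⁻¹ • ((1 / ‖a‖) ^ 2 • a - (1 / ‖b‖) ^ 2 • b)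
      + ((‖a‖⁻¹ - ‖b‖⁻¹) * ‖b‖⁻¹ ^ 2) • b := by
    simp only [riesz, smul_sub, smul_smul, one_div]
    module
  rw [h2]
  refine (norm_add_le _ _).trans ?_
  rw [norm_smul, norm_smul, h1, norm_inv, norm_norm, Real.norm_eq_abs, abs_mul,
    abs_of_nonneg (by positivity : 0 ≤ ‖b‖⁻¹ ^ 2)]
  have h3 : |‖a‖⁻¹ - ‖b‖⁻¹| * ‖b‖⁻¹ ^ 2 * ‖b‖ ≤
      ‖a - b‖ * (‖a‖⁻¹ * ‖b‖⁻¹) * ‖b‖⁻¹ ^ 2 * ‖b‖ := by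
    gcongr
    exact abs_inv_norm_sub_le ha hb
  refine (add_le_add_right h3 _).trans (le_of_eq ?_)
  field_simp

theorem inv_norm_add_le_sq (a b : E3) :
    ‖a‖⁻¹ + ‖b‖⁻¹ ≤ ((√‖a‖)⁻¹ + (√‖b‖)⁻¹) ^ 2 := by
  rw [← inv_sqrt_sq a, ← inv_sqrt_sq b]
  have : 0 ≤ (√‖a‖)⁻¹ * (√‖b‖)⁻¹ := by positivity
  nlinarith

theorem add_pow_five_le_J (a b : E3) :
    ((√‖a‖)⁻¹ + (√‖b‖)⁻¹) ^ 5 ≤ 16 * (J a + J b) := by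
  refine (add_pow_le (by positivity) (by positivity) 5).trans ?_
  have : J a + J b = (√‖a‖)⁻¹ ^ 5 + (√‖b‖)⁻¹ ^ 5 + 2 := by unfold J; ring
  linarith

/-- Interpolation between an estimate of order `k + 2` and one of order `k` in the square root of
the distance. -/
theorem le_interp {a b : E3} {E c D : ℝ} (k : ℕ) (hc : 0 ≤ c)
    (hD : ‖a - b‖ = D)
    (h1 : E ≤ c * (D ^ (k + 1) * (‖a‖⁻¹ + ‖b‖⁻¹) ^ 3))
    (h2 : E ≤ c * (D ^ k * (‖a‖⁻¹ + ‖b‖⁻¹) ^ 2)) :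
    E ≤ 16 * c * (D ^ k * √D) * (J a + J b) := by
  have hD0 : 0 ≤ D := hD ▸ norm_nonneg _
  set n := (√‖a‖)⁻¹ + (√‖b‖)⁻¹ with hn
  have hn0 : 0 ≤ n := by positivity
  have hs := inv_norm_add_le_sq a b
  have hP : 0 ≤ ‖a‖⁻¹ + ‖b‖⁻¹ := by positivity
  have h1' : E ≤ c * (D ^ k * n ^ 4) * (√D * n) ^ 2 := by
    refine h1.trans ?_
    have : c * (D ^ k * n ^ 4) * (√D * n) ^ 2 = c * (D ^ (k + 1) * (n ^ 2) ^ 3) := by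
      rw [mul_pow, Real.sq_sqrt hD0]; ring
    rw [this]
    gcongr
  have h2' : E ≤ c * (D ^ k * n ^ 4) := by
    refine h2.trans ?_
    have : n ^ 4 = (n ^ 2) ^ 2 := by ring
    rw [this]
    gcongr
  -- two powers of `√D * n` are available in the first bound and none in the second
  have h3 := le_of_le_sq_of_le hc (by positivity) (by positivity) h1' h2'
  have h4 := add_pow_five_le_J a b
  calc E ≤ c * (D ^ k * √D) * n ^ 5 := h3.trans (le_of_eq (by ring))
    _ ≤ c * (D ^ k * √D) * (16 * (J a + J b)) := by gcongr
    _ = _ := by ring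

/-- Hölder estimate of order `1/2` for `riesz`, with an integrable weight. -/
theorem norm_riesz_sub_le_sqrt {a b : E3} (ha : a ≠ 0) (hb : b ≠ 0) :
    ‖riesz a - riesz b‖ ≤ 16 * √‖a - b‖ * (J a + J b) := by
  have := le_interp (E := ‖riesz a - riesz b‖) (c := 1) 0 zero_le_one rfl ?_ ?_
    (a := a) (b := b)
  · simpa using this
  · refine (norm_riesz_sub_le ha hb).trans ?_
    rw [one_mul, zero_add, pow_one]
    have h1 : 0 ≤ ‖a‖⁻¹ := by positivity
    have h2 : 0 ≤ ‖b‖⁻¹ := by positivity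
    gcongr
    have := mul_nonneg h1 h2
    nlinarith [mul_nonneg this h1, mul_nonneg this h2, pow_nonneg h1 3, pow_nonneg h2 3]
  · refine (norm_sub_le _ _).trans ?_
    rw [norm_riesz, norm_riesz]
    have : 0 ≤ ‖a‖⁻¹ * ‖b‖⁻¹ := by positivity
    nlinarith

theorem inner_sub_eq (a b : E3) : inner ℝ b (a - b) = (‖a‖ ^ 2 - ‖b‖ ^ 2 - ‖a - b‖ ^ 2) / 2 := by
  have h := norm_add_sq_real b (a - b)
  rw [add_sub_cancel] at h
  linarith

/-- First-order Taylor estimate for `1 / |z|`. -/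
theorem abs_inv_norm_taylor {a b : E3} (ha : a ≠ 0) (hb : b ≠ 0) :
    |‖a‖⁻¹ - ‖b‖⁻¹ + inner ℝ (riesz b) (a - b)| ≤ 16 * (‖a - b‖ * √‖a - b‖) * (J a + J b) := by
  have ha0 : 0 < ‖a‖ := norm_pos_iff.2 ha
  have hb0 : 0 < ‖b‖ := norm_pos_iff.2 hb
  have hP : 0 < ‖a‖⁻¹ := inv_pos.2 ha0
  have hM : 0 < ‖b‖⁻¹ := inv_pos.2 hb0
  have := le_interp (E := |‖a‖⁻¹ - ‖b‖⁻¹ + inner ℝ (riesz b) (a - b)|) (c := 1) 1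
    zero_le_one rfl ?_ ?_ (a := a) (b := b)
  · simpa using this
  · have hd : |‖a‖ - ‖b‖| ≤ ‖a - b‖ := abs_norm_sub_norm_le a b
    have hd2 : (‖a‖ - ‖b‖) ^ 2 ≤ ‖a - b‖ ^ 2 :=
      sq_le_sq' (by linarith [abs_le.1 hd]) (abs_le.1 hd).2
    rw [riesz, inner_smul_left, inner_sub_eq]
    have e : ‖a‖⁻¹ - ‖b‖⁻¹ + (starRingEnd ℝ) (‖b‖⁻¹ ^ 3) * ((‖a‖ ^ 2 - ‖b‖ ^ 2 - ‖a - b‖ ^ 2) / 2)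
        = (‖a‖ - ‖b‖) ^ 2 * (‖b‖⁻¹ ^ 3 / 2 + ‖a‖⁻¹ * ‖b‖⁻¹ ^ 2) -
          ‖a - b‖ ^ 2 * (‖b‖⁻¹ ^ 3 / 2) := by
      simp only [conj_trivial]
      field_simp
      ring
    rw [e]
    refine (abs_sub _ _).trans ?_
    rw [abs_of_nonneg (by positivity), abs_of_nonneg (by positivity)]
    have h1 : (‖a‖ - ‖b‖) ^ 2 * (‖b‖⁻¹ ^ 3 / 2 + ‖a‖⁻¹ * ‖b‖⁻¹ ^ 2) ≤
        ‖a - b‖ ^ 2 * (‖b‖⁻¹ ^ 3 / 2 + ‖a‖⁻¹ * ‖b‖⁻¹ ^ 2) := by gcongr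
    have h2 : ‖b‖⁻¹ ^ 3 + ‖a‖⁻¹ * ‖b‖⁻¹ ^ 2 ≤ (‖a‖⁻¹ + ‖b‖⁻¹) ^ 3 := by
      have := mul_pos hP hM
      nlinarith [mul_pos this hP, mul_pos this hM, pow_pos hP 3]
    calc _ ≤ ‖a - b‖ ^ 2 * (‖b‖⁻¹ ^ 3 + ‖a‖⁻¹ * ‖b‖⁻¹ ^ 2) := by linarith
      _ ≤ _ := by rw [one_mul]; gcongr
  · refine (abs_add_le _ _).trans ?_
    have h1 := abs_inv_norm_sub_le ha hb
    have h2 := abs_real_inner_le_norm (riesz b) (a - b)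
    rw [norm_riesz] at h2
    have h3 : ‖a‖⁻¹ * ‖b‖⁻¹ + ‖b‖⁻¹ ^ 2 ≤ (‖a‖⁻¹ + ‖b‖⁻¹) ^ 2 := by
      have := mul_pos hP hM
      nlinarith [pow_pos hP 2]
    calc _ ≤ ‖a - b‖ * (‖a‖⁻¹ * ‖b‖⁻¹ + ‖b‖⁻¹ ^ 2) := by linarith
      _ ≤ _ := by rw [one_mul, pow_one]; gcongr

/-- The scalar identity behind the Taylor estimate for `riesz`: the second-order remainder of
`r ↦ r⁻³` after insertion of the law of cosines. -/
theorem cube_remainder {r s d : ℝ} (hr : 0 < r) (hs : 0 < s) :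
    r⁻¹ ^ 3 - s⁻¹ ^ 3 + 3 * s⁻¹ ^ 5 * ((r ^ 2 - s ^ 2 - d ^ 2) / 2) =
      (r - s) ^ 2 * s⁻¹ ^ 2 * (3 / 2 * s⁻¹ ^ 3 + r⁻¹ * (3 * s⁻¹ ^ 2 + 2 * r⁻¹ * s⁻¹ + r⁻¹ ^ 2))
        - d ^ 2 * (3 / 2 * s⁻¹ ^ 5) := by
  field_simp
  ring

/-- First-order Taylor estimate for `riesz`, with the weight `|b|`. -/
theorem norm_riesz_taylor {a b : E3} (ha : a ≠ 0) (hb : b ≠ 0) :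
    ‖b‖ * ‖riesz a - riesz b - rieszDeriv b (a - b)‖ ≤
      64 * (‖a - b‖ * √‖a - b‖) * (J a + J b) := by
  have ha0 : 0 < ‖a‖ := norm_pos_iff.2 ha
  have hb0 : 0 < ‖b‖ := norm_pos_iff.2 hb
  have hP : 0 < ‖a‖⁻¹ := inv_pos.2 ha0
  have hM : 0 < ‖b‖⁻¹ := inv_pos.2 hb0
  have hPM := mul_pos hP hM
  have := le_interp (E := ‖b‖ * ‖riesz a - riesz b - rieszDeriv b (a - b)‖) (c := 4) 1
    (by norm_num) rfl ?_ ?_ (a := a) (b := b)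
  · refine this.trans (le_of_eq ?_)
    ring
  · have hd : |‖a‖ - ‖b‖| ≤ ‖a - b‖ := abs_norm_sub_norm_le a b
    have hd2 : (‖a‖ - ‖b‖) ^ 2 ≤ ‖a - b‖ ^ 2 :=
      sq_le_sq' (by linarith [abs_le.1 hd]) (abs_le.1 hd).2
    have e : riesz a - riesz b - rieszDeriv b (a - b) = (‖a‖⁻¹ ^ 3 - ‖b‖⁻¹ ^ 3) • (a - b) +
        (‖a‖⁻¹ ^ 3 - ‖b‖⁻¹ ^ 3 + 3 * ‖b‖⁻¹ ^ 5 * inner ℝ b (a - b)) • b := by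
      simp only [riesz, rieszDeriv]
      module
    have h0 : ‖riesz a - riesz b - rieszDeriv b (a - b)‖ ≤
        |‖a‖⁻¹ ^ 3 - ‖b‖⁻¹ ^ 3| * ‖a - b‖ +
        |‖a‖⁻¹ ^ 3 - ‖b‖⁻¹ ^ 3 + 3 * ‖b‖⁻¹ ^ 5 * inner ℝ b (a - b)| * ‖b‖ := by
      rw [e]
      refine (norm_add_le _ _).trans ?_
      rw [norm_smul, norm_smul, Real.norm_eq_abs, Real.norm_eq_abs]
    have h1 : |‖a‖⁻¹ ^ 3 - ‖b‖⁻¹ ^ 3| ≤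
        ‖a - b‖ * (‖a‖⁻¹ * ‖b‖⁻¹) * (‖a‖⁻¹ ^ 2 + ‖a‖⁻¹ * ‖b‖⁻¹ + ‖b‖⁻¹ ^ 2) := by
      have : ‖a‖⁻¹ ^ 3 - ‖b‖⁻¹ ^ 3 =
          (‖a‖⁻¹ - ‖b‖⁻¹) * (‖a‖⁻¹ ^ 2 + ‖a‖⁻¹ * ‖b‖⁻¹ + ‖b‖⁻¹ ^ 2) := by ring
      rw [this, abs_mul, abs_of_pos (by positivity : 0 < ‖a‖⁻¹ ^ 2 + ‖a‖⁻¹ * ‖b‖⁻¹ + ‖b‖⁻¹ ^ 2)]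
      gcongr
      exact abs_inv_norm_sub_le ha hb
    have h2 : |‖a‖⁻¹ ^ 3 - ‖b‖⁻¹ ^ 3 + 3 * ‖b‖⁻¹ ^ 5 * inner ℝ b (a - b)| ≤
        ‖a - b‖ ^ 2 * ‖b‖⁻¹ ^ 2 *
          (3 * ‖b‖⁻¹ ^ 3 + ‖a‖⁻¹ * (3 * ‖b‖⁻¹ ^ 2 + 2 * ‖a‖⁻¹ * ‖b‖⁻¹ + ‖a‖⁻¹ ^ 2)) := by
      rw [inner_sub_eq, cube_remainder ha0 hb0]
      refine (abs_sub _ _).trans ?_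
      rw [abs_of_nonneg (by positivity), abs_of_nonneg (by positivity)]
      have : (‖a‖ - ‖b‖) ^ 2 * ‖b‖⁻¹ ^ 2 *
          (3 / 2 * ‖b‖⁻¹ ^ 3 + ‖a‖⁻¹ * (3 * ‖b‖⁻¹ ^ 2 + 2 * ‖a‖⁻¹ * ‖b‖⁻¹ + ‖a‖⁻¹ ^ 2)) ≤
          ‖a - b‖ ^ 2 * ‖b‖⁻¹ ^ 2 *
          (3 / 2 * ‖b‖⁻¹ ^ 3 + ‖a‖⁻¹ * (3 * ‖b‖⁻¹ ^ 2 + 2 * ‖a‖⁻¹ * ‖b‖⁻¹ + ‖a‖⁻¹ ^ 2)) := by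
        gcongr
      refine (add_le_add_left this _).trans (le_of_eq ?_)
      ring
    calc ‖b‖ * ‖riesz a - riesz b - rieszDeriv b (a - b)‖
        ≤ ‖b‖ * (‖a - b‖ * (‖a‖⁻¹ * ‖b‖⁻¹) * (‖a‖⁻¹ ^ 2 + ‖a‖⁻¹ * ‖b‖⁻¹ + ‖b‖⁻¹ ^ 2) * ‖a - b‖ +
          ‖a - b‖ ^ 2 * ‖b‖⁻¹ ^ 2 *
          (3 * ‖b‖⁻¹ ^ 3 + ‖a‖⁻¹ * (3 * ‖b‖⁻¹ ^ 2 + 2 * ‖a‖⁻¹ * ‖b‖⁻¹ + ‖a‖⁻¹ ^ 2)) * ‖b‖) := by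
          gcongr
          refine h0.trans ?_
          gcongr
      _ = ‖a - b‖ ^ 2 * (2 * ‖a‖⁻¹ ^ 3 + 3 * (‖a‖⁻¹ ^ 2 * ‖b‖⁻¹) + 4 * (‖a‖⁻¹ * ‖b‖⁻¹ ^ 2)
            + 3 * ‖b‖⁻¹ ^ 3) := by
          field_simp
          ring
      _ ≤ 4 * (‖a - b‖ ^ (1 + 1) * (‖a‖⁻¹ + ‖b‖⁻¹) ^ 3) := by
          have e2 : 4 * (‖a - b‖ ^ (1 + 1) * (‖a‖⁻¹ + ‖b‖⁻¹) ^ 3) =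
            ‖a - b‖ ^ 2 * (4 * (‖a‖⁻¹ + ‖b‖⁻¹) ^ 3) := by ring
          rw [e2]
          refine mul_le_mul_of_nonneg_left ?_ (by positivity)
          nlinarith [mul_pos hPM hP, mul_pos hPM hM, pow_pos hP 3, pow_pos hM 3]
  · have h1 := norm_riesz_sub_le ha hb
    have h2 := norm_rieszDeriv_le b (a - b)
    calc ‖b‖ * ‖riesz a - riesz b - rieszDeriv b (a - b)‖
        ≤ ‖b‖ * (‖a - b‖ * (‖a‖⁻¹ * ‖b‖⁻¹ * (‖a‖⁻¹ + ‖b‖⁻¹)) + 4 * ‖b‖⁻¹ ^ 3 * ‖a - b‖) := by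
          gcongr
          exact (norm_sub_le _ _).trans (add_le_add h1 h2)
      _ = ‖a - b‖ * (‖a‖⁻¹ * ‖b‖⁻¹ + ‖a‖⁻¹ ^ 2 + 4 * ‖b‖⁻¹ ^ 2) := by
          field_simp
          ring
      _ ≤ 4 * (‖a - b‖ ^ 1 * (‖a‖⁻¹ + ‖b‖⁻¹) ^ 2) := by
          rw [mul_left_comm, pow_one]
          refine mul_le_mul_of_nonneg_left ?_ (norm_nonneg _)
          nlinarith [pow_pos hP 2]

/-! ### Potentials of bounded densities -/

@[fun_prop]
theorem measurable_J : Measurable J := by unfold J; fun_prop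

@[fun_prop]
theorem measurable_riesz : Measurable riesz := by unfold riesz; fun_prop

theorem integrableOn_J_ball (r : ℝ) : IntegrableOn J (Metric.ball 0 r) := by
  have h := integrableOn_fun_norm_addHaar (E := E3) volume
    (f := fun t : ℝ => 1 + (√t)⁻¹ ^ 5) (r := r)
  refine h.2 ?_
  have hd : Module.finrank ℝ E3 - 1 = 2 := by simp
  rw [hd]
  have h1 : IntegrableOn (fun t : ℝ => t ^ 2 + t ^ (-(1 / 2) : ℝ)) (Ioo 0 r) := by
    refine Integrable.add ?_ ?_
    · exact (continuous_pow 2).integrableOn_Icc.mono_set Ioo_subset_Icc_self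
    · rcases le_total r 0 with hr | hr
      · simp [Ioo_eq_empty_of_le hr]
      · exact ((intervalIntegrable_iff_integrableOn_Ioo_of_le hr).1
          (intervalIntegral.intervalIntegrable_rpow' (by norm_num)))
  refine h1.congr_fun (fun t ht => ?_) measurableSet_Ioo
  have ht0 : 0 < t := ht.1
  have hs : 0 < √t := Real.sqrt_pos.2 ht0
  have h2 : t ^ (-(1 / 2) : ℝ) = (√t)⁻¹ := by rw [Real.rpow_neg ht0.le, Real.sqrt_eq_rpow]
  simp only [h2, smul_eq_mul]
  -- in polar coordinates `|z|^(-5/2)` becomes `t^2 * t^(-5/2) = t^(-1/2)`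
  have h3 : t = √t ^ 2 := (Real.sq_sqrt ht0.le).symm
  generalize √t = s at *
  subst h3
  field_simp

/-- A bound for the integrals of the translates of `J` over `B_2`. -/
def CJ : ℝ := (∫ z in Metric.ball (0 : E3) 1, J z) + 2 * volume.real (B 2)

theorem J_le (z : E3) : J z ≤ (Metric.ball (0 : E3) 1).indicator J z + 2 := by
  by_cases hz : z ∈ Metric.ball (0 : E3) 1
  · rw [indicator_of_mem hz]; linarith
  · rw [indicator_of_notMem hz]
    have h1 : 1 ≤ ‖z‖ := by simpa using hz
    have h2 : (√‖z‖)⁻¹ ≤ 1 := inv_le_one_of_one_le₀ (Real.one_le_sqrt.2 h1)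
    have h3 : (√‖z‖)⁻¹ ^ 5 ≤ 1 := pow_le_one₀ (by positivity) h2
    unfold J; linarith

theorem measurableSet_B (r : ℝ) : MeasurableSet (B r) := Metric.isClosed_closedBall.measurableSet

theorem volume_B_ne_top (r : ℝ) : volume (B r) ≠ ⊤ := measure_closedBall_lt_top.ne

theorem integrableOn_J (x : E3) :
    IntegrableOn (fun y => J (x - y)) (B 2) ∧ ∫ y in B 2, J (x - y) ≤ CJ := by
  have hi : Integrable ((Metric.ball (0 : E3) 1).indicator J) :=
    (integrable_indicator_iff measurableSet_ball).2 (integrableOn_J_ball 1)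
  have h1 : Integrable (fun y => (Metric.ball (0 : E3) 1).indicator J (x - y)) :=
    hi.comp_sub_left x
  have h2 : IntegrableOn (fun y => (Metric.ball (0 : E3) 1).indicator J (x - y) + 2) (B 2) :=
    h1.integrableOn.add (integrableOn_const (volume_B_ne_top 2))
  have h3 : IntegrableOn (fun y => J (x - y)) (B 2) := by
    refine h2.mono' (Measurable.aestronglyMeasurable (by fun_prop)) (.of_forall fun y => ?_)
    rw [Real.norm_of_nonneg (J_nonneg _)]
    exact J_le _
  refine ⟨h3, ?_⟩
  calc ∫ y in B 2, J (x - y)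
      ≤ ∫ y in B 2, ((Metric.ball (0 : E3) 1).indicator J (x - y) + 2) :=
        integral_mono h3 h2 fun y => J_le _
    _ = (∫ y in B 2, (Metric.ball (0 : E3) 1).indicator J (x - y)) + 2 * volume.real (B 2) := by
        rw [integral_add h1.integrableOn (integrableOn_const (volume_B_ne_top 2))]
        simp [mul_comm]
    _ ≤ CJ := by
        unfold CJ
        gcongr
        rw [← integral_indicator measurableSet_ball,
          ← integral_sub_left_eq_self ((Metric.ball (0 : E3) 1).indicator J) volume x]
        refine setIntegral_le_integral h1 (.of_forall fun y => ?_)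
        exact indicator_nonneg (fun z _ => J_nonneg z) _

theorem CJ_nonneg : 0 ≤ CJ :=
  (setIntegral_nonneg (measurableSet_B 2) fun y _ => J_nonneg (0 - y)).trans (integrableOn_J 0).2

theorem ae_sub_ne (a : E3) : ∀ᵐ y : E3, a - y ≠ 0 := by
  filter_upwards [compl_mem_ae_iff.2 (measure_singleton a)] with y hy h
  exact hy (sub_eq_zero.1 h).symm

/-- An integrand supported in `B_2` and dominated by translates of `J` is integrable; the bound does
not depend on the centres `a` and `b`, and it is not required at these two points. -/
theorem integrable_and_norm_integral_le {F : Type*} [NormedAddCommGroup F] [NormedSpace ℝ F]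
    {φ : E3 → F} (hφ : AEStronglyMeasurable φ) {c : ℝ} (hc : 0 ≤ c) (a b : E3)
    (h : ∀ y ∈ B 2, a - y ≠ 0 → b - y ≠ 0 → ‖φ y‖ ≤ c * (J (a - y) + J (b - y)))
    (h0 : ∀ y, y ∉ B 2 → φ y = 0) :
    Integrable φ ∧ ‖∫ y, φ y‖ ≤ c * (2 * CJ) := by
  have hg : IntegrableOn (fun y => c * (J (a - y) + J (b - y))) (B 2) :=
    ((integrableOn_J a).1.add (integrableOn_J b).1).const_mul c
  have hle : ∀ᵐ y ∂(volume.restrict (B 2)), ‖φ y‖ ≤ c * (J (a - y) + J (b - y)) := by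
    rw [ae_restrict_iff' (measurableSet_B 2)]
    filter_upwards [ae_sub_ne a, ae_sub_ne b] with y h1 h2 hy using h y hy h1 h2
  have hi : IntegrableOn φ (B 2) := hg.mono' hφ.restrict hle
  have he : ∫ y, φ y = ∫ y in B 2, φ y := by
    rw [setIntegral_eq_integral_of_forall_compl_eq_zero h0]
  refine ⟨(integrableOn_iff_integrable_of_support_subset fun y hy => ?_).1 hi, ?_⟩
  · by_contra hn
    exact hy (h0 y hn)
  · rw [he]
    refine (norm_integral_le_of_norm_le hg hle).trans ?_
    rw [integral_const_mul, integral_add (integrableOn_J a).1 (integrableOn_J b).1]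
    have := (integrableOn_J a).2
    have := (integrableOn_J b).2
    gcongr
    linarith

/-- The Newtonian potential `∫ f(y) / |x - y| dy`. -/
def newton (f : E3 → ℝ) (x : E3) : ℝ := ∫ y, f y / ‖x - y‖

/-- The gradient of `newton f`, given by its integral representation. -/
def field (f : E3 → ℝ) (x : E3) : E3 := -∫ y, f y • riesz (x - y)

/-- Measurable functions on `B_2` (extended by zero) which are bounded by `A`. -/
structure IsSource (A : ℝ) (f : E3 → ℝ) : Prop where
  meas : AEStronglyMeasurable f
  bound : ∀ y, |f y| ≤ A
  zero : ∀ y, y ∉ B 2 → f y = 0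

theorem IsSource.nonneg {A : ℝ} {f : E3 → ℝ} (hf : IsSource A f) : 0 ≤ A :=
  (abs_nonneg _).trans (hf.bound 0)

theorem IsSource.const_smul {A : ℝ} {f : E3 → ℝ} (hf : IsSource A f) (c : ℝ) :
    IsSource (|c| * A) (c • f) where
  meas := hf.meas.const_smul c
  bound y := by
    rw [Pi.smul_apply, smul_eq_mul, abs_mul]
    exact mul_le_mul_of_nonneg_left (hf.bound y) (abs_nonneg c)
  zero y hy := by simp [hf.zero y hy]

variable {A : ℝ} {f : E3 → ℝ}

theorem IsSource.integrable_newton (hf : IsSource A f) (x : E3) :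
    Integrable (fun y => f y / ‖x - y‖) ∧ |newton f x| ≤ 2 * A * CJ := by
  have := integrable_and_norm_integral_le (φ := fun y => f y / ‖x - y‖) (c := A / 2)
    (hf.meas.div₀ (by fun_prop)) (by linarith [hf.nonneg]) x x (fun y _ _ _ => ?_)
    (fun y hy => by simp [hf.zero y hy])
  · refine ⟨this.1, this.2.trans ?_⟩
    have := mul_nonneg hf.nonneg CJ_nonneg
    linarith
  · rw [norm_div, norm_norm, div_eq_mul_inv, Real.norm_eq_abs]
    have h1 := inv_norm_le_J (x - y)
    calc |f y| * ‖x - y‖⁻¹ ≤ A * J (x - y) :=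
        mul_le_mul (hf.bound y) h1 (by positivity) hf.nonneg
      _ = _ := by ring

theorem aesm_riesz (hf : AEStronglyMeasurable f) (x : E3) :
    AEStronglyMeasurable (fun y => f y • riesz (x - y)) :=
  hf.smul (Measurable.aestronglyMeasurable (by fun_prop))

theorem IsSource.integrable_field (hf : IsSource A f) (x : E3) :
    Integrable (fun y => f y • riesz (x - y)) ∧ ‖field f x‖ ≤ 2 * A * CJ := by
  have := integrable_and_norm_integral_le (φ := fun y => f y • riesz (x - y)) (c := A / 2)
    (aesm_riesz hf.meas x) (by linarith [hf.nonneg]) x x (fun y _ _ _ => ?_)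
    (fun y hy => by simp [hf.zero y hy])
  · refine ⟨this.1, ?_⟩
    rw [field, norm_neg]
    refine this.2.trans ?_
    have := mul_nonneg hf.nonneg CJ_nonneg
    linarith
  · rw [norm_smul, norm_riesz, Real.norm_eq_abs]
    calc |f y| * ‖x - y‖⁻¹ ^ 2 ≤ A * J (x - y) :=
        mul_le_mul (hf.bound y) (inv_norm_sq_le_J _) (by positivity) hf.nonneg
      _ = _ := by ring

theorem newton_add {A' : ℝ} {g : E3 → ℝ} (hf : IsSource A f) (hg : IsSource A' g) (x : E3) :
    newton (f + g) x = newton f x + newton g x := by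
  simp only [newton, Pi.add_apply, add_div]
  exact integral_add (hf.integrable_newton x).1 (hg.integrable_newton x).1

theorem newton_smul (c : ℝ) (f : E3 → ℝ) (x : E3) : newton (c • f) x = c * newton f x := by
  simp only [newton, Pi.smul_apply, smul_eq_mul, mul_div_assoc]
  exact integral_const_mul _ _

theorem field_add {A' : ℝ} {g : E3 → ℝ} (hf : IsSource A f) (hg : IsSource A' g) (x : E3) :
    field (f + g) x = field f x + field g x := by
  simp only [field, Pi.add_apply, add_smul]
  rw [integral_add (hf.integrable_field x).1 (hg.integrable_field x).1, neg_add]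

/-- The Newtonian potential is differentiable with gradient `field f`, with a remainder of order
`3/2`. -/
theorem IsSource.newton_taylor (hf : IsSource A f) (x x' : E3) :
    |newton f x' - newton f x - inner ℝ (field f x) (x' - x)| ≤
      32 * A * CJ * (‖x' - x‖ * √‖x' - x‖) := by
  have e : newton f x' - newton f x - inner ℝ (field f x) (x' - x) =
      ∫ y, f y * (‖x' - y‖⁻¹ - ‖x - y‖⁻¹ + inner ℝ (riesz (x - y)) (x' - x)) := by
    have h1 : inner ℝ (field f x) (x' - x) = -∫ y, f y * inner ℝ (riesz (x - y)) (x' - x) := by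
      rw [field, inner_neg_left, real_inner_comm, ← integral_inner (hf.integrable_field x).1]
      simp only [inner_smul_right, real_inner_comm]
    have h2 : Integrable fun y => f y * inner ℝ (riesz (x - y)) (x' - x) := by
      have := (hf.integrable_field x).1.const_inner (𝕜 := ℝ) (x' - x)
      simpa only [inner_smul_right, real_inner_comm] using this
    rw [h1, newton, newton, sub_neg_eq_add,
      ← integral_sub (hf.integrable_newton x').1 (hf.integrable_newton x).1, ← integral_add _ h2]
    · refine integral_congr_ae (.of_forall fun y => ?_)
      simp only [div_eq_mul_inv]
      ring
    · exact (hf.integrable_newton x').1.sub (hf.integrable_newton x).1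
  rw [e]
  have hn := hf.nonneg
  refine (integrable_and_norm_integral_le (c := 16 * A * (‖x' - x‖ * √‖x' - x‖))
    (hf.meas.mul (Measurable.aestronglyMeasurable (by fun_prop))) (by positivity) x' x
    (fun y _ ha hb => ?_)
    (fun y hy => by simp [hf.zero y hy])).2.trans (le_of_eq (by ring))
  rw [Pi.mul_apply, norm_mul, Real.norm_eq_abs, Real.norm_eq_abs]
  have := abs_inv_norm_taylor ha hb
  rw [sub_sub_sub_cancel_right] at this
  calc _ ≤ A * (16 * (‖x' - x‖ * √‖x' - x‖) * (J (x' - y) + J (x - y))) :=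
        mul_le_mul (hf.bound y) this (abs_nonneg _) hf.nonneg
    _ = _ := by ring

theorem isLittleO_of_mul_sqrt {F : Type*} [NormedAddCommGroup F] {φ : E3 → F} {x : E3} {c : ℝ}
    (h : ∀ x', ‖φ x'‖ ≤ c * (‖x' - x‖ * √‖x' - x‖)) : φ =o[𝓝 x] fun x' => x' - x := by
  have h1 : φ =O[𝓝 x] fun x' => ‖x' - x‖ * √‖x' - x‖ := by
    refine Asymptotics.IsBigO.of_bound c (.of_forall fun x' => ?_)
    rw [Real.norm_of_nonneg (by positivity)]
    exact h x'
  refine h1.trans_isLittleO ?_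
  have h2 : (fun x' : E3 => √‖x' - x‖) =o[𝓝 x] fun _ => (1 : ℝ) := by
    rw [Asymptotics.isLittleO_one_iff]
    have : Continuous fun x' : E3 => √‖x' - x‖ := by fun_prop
    simpa using this.tendsto x
  have h3 := (Asymptotics.isBigO_refl (fun x' : E3 => ‖x' - x‖) (𝓝 x)).mul_isLittleO h2
  simpa using h3

theorem IsSource.hasGradientAt (hf : IsSource A f) (x : E3) :
    HasGradientAt (newton f) (field f x) x := by
  rw [hasGradientAt_iff_isLittleO]
  exact isLittleO_of_mul_sqrt (hf.newton_taylor x)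

/-- The field of a bounded density is Hölder continuous of order `1/2`. -/
theorem IsSource.field_holder (hf : IsSource A f) (x x' : E3) :
    ‖field f x' - field f x‖ ≤ 32 * A * CJ * √‖x' - x‖ := by
  have hn := hf.nonneg
  have e : field f x' - field f x = -∫ y, f y • (riesz (x' - y) - riesz (x - y)) := by
    simp only [smul_sub]
    rw [integral_sub (hf.integrable_field x').1 (hf.integrable_field x).1, field, field]
    abel
  rw [e, norm_neg]
  refine (integrable_and_norm_integral_le (c := 16 * A * √‖x' - x‖)
    (hf.meas.smul (Measurable.aestronglyMeasurable (by fun_prop))) (by positivity) x' x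
    (fun y _ ha hb => ?_)
    (fun y hy => by simp [hf.zero y hy])).2.trans (le_of_eq (by ring))
  rw [Pi.smul_apply', norm_smul, Real.norm_eq_abs]
  have := norm_riesz_sub_le_sqrt ha hb
  rw [sub_sub_sub_cancel_right] at this
  calc _ ≤ A * (16 * √‖x' - x‖ * (J (x' - y) + J (x - y))) :=
        mul_le_mul (hf.bound y) this (norm_nonneg _) hf.nonneg
    _ = _ := by ring

theorem IsSource.continuous_field (hf : IsSource A f) : Continuous (field f) := by
  rw [continuous_iff_continuousAt]
  intro x
  rw [ContinuousAt, tendsto_iff_norm_sub_tendsto_zero]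
  have h : Tendsto (fun x' => 32 * A * CJ * √‖x' - x‖) (𝓝 x) (𝓝 0) := by
    have : Continuous fun x' : E3 => 32 * A * CJ * √‖x' - x‖ := by fun_prop
    simpa using this.tendsto x
  exact squeeze_zero (fun _ => norm_nonneg _) (hf.field_holder x) h

theorem IsSource.continuous_newton (hf : IsSource A f) : Continuous (newton f) :=
  continuous_iff_continuousAt.2 fun x => (hf.hasGradientAt x).hasFDerivAt.continuousAt

theorem IsSource.newton_lipschitz (hf : IsSource A f) (x x' : E3) :
    |newton f x' - newton f x| ≤ 2 * A * CJ * ‖x' - x‖ := by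
  have := Convex.norm_image_sub_le_of_norm_hasFDerivWithin_le (f := newton f) (s := univ)
    (f' := fun x => InnerProductSpace.toDual ℝ E3 (field f x)) (C := 2 * A * CJ)
    (fun x _ => (hf.hasGradientAt x).hasFDerivAt.hasFDerivWithinAt)
    (fun x _ => by simpa using (hf.integrable_field x).2) convex_univ (mem_univ x) (mem_univ x')
  simpa using this

/-! ### Potentials of densities of linear growth at the origin -/

theorem inv_norm_mul_le_J (a b : E3) :
    ‖a‖⁻¹ * (‖a‖⁻¹ + ‖b‖⁻¹) ≤ 2 * (J a + J b) := by
  have hJa := inv_norm_sq_le_J a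
  have hJb := inv_norm_sq_le_J b
  nlinarith [sq_nonneg (‖a‖⁻¹ - ‖b‖⁻¹), sq_nonneg ‖a‖⁻¹, sq_nonneg ‖b‖⁻¹]

/-- Even source densities on `B_2` with `|f(y)| ≤ A |y|`. The linear growth makes
`∫ f(y) |y|^(-3) dy` converge, so that the field is differentiable at the origin; evenness makes
the field vanish there. -/
structure IsLinSource (A : ℝ) (f : E3 → ℝ) : Prop where
  meas : AEStronglyMeasurable f
  bound : ∀ y, |f y| ≤ A * ‖y‖
  zero : ∀ y, y ∉ B 2 → f y = 0
  even : ∀ y, f (-y) = f y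

namespace IsLinSource

variable {A : ℝ} {f : E3 → ℝ}

theorem nonneg (hf : IsLinSource A f) : 0 ≤ A := by
  have := (abs_nonneg _).trans (hf.bound (EuclideanSpace.single 0 1))
  simpa using this

theorem isSource (hf : IsLinSource A f) : IsSource (2 * A) f where
  meas := hf.meas
  bound y := by
    by_cases hy : y ∈ B 2
    · have h1 : ‖y‖ ≤ 2 := by simpa [B] using hy
      have := mul_le_mul_of_nonneg_left h1 hf.nonneg
      linarith [hf.bound y]
    · rw [hf.zero y hy, abs_zero]
      linarith [hf.nonneg]
  zero := hf.zero

/-- The integrand is odd. -/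
theorem field_zero (hf : IsLinSource A f) : field f 0 = 0 := by
  have h1 : ∫ y, f y • riesz (0 - y) = ∫ y, f (-y) • riesz (0 - -y) :=
    (integral_neg_eq_self (fun y => f y • riesz (0 - y)) volume).symm
  have h2 : ∫ y, f (-y) • riesz (0 - -y) = - ∫ y, f y • riesz (0 - y) := by
    rw [← integral_neg]
    congr 1 with y : 1
    rw [hf.even, zero_sub, zero_sub, riesz_neg (-y), smul_neg]
  rw [h2] at h1
  rw [field, neg_eq_zero]
  have h3 : (2 : ℝ) • ∫ y, f y • riesz (0 - y) = 0 := by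
    rw [two_smul]
    nth_rw 1 [h1]
    exact neg_add_cancel _
  exact (smul_eq_zero.1 h3).resolve_left two_ne_zero

theorem norm_field_le (hf : IsLinSource A f) (x : E3) : ‖field f x‖ ≤ 4 * A * CJ * ‖x‖ := by
  have hn := hf.nonneg
  have e : field f x = -∫ y, f y • (riesz (x - y) - riesz (0 - y)) := by
    simp only [smul_sub]
    rw [integral_sub (hf.isSource.integrable_field x).1 (hf.isSource.integrable_field 0).1]
    have := hf.field_zero
    rw [field, neg_eq_zero] at this
    rw [this, sub_zero, field]
  rw [e, norm_neg]
  refine (integrable_and_norm_integral_le (c := 2 * A * ‖x‖)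
    (hf.meas.smul (Measurable.aestronglyMeasurable (by fun_prop))) (by positivity) x 0
    (fun y _ ha hb => ?_)
    (fun y hy => by simp [hf.zero y hy])).2.trans (le_of_eq (by ring))
  rw [Pi.smul_apply', norm_smul, Real.norm_eq_abs]
  have h := norm_riesz_sub_le ha hb
  rw [sub_sub_sub_cancel_right, sub_zero] at h
  have hb0 : 0 < ‖0 - y‖ := norm_pos_iff.2 hb
  have hy : ‖y‖ = ‖0 - y‖ := by simp
  have hb2 := hf.bound y
  rw [hy] at hb2
  calc |f y| * ‖riesz (x - y) - riesz (0 - y)‖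
      ≤ (A * ‖0 - y‖) * (‖x‖ * (‖x - y‖⁻¹ * ‖0 - y‖⁻¹ * (‖x - y‖⁻¹ + ‖0 - y‖⁻¹))) :=
        mul_le_mul hb2 h (norm_nonneg _) (by positivity)
    _ = A * ‖x‖ * (‖x - y‖⁻¹ * (‖x - y‖⁻¹ + ‖0 - y‖⁻¹)) := by
        field_simp
    _ ≤ A * ‖x‖ * (2 * (J (x - y) + J (0 - y))) := by
        have := inv_norm_mul_le_J (x - y) (0 - y)
        exact mul_le_mul_of_nonneg_left this (by positivity)
    _ = _ := by ring

/-- The field of a density with linear growth at the origin is Hölder continuous with a modulus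
that respects the scaling at the origin. -/
theorem norm_field_sub_le (hf : IsLinSource A f) {x x' : E3} {η : ℝ} (hx : ‖x‖ ≤ 3)
    (h1 : η ≤ 1) (h : ‖x' - x‖ ≤ η * ‖x‖) :
    ‖field f x' - field f x‖ ≤ 68 * A * CJ * √η * ‖x‖ := by
  rcases eq_or_ne x 0 with rfl | hx0
  · simp at h
    simp [h]
  have hn := hf.nonneg
  have hxp : 0 < ‖x‖ := norm_pos_iff.2 hx0
  have hη : 0 ≤ η := nonneg_of_mul_nonneg_left ((norm_nonneg _).trans h) hxp
  have e : field f x' - field f x = -∫ y, f y • (riesz (x' - y) - riesz (x - y)) := by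
    simp only [smul_sub]
    rw [integral_sub (hf.isSource.integrable_field x').1 (hf.isSource.integrable_field x).1,
      field, field]
    abel
  rw [e, norm_neg]
  refine (integrable_and_norm_integral_le (c := 34 * A * √η * ‖x‖)
    (hf.meas.smul (Measurable.aestronglyMeasurable (by fun_prop))) (by positivity) x' x
    (fun y _ ha hb => ?_)
    (fun y hy => by simp [hf.zero y hy])).2.trans (le_of_eq (by ring))
  rw [Pi.smul_apply', norm_smul, Real.norm_eq_abs]
  have k1 := norm_riesz_sub_le ha hb
  have k2 := norm_riesz_sub_le_sqrt ha hb
  rw [sub_sub_sub_cancel_right] at k1 k2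
  have hb0 : 0 < ‖x - y‖ := norm_pos_iff.2 hb
  have hJ : 0 ≤ J (x' - y) + J (x - y) := add_nonneg (J_nonneg _) (J_nonneg _)
  -- the weight is split as `|y| ≤ |x - y| + |x|`
  have hy : ‖y‖ ≤ ‖x - y‖ + ‖x‖ := by
    have := norm_sub_le x (x - y)
    rw [sub_sub_cancel] at this
    linarith
  have hηs : η ≤ √η := by
    rw [Real.le_sqrt hη hη]; nlinarith
  have p1 : ‖x - y‖ * ‖riesz (x' - y) - riesz (x - y)‖ ≤
      2 * (√η * ‖x‖) * (J (x' - y) + J (x - y)) := by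
    calc ‖x - y‖ * ‖riesz (x' - y) - riesz (x - y)‖
        ≤ ‖x - y‖ * (‖x' - x‖ * (‖x' - y‖⁻¹ * ‖x - y‖⁻¹ * (‖x' - y‖⁻¹ + ‖x - y‖⁻¹))) := by gcongr
      _ = ‖x' - x‖ * (‖x' - y‖⁻¹ * (‖x' - y‖⁻¹ + ‖x - y‖⁻¹)) := by field_simp
      _ ≤ (√η * ‖x‖) * (2 * (J (x' - y) + J (x - y))) := by
          have := inv_norm_mul_le_J (x' - y) (x - y)
          exact mul_le_mul (h.trans (by gcongr)) this (by positivity) (by positivity)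
      _ = _ := by ring
  have p2 : ‖x‖ * ‖riesz (x' - y) - riesz (x - y)‖ ≤
      32 * (√η * ‖x‖) * (J (x' - y) + J (x - y)) := by
    have hs : √‖x' - x‖ ≤ √η * 2 := by
      refine (Real.sqrt_le_sqrt (h.trans (mul_le_mul_of_nonneg_left (hx.trans (by norm_num :
        (3 : ℝ) ≤ 2 ^ 2)) hη))).trans ?_
      rw [Real.sqrt_mul hη, Real.sqrt_sq (by norm_num)]
    calc ‖x‖ * ‖riesz (x' - y) - riesz (x - y)‖
        ≤ ‖x‖ * (16 * (√η * 2) * (J (x' - y) + J (x - y))) := by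
          gcongr
          exact k2.trans (by gcongr)
      _ = _ := by ring
  calc |f y| * ‖riesz (x' - y) - riesz (x - y)‖
      ≤ (A * (‖x - y‖ + ‖x‖)) * ‖riesz (x' - y) - riesz (x - y)‖ := by
        gcongr
        exact (hf.bound y).trans (by gcongr)
    _ = A * (‖x - y‖ * ‖riesz (x' - y) - riesz (x - y)‖
          + ‖x‖ * ‖riesz (x' - y) - riesz (x - y)‖) := by ring
    _ ≤ A * (2 * (√η * ‖x‖) * (J (x' - y) + J (x - y)) +
          32 * (√η * ‖x‖) * (J (x' - y) + J (x - y))) := by gcongr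
    _ = _ := by ring

end IsLinSource

/-- The derivative of `field f` at the origin, in the direction `x`. The integral converges for
densities of linear growth. -/
def fieldDeriv (f : E3 → ℝ) (x : E3) : E3 := -∫ y, f y • rieszDeriv (0 - y) x

theorem fieldDeriv_smul (f : E3 → ℝ) (c : ℝ) (x : E3) :
    fieldDeriv f (c • x) = c • fieldDeriv f x := by
  simp only [fieldDeriv, rieszDeriv_smul, smul_comm _ c]
  rw [integral_smul, smul_neg]

namespace IsLinSource

variable {A : ℝ} {f : E3 → ℝ}

theorem integrable_fieldDeriv (hf : IsLinSource A f) (x : E3) :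
    Integrable (fun y => f y • rieszDeriv (0 - y) x) ∧ ‖fieldDeriv f x‖ ≤ 8 * A * CJ * ‖x‖ := by
  have hn := hf.nonneg
  have := integrable_and_norm_integral_le (φ := f • fun y => rieszDeriv (0 - y) x)
    (c := 4 * A * ‖x‖)
    (hf.meas.smul (Measurable.aestronglyMeasurable (by unfold rieszDeriv; fun_prop)))
    (by positivity) 0 0 (fun y _ ha _ => ?_)
    (fun y hy => by simp [hf.zero y hy])
  · refine ⟨this.1, ?_⟩
    rw [fieldDeriv, norm_neg]
    exact this.2.trans (le_of_eq (by ring))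
  · rw [Pi.smul_apply', norm_smul, Real.norm_eq_abs]
    have hb0 : 0 < ‖0 - y‖ := norm_pos_iff.2 ha
    have hy : ‖y‖ = ‖0 - y‖ := by simp
    have hb2 := hf.bound y
    rw [hy] at hb2
    have hJb := inv_norm_sq_le_J (0 - y)
    have := J_nonneg (0 - y)
    calc |f y| * ‖rieszDeriv (0 - y) x‖
        ≤ (A * ‖0 - y‖) * (4 * ‖0 - y‖⁻¹ ^ 3 * ‖x‖) :=
          mul_le_mul hb2 (norm_rieszDeriv_le _ _) (norm_nonneg _) (by positivity)
      _ = 4 * A * ‖x‖ * ‖0 - y‖⁻¹ ^ 2 := by field_simp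
      _ ≤ 4 * A * ‖x‖ * (J (0 - y) + J (0 - y)) := by
          gcongr
          linarith

/-- `field f` is differentiable at the origin, with a remainder of order `3/2`. This yields the
uniform limit of `∇ newton f (tx) / t` that membership in `Y` requires. -/
theorem norm_field_sub_fieldDeriv_le (hf : IsLinSource A f) (x : E3) :
    ‖field f x - fieldDeriv f x‖ ≤ 128 * A * CJ * √‖x‖ * ‖x‖ := by
  have hn := hf.nonneg
  have e : field f x - fieldDeriv f x =
      -∫ y, f y • (riesz (x - y) - riesz (0 - y) - rieszDeriv (0 - y) x) := by
    simp only [smul_sub]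
    have i1 := (hf.isSource.integrable_field x).1
    have i2 := (hf.isSource.integrable_field 0).1
    have i3 := integral_sub (i1.sub i2) (hf.integrable_fieldDeriv x).1
    simp only [Pi.sub_apply] at i3
    rw [i3, integral_sub i1 i2]
    have := hf.field_zero
    rw [field, neg_eq_zero] at this
    rw [this, sub_zero, field, fieldDeriv]
    abel
  rw [e, norm_neg]
  refine (integrable_and_norm_integral_le (c := 64 * A * (‖x‖ * √‖x‖))
    (hf.meas.smul (Measurable.aestronglyMeasurable (by unfold rieszDeriv; fun_prop)))
    (by positivity) x 0
    (fun y _ ha hb => ?_)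
    (fun y hy => by simp [hf.zero y hy])).2.trans (le_of_eq (by ring))
  rw [Pi.smul_apply', norm_smul, Real.norm_eq_abs]
  have h := norm_riesz_taylor ha hb
  rw [sub_sub_sub_cancel_right, sub_zero] at h
  have hy : ‖y‖ = ‖0 - y‖ := by simp
  have hb2 := hf.bound y
  rw [hy] at hb2
  calc |f y| * ‖riesz (x - y) - riesz (0 - y) - rieszDeriv (0 - y) x‖
      ≤ A * ‖0 - y‖ * ‖riesz (x - y) - riesz (0 - y) - rieszDeriv (0 - y) x‖ := by gcongr
    _ = A * (‖0 - y‖ * ‖riesz (x - y) - riesz (0 - y) - rieszDeriv (0 - y) x‖) := by ring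
    _ ≤ A * (64 * (‖x‖ * √‖x‖) * (J (x - y) + J (0 - y))) := by gcongr
    _ = _ := by ring

end IsLinSource

/-! ### Symmetries -/

/-- Linear maps that preserve the norm are isometries of the space onto itself. -/
def isoOfNorm (L : E3 →ₗ[ℝ] E3) (h : ∀ x, ‖L x‖ = ‖x‖) : E3 ≃ₗᵢ[ℝ] E3 :=
  LinearIsometry.toLinearIsometryEquiv ⟨L, h⟩ rfl

theorem newton_comp_iso (e : E3 ≃ₗᵢ[ℝ] E3) (f : E3 → ℝ) (x : E3) :
    newton (f ∘ e) x = newton f (e x) := by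
  have := e.measurePreserving.integral_comp e.toHomeomorph.measurableEmbedding
    (fun y => f y / ‖e x - y‖)
  simp only [newton, ← this, Function.comp]
  congr 1 with y
  rw [← map_sub, e.norm_map]

theorem norm_eq_three (x : E3) : ‖x‖ = √(x 0 ^ 2 + x 1 ^ 2 + x 2 ^ 2) := by
  rw [EuclideanSpace.norm_eq]
  simp [Fin.sum_univ_three]

/-- The rotation by `θ` around the third axis. -/
def rot3 (θ : ℝ) : E3 ≃ₗᵢ[ℝ] E3 :=
  isoOfNorm
    { toFun := axisRotation θ
      map_add' := fun x y => by
        ext i; fin_cases i <;> simp [axisRotation] <;> ring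
      map_smul' := fun c x => by
        ext i; fin_cases i <;> simp [axisRotation] <;> ring }
    (fun x => by
      simp only [LinearMap.coe_mk, AddHom.coe_mk, norm_eq_three, axisRotation]
      congr 1
      simp
      linear_combination (x 0 ^ 2 + x 1 ^ 2) * Real.cos_sq_add_sin_sq θ)

theorem rot3_apply (θ : ℝ) (x : E3) : rot3 θ x = axisRotation θ x := rfl

/-- The rotation by `θ` around the first axis. -/
def rot1 (θ : ℝ) : E3 ≃ₗᵢ[ℝ] E3 :=
  isoOfNorm
    { toFun := fun x => !₂[x 0, Real.cos θ * x 1 - Real.sin θ * x 2,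
        Real.sin θ * x 1 + Real.cos θ * x 2]
      map_add' := fun x y => by
        ext i; fin_cases i <;> simp <;> ring
      map_smul' := fun c x => by
        ext i; fin_cases i <;> simp <;> ring }
    (fun x => by
      simp only [LinearMap.coe_mk, AddHom.coe_mk, norm_eq_three]
      congr 1
      simp
      linear_combination (x 1 ^ 2 + x 2 ^ 2) * Real.cos_sq_add_sin_sq θ)

theorem rot1_apply (θ : ℝ) (x : E3) : rot1 θ x = !₂[x 0, Real.cos θ * x 1 - Real.sin θ * x 2,
    Real.sin θ * x 1 + Real.cos θ * x 2] := rfl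

/-- The reflection that changes the sign of the third coordinate. -/
def refl3 : E3 ≃ₗᵢ[ℝ] E3 :=
  isoOfNorm
    { toFun := planeReflection
      map_add' := fun x y => by
        ext i; fin_cases i <;> simp [planeReflection]; ring
      map_smul' := fun c x => by
        ext i; fin_cases i <;> simp [planeReflection] }
    (fun x => by
      simp only [LinearMap.coe_mk, AddHom.coe_mk, norm_eq_three, planeReflection]
      simp)

theorem refl3_apply (x : E3) : refl3 x = planeReflection x := rfl

theorem exists_iso_of_mem_S {A : E3 → E3} (hA : A ∈ S) : ∃ e : E3 ≃ₗᵢ[ℝ] E3, ∀ x, e x = A x := by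
  rcases hA with ⟨θ, rfl⟩ | rfl
  · exact ⟨rot3 θ, fun x => rfl⟩
  · exact ⟨refl3, fun x => rfl⟩

/-- Invariance of a function under all transformations in `S`. -/
def SInv (f : E3 → ℝ) : Prop := ∀ A ∈ S, ∀ x, f (A x) = f x

/-- The point reflection is the composition of the reflection with the rotation by `π`. -/
theorem SInv.even {f : E3 → ℝ} (hf : SInv f) (x : E3) : f (-x) = f x := by
  have h1 := hf planeReflection (Or.inr rfl) (axisRotation Real.pi x)
  rw [hf (axisRotation Real.pi) (Or.inl ⟨_, rfl⟩)] at h1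
  rw [← h1]
  congr 1
  ext i
  fin_cases i <;> simp [axisRotation, planeReflection]

theorem SInv.newton {f : E3 → ℝ} (hf : SInv f) : SInv (newton f) := by
  intro A hA x
  obtain ⟨e, he⟩ := exists_iso_of_mem_S hA
  rw [← he, ← newton_comp_iso]
  congr 1
  funext y
  simp [he, hf A hA]

theorem mem_B {r : ℝ} {x : E3} : x ∈ B r ↔ ‖x‖ ≤ r := by simp [B]

theorem IsCS.sInv {R : ℝ} {f : E3 → ℝ} (hf : IsCS R f) : SInv f := by
  intro A hA x
  by_cases hx : x ∈ B R
  · exact hf.symm A hA x hx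
  · obtain ⟨e, he⟩ := exists_iso_of_mem_S hA
    rw [hf.zero_outside x hx, hf.zero_outside]
    rwa [mem_B, ← he, e.norm_map, ← mem_B]

theorem SInv.mul {f g : E3 → ℝ} (hf : SInv f) (hg : SInv g) : SInv (f * g) :=
  fun A hA x => by simp [hf A hA x, hg A hA x]

/-- A function of `|x|` only. -/
def Radial (f : E3 → ℝ) : Prop := ∀ x y : E3, ‖x‖ = ‖y‖ → f x = f y

theorem Radial.sInv {f : E3 → ℝ} (hf : Radial f) : SInv f := by
  intro A hA x
  obtain ⟨e, he⟩ := exists_iso_of_mem_S hA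
  exact hf _ _ (by rw [← he, e.norm_map])

/-! ### Newton's theorem on radial densities -/

theorem lintegral_coords {Ψ : ℝ × ℝ × ℝ → ENNReal} (hΨ : Measurable Ψ) :
    ∫⁻ y : E3, Ψ (y 0, y 1, y 2) = ∫⁻ z, ∫⁻ p : ℝ × ℝ, Ψ (z, p) := by
  let e1 := MeasurableEquiv.piFinSuccAbove (fun _ : Fin 3 => ℝ) 0
  have h1 := (PiLp.volume_preserving_ofLp (Fin 3)).lintegral_comp
    (f := fun v : Fin 3 → ℝ => Ψ (v 0, v 1, v 2)) (by fun_prop)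
  have h2 := (volume_preserving_piFinSuccAbove (fun _ : Fin 3 => ℝ) 0).lintegral_comp
    (f := fun p : ℝ × (Fin 2 → ℝ) => Ψ (p.1, p.2 0, p.2 1)) (by fun_prop)
  rw [h1]
  refine (Eq.trans ?_ h2).trans ?_
  · rfl
  · rw [Measure.volume_eq_prod, lintegral_prod _ (by fun_prop)]
    refine lintegral_congr fun z => ?_
    have h3 := (volume_preserving_finTwoArrow ℝ).lintegral_comp
      (f := fun p : ℝ × ℝ => Ψ (z, p)) (by fun_prop)
    exact h3

/-- Integration of a radial function over a plane at height `z`: the area element on the plane is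
`2π r dr` in terms of the distance `r` from the origin. -/
theorem lintegral_plane_radial {G : ℝ → ENNReal} (hG : Measurable G) (z : ℝ) :
    ∫⁻ p : ℝ × ℝ, G (√(z ^ 2 + p.1 ^ 2 + p.2 ^ 2)) =
      ∫⁻ r in Ioi |z|, ENNReal.ofReal (2 * Real.pi * r) * G r := by
  have h1 := lintegral_comp_polarCoord_symm fun p : ℝ × ℝ => G (√(z ^ 2 + p.1 ^ 2 + p.2 ^ 2))
  rw [← h1, polarCoord_target, Measure.volume_eq_prod, ← Measure.prod_restrict]
  have h2 : ∀ p : ℝ × ℝ, ENNReal.ofReal p.1 •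
      G (√(z ^ 2 + (polarCoord.symm p).1 ^ 2 + (polarCoord.symm p).2 ^ 2)) =
      ENNReal.ofReal p.1 * G (√(z ^ 2 + p.1 ^ 2)) := by
    intro p
    rw [polarCoord_symm_apply, smul_eq_mul]
    congr 3
    simp only
    linear_combination p.1 ^ 2 * Real.cos_sq_add_sin_sq p.2
  simp only [h2]
  rw [lintegral_prod _ (by fun_prop)]
  simp only [lintegral_const, Measure.restrict_apply MeasurableSet.univ, univ_inter,
    Real.volume_Ioo]
  have h3 : (fun s : ℝ => √(z ^ 2 + s ^ 2)) '' Ioi 0 = Ioi |z| := by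
    ext r
    simp only [mem_image, mem_Ioi]
    constructor
    · rintro ⟨s, hs, rfl⟩
      rw [← Real.sqrt_sq_eq_abs]
      exact Real.sqrt_lt_sqrt (sq_nonneg z) (by nlinarith)
    · intro hr
      have hr0 : 0 < r := (abs_nonneg z).trans_lt hr
      have hz : z ^ 2 < r ^ 2 := by
        rw [← sq_abs z]
        exact pow_lt_pow_left₀ hr (abs_nonneg z) two_ne_zero
      refine ⟨√(r ^ 2 - z ^ 2), Real.sqrt_pos.2 (by linarith), ?_⟩
      rw [Real.sq_sqrt (by linarith), add_sub_cancel, Real.sqrt_sq hr0.le]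
  have hpos : ∀ s ∈ Ioi (0 : ℝ), 0 < z ^ 2 + s ^ 2 := fun s hs => by
    have : 0 < s := hs
    positivity
  rw [← h3, lintegral_image_eq_lintegral_abs_deriv_mul (f' := fun s => s / √(z ^ 2 + s ^ 2))
    measurableSet_Ioi]
  · refine setLIntegral_congr_fun measurableSet_Ioi fun s hs => ?_
    have hs0 : 0 < s := hs
    have hq := Real.sqrt_pos.2 (hpos s hs)
    have e : Real.pi - -Real.pi = 2 * Real.pi := by ring
    simp only [e]
    rw [← mul_assoc, ← ENNReal.ofReal_mul (abs_nonneg _), abs_of_pos (div_pos hs0 hq),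
      mul_right_comm, ← ENNReal.ofReal_mul hs0.le]
    congr 2
    field_simp
  · intro s hs
    have h4 : HasDerivAt (fun s : ℝ => z ^ 2 + s ^ 2) (2 * s) s := by
      simpa using (hasDerivAt_pow 2 s).const_add (z ^ 2)
    have h5 := h4.sqrt (hpos s hs).ne'
    exact h5.hasDerivWithinAt.congr_deriv (mul_div_mul_left _ _ two_ne_zero)
  · intro s hs t ht hst
    have hs0 : 0 < s := hs
    have ht0 : 0 < t := ht
    have h6 := (Real.sqrt_inj (hpos s hs).le (hpos t ht).le).1 hst
    have h7 : s ^ 2 = t ^ 2 := by linarith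
    exact (pow_left_inj₀ hs0.le ht0.le two_ne_zero).1 h7

/-- Archimedes: on each sphere about the origin a coordinate is uniformly distributed. -/
theorem lintegral_norm_coord {Φ : ℝ × ℝ → ENNReal} (hΦ : Measurable Φ) :
    ∫⁻ y : E3, Φ (‖y‖, y 0) =
      ∫⁻ r in Ioi (0 : ℝ), ENNReal.ofReal (2 * Real.pi * r) * ∫⁻ z in Ioo (-r) r, Φ (r, z) := by
  have h1 := lintegral_coords
    (Ψ := fun q => Φ (√(q.1 ^ 2 + q.2.1 ^ 2 + q.2.2 ^ 2), q.1)) (by fun_prop)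
  simp only [← norm_eq_three] at h1
  rw [h1]
  have h2 : ∀ z : ℝ, ∫⁻ p : ℝ × ℝ, Φ (√(z ^ 2 + p.1 ^ 2 + p.2 ^ 2), z) =
      ∫⁻ r in Ioi (0 : ℝ), ENNReal.ofReal (2 * Real.pi * r) *
        (Ioo (-r) r).indicator (fun z => Φ (r, z)) z := by
    intro z
    rw [lintegral_plane_radial (G := fun r => Φ (r, z)) (by fun_prop) z,
      ← lintegral_indicator measurableSet_Ioi, ← lintegral_indicator measurableSet_Ioi]
    refine lintegral_congr fun r => ?_
    by_cases hr : |z| < r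
    · have hr0 : 0 < r := (abs_nonneg z).trans_lt hr
      rw [indicator_of_mem (mem_Ioi.2 hr), indicator_of_mem (mem_Ioi.2 hr0),
        indicator_of_mem (show z ∈ Ioo (-r) r from abs_lt.1 hr)]
    · rw [indicator_of_notMem (by simpa using hr)]
      by_cases hr0 : 0 < r
      · rw [indicator_of_mem (mem_Ioi.2 hr0),
          indicator_of_notMem (fun h : z ∈ Ioo (-r) r => hr (abs_lt.2 h)), mul_zero]
      · rw [indicator_of_notMem (by simpa using hr0)]
  simp only [h2]
  have hm : Measurable fun q : ℝ × ℝ => ENNReal.ofReal (2 * Real.pi * q.2) *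
      (Ioo (-q.2) q.2).indicator (fun z => Φ (q.2, z)) q.1 := by
    refine Measurable.mul (by fun_prop) ?_
    have : (fun q : ℝ × ℝ => (Ioo (-q.2) q.2).indicator (fun z => Φ (q.2, z)) q.1) =
        {q : ℝ × ℝ | -q.2 < q.1 ∧ q.1 < q.2}.indicator (fun q => Φ (q.2, q.1)) := by
      funext q
      simp only [indicator, mem_Ioo, mem_ofPred_eq]
    rw [this]
    refine Measurable.indicator (by fun_prop) ?_
    exact (measurableSet_lt measurable_snd.neg measurable_fst).inter
      (measurableSet_lt measurable_fst measurable_snd)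
  rw [lintegral_lintegral_swap hm.aemeasurable]
  refine lintegral_congr fun r => ?_
  rw [lintegral_const_mul _ ((by fun_prop : Measurable fun z => Φ (r, z)).indicator
    measurableSet_Ioo), lintegral_indicator measurableSet_Ioo]

/-- The average of the distance kernel over a sphere of radius `r`, seen from distance `a`. -/
theorem lintegral_inv_sqrt {a r : ℝ} (ha : 0 < a) (hr : 0 < r) :
    ∫⁻ z in Ioo (-r) r, ENNReal.ofReal (√(a ^ 2 + r ^ 2 - 2 * a * z))⁻¹ =
      ∫⁻ _ in Ioo (-r) r, ENNReal.ofReal (max a r)⁻¹ := by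
  have hpos : ∀ z ∈ Ioo (-r) r, 0 < a ^ 2 + r ^ 2 - 2 * a * z := fun z hz => by
    nlinarith [sq_nonneg (a - r), mul_pos ha (sub_pos.2 hz.2)]
  have hd : ∀ z ∈ Ioo (-r) r, HasDerivAt (fun z => -(√(a ^ 2 + r ^ 2 - 2 * a * z) / a))
      (√(a ^ 2 + r ^ 2 - 2 * a * z))⁻¹ z := by
    intro z hz
    have h4 : HasDerivAt (fun z : ℝ => a ^ 2 + r ^ 2 - 2 * a * z) (-(2 * a)) z := by
      simpa using ((hasDerivAt_id z).const_mul (2 * a)).const_sub (a ^ 2 + r ^ 2)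
    have h5 := ((h4.sqrt (hpos z hz).ne').div_const a).neg
    refine h5.congr_deriv ?_
    have := Real.sqrt_pos.2 (hpos z hz)
    field_simp
  have hc : ContinuousOn (fun z => -(√(a ^ 2 + r ^ 2 - 2 * a * z) / a)) (Icc (-r) r) := by
    fun_prop
  have hi := intervalIntegral.integrableOn_deriv_of_nonneg hc hd
    (fun z _ => inv_nonneg.2 (Real.sqrt_nonneg _))
  have hI := intervalIntegral.integral_eq_sub_of_hasDerivAt_of_le (by linarith) hc hd
    ((intervalIntegrable_iff_integrableOn_Ioc_of_le (by linarith)).2 hi)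
  rw [intervalIntegral.integral_of_le (by linarith), integral_Ioc_eq_integral_Ioo] at hI
  rw [← ofReal_integral_eq_lintegral_ofReal (hi.mono_set Ioo_subset_Ioc_self)
    (.of_forall fun z => inv_nonneg.2 (Real.sqrt_nonneg _)), hI, setLIntegral_const,
    Real.volume_Ioo, ← ENNReal.ofReal_mul (by positivity)]
  congr 1
  have e1 : a ^ 2 + r ^ 2 - 2 * a * r = (a - r) ^ 2 := by ring
  have e2 : a ^ 2 + r ^ 2 - 2 * a * -r = (a + r) ^ 2 := by ring
  rw [e1, e2, Real.sqrt_sq_eq_abs, Real.sqrt_sq_eq_abs, abs_of_pos (by positivity : 0 < a + r)]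
  rcases le_total a r with h | h
  · rw [max_eq_right h, abs_of_nonpos (by linarith)]
    field_simp
    ring
  · rw [max_eq_left h, abs_of_nonneg (by linarith)]
    field_simp
    ring

/-- A reflection carries `x` to the first axis. -/
theorem exists_iso_axis (x : E3) :
    ∃ e : E3 ≃ₗᵢ[ℝ] E3, e x = EuclideanSpace.single 0 ‖x‖ :=
  ⟨_, Submodule.reflection_sub (by simp)⟩

theorem lintegral_radial_div {F : ℝ → ENNReal} (hF : Measurable F) (x : E3) :
    ∫⁻ y : E3, F ‖y‖ * ENNReal.ofReal ‖x - y‖⁻¹ =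
      ∫⁻ y : E3, F ‖y‖ * ENNReal.ofReal (max ‖x‖ ‖y‖)⁻¹ := by
  rcases eq_or_ne x 0 with rfl | hx
  · simp
  have ha : 0 < ‖x‖ := norm_pos_iff.2 hx
  obtain ⟨e, he⟩ := exists_iso_axis x
  have h1 : ∫⁻ y : E3, F ‖y‖ * ENNReal.ofReal ‖x - y‖⁻¹ =
      ∫⁻ y : E3, F ‖y‖ * ENNReal.ofReal (√(‖x‖ ^ 2 + ‖y‖ ^ 2 - 2 * ‖x‖ * y 0))⁻¹ := by
    rw [← e.measurePreserving.lintegral_comp_emb e.toHomeomorph.measurableEmbedding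
      (fun y => F ‖y‖ * ENNReal.ofReal (√(‖x‖ ^ 2 + ‖y‖ ^ 2 - 2 * ‖x‖ * y 0))⁻¹)]
    refine lintegral_congr fun y => ?_
    rw [e.norm_map]
    congr 3
    have h2 := norm_sub_sq_real (e x) (e y)
    rw [← map_sub, e.norm_map, e.norm_map, e.norm_map] at h2
    rw [← Real.sqrt_sq (norm_nonneg (x - y)), h2, he]
    congr 1
    simp [EuclideanSpace.inner_single_left]
    ring
  rw [h1, lintegral_norm_coord (Φ := fun p => F p.1 *
      ENNReal.ofReal (√(‖x‖ ^ 2 + p.1 ^ 2 - 2 * ‖x‖ * p.2))⁻¹) (by fun_prop),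
    lintegral_norm_coord (Φ := fun p => F p.1 * ENNReal.ofReal (max ‖x‖ p.1)⁻¹) (by fun_prop)]
  refine setLIntegral_congr_fun measurableSet_Ioi fun r hr => ?_
  simp only
  rw [lintegral_const_mul _ (by fun_prop), lintegral_const_mul _ (by fun_prop),
    lintegral_inv_sqrt ha hr]

/-- Newton's theorem: the potential of a radial density is the potential of the mass inside,
concentrated at the origin, plus a constant from each shell outside. -/
theorem newton_radial {A : ℝ} {f : E3 → ℝ} (hf : IsSource A f) (hm : Measurable f)
    (hr : Radial f) (x : E3) : newton f x = ∫ y, f y / max ‖x‖ ‖y‖ := by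
  set F : ℝ → ℝ := fun t => f (EuclideanSpace.single 0 t) with hF
  have hFm : Measurable F := by
    have : Continuous fun t : ℝ => (EuclideanSpace.single 0 t : E3) := by
      have : (fun t : ℝ => (EuclideanSpace.single 0 t : E3)) =
          fun t : ℝ => t • (EuclideanSpace.single 0 1 : E3) := by
        funext t; ext i; fin_cases i <;> simp
      rw [this]; fun_prop
    exact hm.comp this.measurable
  have hfF : ∀ y, f y = F ‖y‖ := fun y => hr _ _ (by simp)
  have hi1 := (hf.integrable_newton x).1
  have hi2 : Integrable fun y => f y / max ‖x‖ ‖y‖ := by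
    refine ((hf.integrable_newton 0).1).mono
      (hf.meas.div₀ (Measurable.aestronglyMeasurable (by fun_prop))) ?_
    filter_upwards [ae_sub_ne 0] with y hy
    have hy0 : 0 < ‖y‖ := by simpa using hy
    rw [norm_div, norm_div, zero_sub, norm_neg, norm_norm, Real.norm_of_nonneg
      (hy0.le.trans (le_max_right _ _))]
    exact div_le_div_of_nonneg_left (norm_nonneg _) hy0 (le_max_right _ _)
  rw [newton, integral_eq_lintegral_pos_part_sub_lintegral_neg_part hi1,
    integral_eq_lintegral_pos_part_sub_lintegral_neg_part hi2]
  -- `s = 1` and `s = -1` give the positive and the negative part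
  have key : ∀ s : ℝ, ∫⁻ y, ENNReal.ofReal (s * (f y / ‖x - y‖)) =
      ∫⁻ y, ENNReal.ofReal (s * (f y / max ‖x‖ ‖y‖)) := by
    intro s
    have := lintegral_radial_div (F := fun t => ENNReal.ofReal (s * F t)) (by fun_prop) x
    simp only [← hfF] at this
    refine (lintegral_congr fun y => ?_).trans (this.trans (lintegral_congr fun y => ?_))
    · rw [← ENNReal.ofReal_mul' (by positivity), div_eq_mul_inv, mul_assoc]
    · have : 0 ≤ (max ‖x‖ ‖y‖)⁻¹ := inv_nonneg.2 ((norm_nonneg _).trans (le_max_left _ _))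
      rw [← ENNReal.ofReal_mul' this, div_eq_mul_inv, mul_assoc]
  have k1 := key 1
  have k2 := key (-1)
  simp only [one_mul, neg_one_mul] at k1 k2
  rw [k1, k2]

/-! ### The density as a function of the potential -/

/-- The spatial density as a function of the value `u` of the potential. The square root vanishes
for `E ≤ u`, so that the integral extends over `E > u` only. -/
def densityOf (φ : ℝ → ℝ) (u : ℝ) : ℝ := 4 * Real.pi * ∫ E, √(2 * (E - u)) * φ E

/-- Integration over the velocities in polar coordinates, with the energy as the new variable. -/
theorem integral_velocity (φ : ℝ → ℝ) (u : ℝ) :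
    ∫ v : E3, φ (‖v‖ ^ 2 / 2 + u) = densityOf φ u := by
  have h1 := integral_fun_norm_addHaar (E := E3) volume (fun r => φ (r ^ 2 / 2 + u))
  have hd : Module.finrank ℝ E3 = 3 := by simp
  have hv : volume.real (Metric.ball (0 : E3) 1) = Real.pi * 4 / 3 := by
    rw [measureReal_def, EuclideanSpace.volume_ball_fin_three]
    simp
    positivity
  rw [h1, hd, hv]
  have himg : (fun r : ℝ => r ^ 2 / 2 + u) '' Ioi 0 = Ioi u := by
    ext E
    simp only [mem_image, mem_Ioi]
    constructor
    · rintro ⟨r, hr, rfl⟩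
      have : 0 < r ^ 2 := by positivity
      linarith
    · intro hE
      refine ⟨√(2 * (E - u)), Real.sqrt_pos.2 (by linarith), ?_⟩
      rw [Real.sq_sqrt (by linarith)]; ring
  have h2 := integral_image_eq_integral_abs_deriv_smul (s := Ioi 0)
    (f := fun r : ℝ => r ^ 2 / 2 + u) (f' := fun r => r) measurableSet_Ioi
    (fun r _ => by
      have := ((hasDerivAt_pow 2 r).div_const 2).add_const u
      refine HasDerivAt.hasDerivWithinAt (this.congr_deriv ?_)
      simp)
    (fun r hr s hs hrs => by
      have hr0 : 0 < r := hr
      have hs0 : 0 < s := hs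
      have h7 : r ^ 2 = s ^ 2 := by
        have : r ^ 2 / 2 + u = s ^ 2 / 2 + u := hrs
        linarith
      exact (pow_left_inj₀ hr0.le hs0.le two_ne_zero).1 h7)
    (fun E => √(2 * (E - u)) * φ E)
  rw [himg] at h2
  have h3 : ∫ E, √(2 * (E - u)) * φ E = ∫ E in Ioi u, √(2 * (E - u)) * φ E := by
    rw [setIntegral_eq_integral_of_forall_compl_eq_zero]
    intro E hE
    have : E ≤ u := by simpa using hE
    rw [Real.sqrt_eq_zero_of_nonpos (by linarith), zero_mul]
  rw [densityOf, h3, h2]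
  have h4 : ∫ r in Ioi (0 : ℝ), |r| • (√(2 * (r ^ 2 / 2 + u - u)) * φ (r ^ 2 / 2 + u)) =
      ∫ r in Ioi (0 : ℝ), r ^ (3 - 1) • φ (r ^ 2 / 2 + u) := by
    refine setIntegral_congr_fun measurableSet_Ioi fun r hr => ?_
    have hr0 : 0 < r := hr
    have e : 2 * (r ^ 2 / 2 + u - u) = r ^ 2 := by ring
    simp only [e, Real.sqrt_sq hr0.le, abs_of_pos hr0, smul_eq_mul]
    ring
  rw [h4]
  simp only [smul_eq_mul, nsmul_eq_mul]
  push_cast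
  ring

variable {φ ψ : ℝ → ℝ} {E₀ : ℝ}

/-- For `γ = 0` the factor `ψ(γ r s)` is `ψ(0) = 1`. -/
theorem h_zero_eq (hφ : EnergyProfile φ E₀) (hψ : MomentumProfile ψ) (r u : ℝ) :
    h φ ψ E₀ 0 r u = densityOf φ u := by
  have hψ0 : ψ 0 = 1 := (hψ.eq_one_iff 0).2 rfl
  have hae : (fun E => √(2 * (E - u)) * φ E) =ᵐ[volume]
      (Ioc u E₀).indicator fun E => √(2 * (E - u)) * φ E := by
    filter_upwards [hφ.zero_above] with E hE
    by_cases h1 : E ∈ Ioc u E₀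
    · rw [indicator_of_mem h1]
    · rw [indicator_of_notMem h1]
      rcases le_or_gt E u with h2 | h2
      · rw [Real.sqrt_eq_zero_of_nonpos (by linarith), zero_mul]
      · rw [hE, mul_zero]
        by_contra h3
        exact h1 ⟨h2, (not_le.1 h3).le⟩
  rw [densityOf, integral_congr_ae hae, integral_indicator measurableSet_Ioc, h]
  split_ifs with hu
  · rw [intervalIntegral.integral_of_le hu.le]
    have : ∀ E, φ E * ∫ s in (-√(2 * (E - u)))..√(2 * (E - u)), ψ (0 * r * s) =
        2 * (√(2 * (E - u)) * φ E) := by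
      intro E
      simp only [zero_mul, hψ0, intervalIntegral.integral_const, smul_eq_mul]
      ring
    simp only [this]
    rw [integral_const_mul]
    ring
  · rw [Ioc_eq_empty (not_lt.2 (not_lt.1 hu)) ]
    simp

/-- A finite exponent of integrability: `p = ∞` is allowed in the hypothesis, and `min p 3` serves
in all cases. -/
theorem EnergyProfile.exists_exponent (hφ : EnergyProfile φ E₀) :
    ∃ p : ℝ, 2 < p ∧ ∀ a b : ℝ, IntegrableOn (fun E => φ E ^ p) (Icc a b) ∧
      IntegrableOn φ (Icc a b) := by
  obtain ⟨p, hp, hL⟩ := hφ.memLp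
  have h3 : min p 3 ≠ ⊤ := (min_le_right p 3).trans_lt (by norm_num) |>.ne
  have h2 : 2 < min p 3 := lt_min hp (by norm_num)
  refine ⟨(min p 3).toReal, ?_, fun a b => ⟨?_, ?_⟩⟩
  · have := (ENNReal.toReal_lt_toReal (by norm_num) h3).2 h2
    simpa using this
  · have h4 := (hL (Icc a b) isCompact_Icc).mono_exponent (min_le_left p 3)
    have h5 := h4.integrable_norm_rpow (by positivity) h3
    refine h5.congr (.of_forall fun E => ?_)
    simp [abs_of_nonneg (hφ.nonneg E)]
  · exact (hL (Icc a b) isCompact_Icc).integrable (le_trans (by norm_num) hp.le)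

theorem EnergyProfile.ae_zero (hφ : EnergyProfile φ E₀) {a u : ℝ} (hu : a ≤ u) :
    ∀ᵐ E, E ∉ Icc a E₀ → √(2 * (E - u)) * φ E = 0 := by
  filter_upwards [hφ.zero_above] with E hE h1
  rcases le_or_gt E u with h2 | h2
  · rw [Real.sqrt_eq_zero_of_nonpos (by linarith), zero_mul]
  · rw [hE, mul_zero]
    by_contra h3
    exact h1 ⟨by linarith, (not_le.1 h3).le⟩

theorem EnergyProfile.integrable (hφ : EnergyProfile φ E₀) (u : ℝ) :
    Integrable fun E => √(2 * (E - u)) * φ E := by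
  obtain ⟨p, _, hp⟩ := hφ.exists_exponent
  have h1 : IntegrableOn (fun E => √(2 * (E - u)) * φ E) (Icc u E₀) :=
    (hp u E₀).2.continuousOn_mul (by fun_prop) isCompact_Icc
  refine ((integrable_indicator_iff measurableSet_Icc).2 h1).congr ?_
  filter_upwards [hφ.ae_zero le_rfl] with E hE
  by_cases h2 : E ∈ Icc u E₀
  · rw [indicator_of_mem h2]
  · rw [indicator_of_notMem h2, hE h2]

theorem densityOf_antitone (hφ : EnergyProfile φ E₀) : Antitone (densityOf φ) := by
  intro u u' huu
  refine mul_le_mul_of_nonneg_left ?_ (by positivity)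
  refine integral_mono (hφ.integrable u') (hφ.integrable u) fun E => ?_
  exact mul_le_mul_of_nonneg_right (Real.sqrt_le_sqrt (by linarith)) (hφ.nonneg E)

theorem densityOf_nonneg (hφ : EnergyProfile φ E₀) (u : ℝ) : 0 ≤ densityOf φ u :=
  mul_nonneg (by positivity) <| integral_nonneg fun E =>
    mul_nonneg (Real.sqrt_nonneg _) (hφ.nonneg E)

theorem sqrt_sub_sqrt_le {E u u' : ℝ} (h : u ≤ u') :
    √(2 * (E - u)) - √(2 * (E - u')) ≤ 2 * (u' - u) * (√(E - u))⁻¹ := by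
  rcases le_or_gt E u with h1 | h1
  · rw [Real.sqrt_eq_zero_of_nonpos (by linarith : 2 * (E - u) ≤ 0),
      Real.sqrt_eq_zero_of_nonpos (by linarith : E - u ≤ 0)]
    simp [Real.sqrt_nonneg]
  · have h0 : 0 < √(E - u) := Real.sqrt_pos.2 (by linarith)
    have h2 : √2 ≤ 2 := by
      rw [Real.sqrt_le_left (by norm_num)]; norm_num
    rw [Real.sqrt_mul (by norm_num), Real.sqrt_mul (by norm_num), ← mul_sub]
    have h3 : √(E - u) - √(E - u') ≤ (u' - u) * (√(E - u))⁻¹ := by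
      rw [← div_eq_mul_inv, le_div_iff₀ h0, sub_mul, Real.mul_self_sqrt (by linarith)]
      rcases le_or_gt E u' with h4 | h4
      · have := mul_nonneg (Real.sqrt_nonneg (E - u')) h0.le
        linarith
      · have h5 : √(E - u') ≤ √(E - u) := Real.sqrt_le_sqrt (by linarith)
        have h6 : √(E - u') * √(E - u') = E - u' := Real.mul_self_sqrt (by linarith)
        have := mul_le_mul_of_nonneg_left h5 (Real.sqrt_nonneg (E - u'))
        linarith
    have h7 : 0 ≤ (u' - u) * (√(E - u))⁻¹ := mul_nonneg (by linarith) (by positivity)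
    calc √2 * (√(E - u) - √(E - u')) ≤ √2 * ((u' - u) * (√(E - u))⁻¹) := by gcongr
      _ ≤ 2 * ((u' - u) * (√(E - u))⁻¹) := by gcongr
      _ = _ := by ring

/-- The integrability exponent `p > 2` of the ansatz makes the density a Lipschitz function of the
potential: the difference quotients of `√(E - u)` are bounded by `(E - u)^(-1/2)`, which lies in
`L^q` for the conjugate exponent `q < 2`. -/
theorem densityOf_lipschitz (hφ : EnergyProfile φ E₀) (a : ℝ) :
    ∃ C : ℝ, 0 ≤ C ∧ ∀ u u' : ℝ, a ≤ u → u ≤ u' →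
      densityOf φ u - densityOf φ u' ≤ C * (u' - u) := by
  obtain ⟨p, hp2, hp⟩ := hφ.exists_exponent
  set p' := p.conjExponent with hp'
  have hc : p.HolderConjugate p' := Real.HolderConjugate.conjExponent (by linarith)
  have hp'2 : p' < 2 := by
    rw [hp', Real.conjExponent, div_lt_iff₀ (by linarith)]
    linarith
  set G : ℝ → ℝ := (Ioc 0 (E₀ - a)).indicator fun t => t ^ (-(p' / 2)) with hG
  have hGi : Integrable G := by
    rw [hG, integrable_indicator_iff measurableSet_Ioc]
    rcases le_or_gt (E₀ - a) 0 with h1 | h1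
    · simp [Ioc_eq_empty_of_le h1]
    · exact ((intervalIntegrable_iff_integrableOn_Ioc_of_le h1.le).1
        (intervalIntegral.intervalIntegrable_rpow' (by linarith)))
  have hG0 : ∀ t, 0 ≤ G t := by
    intro t
    rw [hG]
    exact indicator_nonneg (fun s hs => Real.rpow_nonneg hs.1.le _) t
  have hφi : Integrable ((Icc a E₀).indicator fun E => φ E ^ p) :=
    (integrable_indicator_iff measurableSet_Icc).2 (hp a E₀).1
  have hφ0 : ∀ E, 0 ≤ (Icc a E₀).indicator (fun E => φ E ^ p) E :=
    fun t => indicator_nonneg (fun s _ => Real.rpow_nonneg (hφ.nonneg s) _) t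
  set C1 := (∫ E, (Icc a E₀).indicator (fun E => φ E ^ p) E) + ∫ t, G t with hC1
  have hC1n : 0 ≤ C1 := add_nonneg (integral_nonneg hφ0) (integral_nonneg hG0)
  refine ⟨4 * Real.pi * (2 * C1), by positivity, fun u u' hau huu => ?_⟩
  rw [densityOf, densityOf, ← mul_sub, ← integral_sub (hφ.integrable u) (hφ.integrable u'),
    mul_assoc (4 * Real.pi) (2 * C1)]
  refine mul_le_mul_of_nonneg_left ?_ (by positivity)
  have hbi : Integrable fun E => 2 * (u' - u) *
      ((Icc a E₀).indicator (fun E => φ E ^ p) E + G (E - u)) :=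
    (hφi.add (hGi.comp_sub_right u)).const_mul _
  refine (integral_mono_ae ((hφ.integrable u).sub (hφ.integrable u')) hbi ?_).trans ?_
  · filter_upwards [hφ.ae_zero hau, hφ.ae_zero (hau.trans huu)] with E h1 h2
    simp only [Pi.sub_apply]
    have hn : 0 ≤ 2 * (u' - u) := by linarith
    by_cases hE : E ∈ Icc a E₀
    · rw [← sub_mul]
      calc (√(2 * (E - u)) - √(2 * (E - u'))) * φ E
          ≤ (2 * (u' - u) * (√(E - u))⁻¹) * φ E :=
            mul_le_mul_of_nonneg_right (sqrt_sub_sqrt_le huu) (hφ.nonneg E)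
        _ = 2 * (u' - u) * (φ E * (√(E - u))⁻¹) := by ring
        _ ≤ _ := by
          refine mul_le_mul_of_nonneg_left ?_ hn
          have hy := Real.young_inequality_of_nonneg (hφ.nonneg E)
            (inv_nonneg.2 (Real.sqrt_nonneg (E - u))) hc
          have hq : (√(E - u))⁻¹ ^ p' ≤ G (E - u) := by
            rcases le_or_gt E u with h3 | h3
            · rw [Real.sqrt_eq_zero_of_nonpos (by linarith), inv_zero,
                Real.zero_rpow hc.symm.pos.ne']
              exact hG0 _
            · have hm : E - u ∈ Ioc 0 (E₀ - a) := ⟨by linarith, by linarith [hE.2]⟩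
              rw [hG, indicator_of_mem hm, Real.sqrt_eq_rpow, ← Real.rpow_neg hm.1.le,
                ← Real.rpow_mul hm.1.le]
              refine le_of_eq ?_
              congr 1
              ring
          rw [indicator_of_mem hE]
          have k1 : φ E ^ p / p ≤ φ E ^ p :=
            div_le_self (Real.rpow_nonneg (hφ.nonneg E) _) (by linarith)
          have k2 : (√(E - u))⁻¹ ^ p' / p' ≤ (√(E - u))⁻¹ ^ p' :=
            div_le_self (Real.rpow_nonneg (inv_nonneg.2 (Real.sqrt_nonneg _)) _) hc.symm.lt.le
          linarith
    · rw [h1 hE, h2 hE, sub_zero]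
      exact mul_nonneg hn (add_nonneg (hφ0 E) (hG0 _))
  · rw [integral_const_mul, integral_add hφi (hGi.comp_sub_right u), integral_sub_right_eq_self]
    exact le_of_eq (by ring)

/-! ### Radial functions and their Laplacian -/

theorem hasGradientAt_norm {x : E3} (hx : x ≠ 0) :
    HasGradientAt (fun x : E3 => ‖x‖) (‖x‖⁻¹ • x) x := by
  have h0 : 0 < ‖x‖ := norm_pos_iff.2 hx
  have h1 := (hasFDerivAt_id (𝕜 := ℝ) x).norm_sq
  have h2 := h1.sqrt (by simpa using hx)
  rw [hasGradientAt_iff_hasFDerivAt]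
  have h3 : (fun x : E3 => ‖x‖) = fun x : E3 => √(‖id x‖ ^ 2) := by
    funext y
    simp [Real.sqrt_sq]
  rw [h3]
  refine h2.congr_fderiv ?_
  ext w
  simp [Real.sqrt_sq, InnerProductSpace.toDual_apply_apply]
  field_simp

theorem hasGradientAt_radial {V : ℝ → ℝ} {v : ℝ} {x : E3} (hx : x ≠ 0) (hV : HasDerivAt V v ‖x‖) :
    HasGradientAt (fun x : E3 => V ‖x‖) ((v / ‖x‖) • x) x := by
  rw [hasGradientAt_iff_hasFDerivAt]
  refine (hV.comp_hasFDerivAt x (hasGradientAt_norm hx).hasFDerivAt).congr_fderiv ?_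
  ext w
  simp [InnerProductSpace.toDual_apply_apply]
  ring

/-- The Laplacian in polar coordinates. -/
theorem laplacian_radial {U : E3 → ℝ} {V : ℝ → ℝ} (hU : ContDiff ℝ 2 U) (hV : ContDiff ℝ 2 V)
    (hUV : ∀ x, U x = V ‖x‖) {x : E3} (hx : x ≠ 0) :
    Laplacian.laplacian U x = deriv (deriv V) ‖x‖ + 2 * (deriv V ‖x‖ / ‖x‖) := by
  have h0 : 0 < ‖x‖ := norm_pos_iff.2 hx
  have hVd : ∀ r, HasDerivAt V (deriv V r) r := fun r =>
    (hV.differentiable two_ne_zero r).hasDerivAt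
  have hV1 : ContDiff ℝ 1 (deriv V) :=
    (contDiff_succ_iff_deriv.1 (by simpa [one_add_one_eq_two] using hV)).2.2
  have hVdd : ∀ r, HasDerivAt (deriv V) (deriv (deriv V) r) r := fun r =>
    (hV1.differentiable one_ne_zero r).hasDerivAt
  have hU1 : Differentiable ℝ (fderiv ℝ U) :=
    (hU.fderiv_right (m := 1) (by norm_num)).differentiable one_ne_zero
  have hgrad : ∀ y : E3, y ≠ 0 → ∀ w, fderiv ℝ U y w = deriv V ‖y‖ / ‖y‖ * inner ℝ y w := by
    intro y hy w
    have h1 := (hasGradientAt_radial hy (hVd ‖y‖)).hasFDerivAt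
    have h2 : U = fun x => V ‖x‖ := funext hUV
    rw [h2, h1.fderiv, InnerProductSpace.toDual_apply_apply, inner_smul_left]
    simp
  have key : ∀ w : E3, ‖w‖ = 1 → iteratedFDeriv ℝ 2 U x ![w, w] =
      (deriv (deriv V) ‖x‖ / ‖x‖ ^ 2 - deriv V ‖x‖ / ‖x‖ ^ 3) * inner ℝ x w ^ 2
        + deriv V ‖x‖ / ‖x‖ := by
    intro w hw
    rw [iteratedFDeriv_two_apply]
    simp only [Matrix.cons_val_zero, Matrix.cons_val_one]
    have hline : HasDerivAt (fun t : ℝ => x + t • w) w 0 := by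
      simpa using ((hasDerivAt_id (0 : ℝ)).smul_const w).const_add x
    have hx0 : x + (0 : ℝ) • w = x := by simp
    have d1 : HasDerivAt (fun t : ℝ => fderiv ℝ U (x + t • w) w)
        (fderiv ℝ (fderiv ℝ U) x w w) 0 := by
      have h3 : HasFDerivAt (fderiv ℝ U) (fderiv ℝ (fderiv ℝ U) x) (x + (0 : ℝ) • w) := by
        rw [hx0]
        exact (hU1 x).hasFDerivAt
      have h4 := h3.comp_hasDerivAt (0 : ℝ) hline
      have h5 := HasDerivAt.clm_apply h4 (hasDerivAt_const (0 : ℝ) w)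
      simpa using h5
    have d2 : HasDerivAt (fun t : ℝ => deriv V ‖x + t • w‖ / ‖x + t • w‖ * inner ℝ (x + t • w) w)
        ((deriv (deriv V) ‖x‖ * (inner ℝ x w / ‖x‖) * ‖x‖ - deriv V ‖x‖ * (inner ℝ x w / ‖x‖)) /
          ‖x‖ ^ 2 * inner ℝ x w + deriv V ‖x‖ / ‖x‖ * inner ℝ w w) 0 := by
      have n1 : HasDerivAt (fun t : ℝ => ‖x + t • w‖) (inner ℝ x w / ‖x‖) 0 := by
        have h5 : HasFDerivAt (fun x : E3 => ‖x‖)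
            (InnerProductSpace.toDual ℝ E3 (‖x‖⁻¹ • x)) (x + (0 : ℝ) • w) := by
          rw [hx0]
          exact (hasGradientAt_norm hx).hasFDerivAt
        refine (h5.comp_hasDerivAt (0 : ℝ) hline).congr_deriv ?_
        simp
        ring
      have n2 : HasDerivAt (fun t : ℝ => deriv V ‖x + t • w‖)
          (deriv (deriv V) ‖x‖ * (inner ℝ x w / ‖x‖)) 0 := by
        have h6 : HasDerivAt (deriv V) (deriv (deriv V) ‖x‖) ‖x + (0 : ℝ) • w‖ := by
          rw [hx0]; exact hVdd _
        exact h6.comp (0 : ℝ) n1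
      have n3 : HasDerivAt (fun t : ℝ => inner ℝ (x + t • w) w) (inner ℝ w w) 0 := by
        have := hline.inner ℝ (hasDerivAt_const (0 : ℝ) w)
        simpa using this
      have n4 := n2.fun_div n1 (by rw [hx0]; exact h0.ne')
      have n5 := n4.fun_mul n3
      simpa only [hx0] using n5
    have d3 : (fun t : ℝ => fderiv ℝ U (x + t • w) w) =ᶠ[𝓝 0]
        fun t : ℝ => deriv V ‖x + t • w‖ / ‖x + t • w‖ * inner ℝ (x + t • w) w := by
      have hne : ∀ᶠ t : ℝ in 𝓝 0, x + t • w ≠ 0 :=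
        hline.continuousAt.eventually_ne (by simpa using hx)
      filter_upwards [hne] with t ht
      exact hgrad _ ht w
    rw [d1.unique (d2.congr_of_eventuallyEq d3), real_inner_self_eq_norm_sq, hw]
    field_simp
  rw [InnerProductSpace.laplacian_eq_iteratedFDeriv_orthonormalBasis U
    (EuclideanSpace.basisFun (Fin 3) ℝ)]
  have hs : ∑ i, inner ℝ x (EuclideanSpace.basisFun (Fin 3) ℝ i) ^ 2 = ‖x‖ ^ 2 := by
    have := (EuclideanSpace.basisFun (Fin 3) ℝ).sum_sq_norm_inner_left x
    simpa using this
  simp only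
  rw [Finset.sum_congr rfl fun i _ => key _ ((EuclideanSpace.basisFun (Fin 3) ℝ).norm_eq_one i),
    Finset.sum_add_distrib, ← Finset.mul_sum, hs]
  simp only [Finset.sum_const, Finset.card_univ, Fintype.card_fin, nsmul_eq_mul]
  field_simp
  push_cast
  ring

/-! ### Radial profiles of the steady state -/

/-- The radial profiles `R` of the density and `V` of the potential of a spherically symmetric
steady state, with the properties on which the analysis of the linearization rests; `C` is a bound
for `-R' / V'`. -/
structure RadialProfiles (ρ₀ U₀ : E3 → ℝ) (R V : ℝ → ℝ) (C : ℝ) : Prop where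
  contDiff_R : ContDiff ℝ 1 R
  contDiff_V : ContDiff ℝ 2 V
  contDiff_density : ContDiff ℝ 1 ρ₀
  contDiff_potential : ContDiff ℝ 2 U₀
  density_eq : ∀ x, ρ₀ x = R ‖x‖
  potential_eq : ∀ x, U₀ x = V ‖x‖
  R_zero : ∀ r, 1 < r → R r = 0
  deriv_V_zero : deriv V 0 = 0
  deriv_V_pos : ∀ r, 0 < r → 0 < deriv V r
  deriv2_V_zero_pos : 0 < deriv (deriv V) 0
  deriv_R_nonpos : ∀ r, 0 ≤ r → deriv R r ≤ 0
  neg_deriv_R_le : ∀ r, 0 ≤ r → -deriv R r ≤ C * deriv V r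
  potential_eq_newton : ∀ x, U₀ x = -newton ρ₀ x

theorem single_eq_smul (r : ℝ) :
    (EuclideanSpace.single 0 r : E3) = r • (EuclideanSpace.single 0 1 : E3) := by
  ext i; fin_cases i <;> simp

theorem contDiff_single {n : WithTop ℕ∞} :
    ContDiff ℝ n fun r : ℝ => (EuclideanSpace.single 0 r : E3) := by
  have : (fun r : ℝ => (EuclideanSpace.single 0 r : E3)) =
      fun r : ℝ => r • (EuclideanSpace.single 0 1 : E3) := funext single_eq_smul
  rw [this]
  fun_prop

theorem deriv_zero_of_even {V : ℝ → ℝ} (hV : ∀ r, V (-r) = V r) : deriv V 0 = 0 := by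
  have h1 := deriv_comp_neg V 0
  have h2 : (fun x => V (-x)) = V := funext hV
  rw [h2, neg_zero] at h1
  linarith

theorem isSource_of_radial {ρ : E3 → ℝ} {R : ℝ → ℝ} (hR : Continuous R) (h : ∀ x, ρ x = R ‖x‖)
    (h0 : ∀ r, 1 < r → R r = 0) : ∃ A, IsSource A ρ := by
  obtain ⟨A, hA⟩ := (isCompact_Icc (a := (0 : ℝ)) (b := 1)).exists_bound_of_continuousOn
    hR.continuousOn
  have hc : Continuous ρ := by
    have : ρ = fun x => R ‖x‖ := funext h
    rw [this]; fun_prop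
  refine ⟨max A 0, hc.aestronglyMeasurable, fun y => ?_, fun y hy => ?_⟩
  · rw [h]
    rcases le_or_gt ‖y‖ 1 with h1 | h1
    · exact (hA _ ⟨norm_nonneg y, h1⟩).trans (le_max_left _ _)
    · rw [h0 _ h1, abs_zero]
      exact le_max_right _ _
  · rw [mem_B, not_le] at hy
    rw [h, h0 _ (by linarith)]

/-- The potential of a radial density supported in the unit ball. -/
theorem newton_radial_formula {ρ : E3 → ℝ} {R : ℝ → ℝ} (hR : Continuous R)
    (h : ∀ x, ρ x = R ‖x‖) (h0 : ∀ r, 1 < r → R r = 0) {x : E3} (hx : x ≠ 0) :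
    newton ρ x = (∫ s in (0 : ℝ)..‖x‖, 4 * Real.pi * s ^ 2 * R s) / ‖x‖ +
      ((∫ s in (0 : ℝ)..2, 4 * Real.pi * s * R s) -
        ∫ s in (0 : ℝ)..‖x‖, 4 * Real.pi * s * R s) := by
  have hr : 0 < ‖x‖ := norm_pos_iff.2 hx
  obtain ⟨A, hA⟩ := isSource_of_radial hR h h0
  have hc : Continuous ρ := by
    have : ρ = fun x => R ‖x‖ := funext h
    rw [this]; fun_prop
  have hrad : Radial ρ := fun y z hyz => by rw [h, h, hyz]
  rw [newton_radial hA hc.measurable hrad x]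
  simp only [h]
  rw [integral_fun_norm_addHaar (E := E3) volume (fun s => R s / max ‖x‖ s)]
  have hd : Module.finrank ℝ E3 = 3 := by simp
  have hv : volume.real (Metric.ball (0 : E3) 1) = Real.pi * 4 / 3 := by
    rw [measureReal_def, EuclideanSpace.volume_ball_fin_three]
    simp
    positivity
  rw [hd, hv]
  set r := ‖x‖ with hr'
  have hcont : Continuous fun s : ℝ => s ^ 2 * (R s / max r s) := by
    have : ∀ s, max r s ≠ 0 := fun s => (hr.trans_le (le_max_left _ _)).ne'
    fun_prop (disch := exact this _)
  have hzero : ∀ s, 1 < s → s ^ 2 * (R s / max r s) = 0 := fun s hs => by simp [h0 s hs]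
  have e1 : ∫ s in Ioi (0 : ℝ), s ^ (3 - 1) • (R s / max r s) =
      ∫ s in (0 : ℝ)..(max r 2), s ^ 2 * (R s / max r s) := by
    rw [intervalIntegral.integral_of_le (by positivity)]
    refine (setIntegral_eq_of_subset_of_forall_sdiff_eq_zero measurableSet_Ioi
      Ioc_subset_Ioi_self fun s hs => ?_)
    have : max r 2 < s := by
      by_contra h2
      exact hs.2 ⟨hs.1, not_lt.1 h2⟩
    exact hzero s (by linarith [le_max_right r 2])
  have i1 : ∀ a b : ℝ, IntervalIntegrable (fun s : ℝ => s ^ 2 * (R s / max r s)) volume a b :=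
    fun a b => hcont.intervalIntegrable a b
  have i2 : ∀ a b : ℝ, IntervalIntegrable (fun s : ℝ => 4 * Real.pi * s * R s) volume a b :=
    fun a b => Continuous.intervalIntegrable (by fun_prop) a b
  rw [e1, ← intervalIntegral.integral_add_adjacent_intervals (i1 0 r) (i1 r _)]
  have e2 : ∫ s in (0 : ℝ)..r, s ^ 2 * (R s / max r s) =
      (∫ s in (0 : ℝ)..r, 4 * Real.pi * s ^ 2 * R s) / (4 * Real.pi * r) := by
    rw [eq_div_iff (by positivity), ← intervalIntegral.integral_mul_const]
    refine intervalIntegral.integral_congr fun s hs => ?_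
    rw [uIcc_of_le hr.le] at hs
    simp only [max_eq_left hs.2]
    field_simp
  have e3 : ∫ s in r..(max r 2), s ^ 2 * (R s / max r s) =
      (∫ s in r..(max r 2), 4 * Real.pi * s * R s) / (4 * Real.pi) := by
    rw [eq_div_iff (by positivity), ← intervalIntegral.integral_mul_const]
    refine intervalIntegral.integral_congr fun s hs => ?_
    rw [uIcc_of_le (le_max_left _ _)] at hs
    have hs0 : 0 < s := hr.trans_le hs.1
    simp only [max_eq_right hs.1]
    field_simp
  have e4 : ∫ s in (2 : ℝ)..(max r 2), 4 * Real.pi * s * R s = 0 := by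
    rw [intervalIntegral.integral_congr (g := fun _ => 0)]
    · simp
    · intro s hs
      rw [uIcc_of_le (le_max_right _ _)] at hs
      simp [h0 s (by linarith [hs.1])]
  have e5 := intervalIntegral.integral_add_adjacent_intervals (i2 0 2) (i2 2 (max r 2))
  have e6 := intervalIntegral.integral_add_adjacent_intervals (i2 0 r) (i2 r (max r 2))
  rw [e4] at e5
  have e7 : ∫ s in r..(max r 2), 4 * Real.pi * s * R s =
      (∫ s in (0 : ℝ)..2, 4 * Real.pi * s * R s) - ∫ s in (0 : ℝ)..r, 4 * Real.pi * s * R s := by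
    linarith
  rw [e2, e3, e7]
  simp only [nsmul_eq_mul, smul_eq_mul]
  field_simp
  push_cast
  ring

variable {φ : ℝ → ℝ} {E₀ : ℝ} {f₀ : E3 → E3 → ℝ} {ρ₀ U₀ : E3 → ℝ}

theorem SphericalSteadyState.density_eq_densityOf (hs : SphericalSteadyState φ f₀ ρ₀ U₀) (x : E3) :
    ρ₀ x = densityOf φ (U₀ x) := by
  rw [hs.density, ← integral_velocity]
  simp only [hs.ansatz]

/-- The radial Poisson equation `(r² V′)′ = 4π r² R` gives the sign of `V′`; monotonicity and the
Lipschitz bound of the density as a function of the potential give the bounds for `R′`; the decay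
at infinity identifies `U₀` with the potential of `ρ₀`. -/
theorem exists_radialProfiles (hφ : EnergyProfile φ E₀) (hs : SphericalSteadyState φ f₀ ρ₀ U₀) :
    ∃ R V C, RadialProfiles ρ₀ U₀ R V C := by
  set R : ℝ → ℝ := fun r => ρ₀ (EuclideanSpace.single 0 r) with hRdef
  set V : ℝ → ℝ := fun r => U₀ (EuclideanSpace.single 0 r) with hVdef
  have hR1 : ContDiff ℝ 1 R := hs.contDiff_density.comp contDiff_single
  have hV2 : ContDiff ℝ 2 V := hs.contDiff_potential.comp contDiff_single
  have hρ : ∀ x, ρ₀ x = R ‖x‖ := fun x => hs.radial_density _ _ (by simp)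
  have hU : ∀ x, U₀ x = V ‖x‖ := fun x => hs.radial_potential _ _ (by simp)
  have hReven : ∀ r, R (-r) = R r := fun r => hs.radial_density _ _ (by simp)
  have hVeven : ∀ r, V (-r) = V r := fun r => hs.radial_potential _ _ (by simp)
  have hR0 : ∀ r, 1 < r → R r = 0 := by
    intro r hr
    refine image_eq_zero_of_notMem_tsupport (f := ρ₀) ?_
    rw [hs.support_density, mem_B]
    simp [abs_of_pos (zero_lt_one.trans hr), hr]
  have hV0 := deriv_zero_of_even hVeven
  have hV1 : ContDiff ℝ 1 (deriv V) :=
    (contDiff_succ_iff_deriv.1 (by simpa [one_add_one_eq_two] using hV2)).2.2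
  have hVd : ∀ r, HasDerivAt V (deriv V r) r := fun r =>
    (hV2.differentiable two_ne_zero r).hasDerivAt
  have hVdd : ∀ r, HasDerivAt (deriv V) (deriv (deriv V) r) r := fun r =>
    (hV1.differentiable one_ne_zero r).hasDerivAt
  have hRd : ∀ r, HasDerivAt R (deriv R r) r := fun r =>
    (hR1.differentiable one_ne_zero r).hasDerivAt
  have hRn : ∀ r, 0 ≤ R r := fun r => by
    simp only [hRdef]
    rw [hs.density_eq_densityOf]
    exact densityOf_nonneg hφ _
  have hRV : ∀ r, R r = densityOf φ (V r) := fun r => hs.density_eq_densityOf _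
  -- the radial form of the Poisson equation
  have hode : ∀ r, 0 < r → deriv (deriv V) r + 2 * (deriv V r / r) = 4 * Real.pi * R r := by
    intro r hr
    have hn : ‖(EuclideanSpace.single 0 r : E3)‖ = r := by simp [abs_of_pos hr]
    have hx : (EuclideanSpace.single 0 r : E3) ≠ 0 := by
      rw [← norm_pos_iff, hn]; exact hr
    have := laplacian_radial hs.contDiff_potential hV2 hU hx
    rw [hs.poisson, hn] at this
    exact this.symm
  have hQ : ∀ r, 0 ≤ r → r ^ 2 * deriv V r = ∫ s in (0 : ℝ)..r, 4 * Real.pi * s ^ 2 * R s := by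
    intro r hr
    have hRc := hR1.continuous
    have h1 := intervalIntegral.integral_eq_sub_of_hasDerivAt (a := 0) (b := r)
      (f := fun r => r ^ 2 * deriv V r) (f' := fun s => 4 * Real.pi * s ^ 2 * R s) ?_
      (Continuous.intervalIntegrable (by fun_prop) _ _)
    · rw [h1]; simp
    · intro s hs'
      rw [uIcc_of_le hr] at hs'
      refine ((hasDerivAt_pow 2 s).fun_mul (hVdd s)).congr_deriv ?_
      rcases hs'.1.eq_or_lt with h2 | h2
      · rw [← h2, hV0]; simp
      · have := hode s h2
        have h3 : 4 * Real.pi * s ^ 2 * R s = s ^ 2 * (4 * Real.pi * R s) := by ring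
        rw [h3, ← this]
        field_simp
        push_cast
        ring
  have hVn : ∀ r, 0 ≤ r → 0 ≤ deriv V r := by
    intro r hr
    rcases hr.eq_or_lt with h1 | h1
    · rw [← h1, hV0]
    · have h2 : 0 ≤ r ^ 2 * deriv V r := by
        rw [hQ r hr]
        exact intervalIntegral.integral_nonneg hr fun s _ => by
          have := hRn s
          positivity
      exact nonneg_of_mul_nonneg_right h2 (by positivity)
  -- `R = densityOf φ ∘ V` is nonincreasing, and not identically zero since its support is `B_1`
  have hVmono : MonotoneOn V (Ici 0) :=
    monotoneOn_of_deriv_nonneg (convex_Ici 0) hV2.continuous.continuousOn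
      (hV2.differentiable two_ne_zero).differentiableOn
      (fun r hr => by
        rw [interior_Ici] at hr
        exact hVn r (le_of_lt hr))
  have hRanti : ∀ r s, 0 ≤ r → r ≤ s → R s ≤ R r := by
    intro r s hr hrs
    rw [hRV, hRV]
    exact densityOf_antitone hφ (hVmono hr (hr.trans hrs) hrs)
  have hR0pos : 0 < R 0 := by
    refine (hRn 0).lt_of_ne' fun h1 => ?_
    have h2 : ρ₀ = 0 := by
      funext x
      rw [hρ]
      exact le_antisymm ((hRanti 0 _ le_rfl (norm_nonneg x)).trans h1.le) (hRn _)
    have h3 := hs.support_density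
    rw [h2, tsupport_zero] at h3
    have h4 : (0 : E3) ∈ B 1 := by simp [mem_B]
    rw [← h3] at h4
    exact h4
  have hVpos : ∀ r, 0 < r → 0 < deriv V r := by
    intro r hr
    have h2 : 0 < r ^ 2 * deriv V r := by
      rw [hQ r hr.le]
      have hRc := hR1.continuous
      obtain ⟨δ, hδ, hδR⟩ : ∃ δ > 0, ∀ s, 0 ≤ s → s < δ → 0 < R s := by
        obtain ⟨δ, hδ, h5⟩ := Metric.mem_nhds_iff.1
          ((hRc.tendsto 0).eventually (lt_mem_nhds hR0pos))
        refine ⟨δ, hδ, fun s hs0 hsδ => h5 ?_⟩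
        simpa [abs_of_nonneg hs0] using hsδ
      have hm : 0 < min r (δ / 2) := by positivity
      refine intervalIntegral.integral_pos hr (by fun_prop) (fun s _ => ?_)
        ⟨min r (δ / 2), ⟨hm.le, min_le_left _ _⟩, ?_⟩
      · have := hRn s
        positivity
      · have := hδR _ hm.le ((min_le_right _ _).trans_lt (by linarith))
        positivity
    exact (mul_pos_iff_of_pos_left (by positivity)).1 h2
  -- the limit of the radial Poisson equation at the origin
  have hV''0 : 3 * deriv (deriv V) 0 = 4 * Real.pi * R 0 := by
    have hRc := hR1.continuous
    have hV''c : Continuous (deriv (deriv V)) := hV1.continuous_deriv le_rfl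
    have t1 : Tendsto (fun r => deriv V r / r) (𝓝[>] 0) (𝓝 (deriv (deriv V) 0)) := by
      have := (hasDerivAt_iff_tendsto_slope_zero.1 (hVdd 0)).mono_left
        (nhdsWithin_mono 0 (fun r (hr : 0 < r) => hr.ne'))
      refine this.congr fun r => ?_
      rw [hV0]; simp [div_eq_inv_mul]
    have t2 : Tendsto (fun r => deriv (deriv V) r + 2 * (deriv V r / r)) (𝓝[>] 0)
        (𝓝 (deriv (deriv V) 0 + 2 * deriv (deriv V) 0)) :=
      ((hV''c.tendsto 0).mono_left nhdsWithin_le_nhds).add (t1.const_mul 2)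
    have t3 : Tendsto (fun r => 4 * Real.pi * R r) (𝓝[>] 0) (𝓝 (4 * Real.pi * R 0)) :=
      ((by fun_prop : Continuous fun r => 4 * Real.pi * R r).tendsto 0).mono_left nhdsWithin_le_nhds
    have t4 := tendsto_nhds_unique (t2.congr' ?_) t3
    · linarith
    · filter_upwards [self_mem_nhdsWithin] with r hr using hode r hr
  obtain ⟨C, hC0, hC⟩ := densityOf_lipschitz hφ (V 0)
  have hR'np : ∀ r, 0 ≤ r → deriv R r ≤ 0 := by
    intro r hr
    have h1 := (hRd r).hasDerivWithinAt (s := Ioi r)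
    refine le_of_tendsto (hasDerivWithinAt_iff_tendsto_slope' self_notMem_Ioi |>.1 h1) ?_
    filter_upwards [self_mem_nhdsWithin] with s hs'
    rw [slope_def_field]
    exact div_nonpos_of_nonpos_of_nonneg (sub_nonpos.2 (hRanti r s hr (le_of_lt hs')))
      (sub_nonneg.2 (le_of_lt hs'))
  refine ⟨R, V, C, hR1, hV2, hs.contDiff_density, hs.contDiff_potential, hρ, hU,
    hR0, hV0, hVpos, ?_, hR'np, ?_, ?_⟩
  · have : 0 < 4 * Real.pi * R 0 := by positivity
    linarith
  · intro r hr
    have h1 := hasDerivWithinAt_iff_tendsto_slope' self_notMem_Ioi |>.1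
      ((hRd r).hasDerivWithinAt (s := Ioi r))
    have h2 := hasDerivWithinAt_iff_tendsto_slope' self_notMem_Ioi |>.1
      ((hVd r).hasDerivWithinAt (s := Ioi r))
    refine le_of_tendsto_of_tendsto h1.neg (h2.const_mul C) ?_
    filter_upwards [self_mem_nhdsWithin] with s hs'
    have hrs : r < s := hs'
    have h3 := hC (V r) (V s) (hVmono (mem_Ici.2 le_rfl) hr hr) (hVmono hr (hr.trans hrs.le) hrs.le)
    rw [← hRV, ← hRV] at h3
    rw [slope_def_field, slope_def_field, ← neg_div, ← mul_div_assoc]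
    exact div_le_div_of_nonneg_right (by linarith) (by linarith)
  · have hRc := hR1.continuous
    -- `-W` is the potential of the density, and `V + W` is constant with limit zero at infinity
    set W : ℝ → ℝ := fun r => (∫ s in (0 : ℝ)..r, 4 * Real.pi * s ^ 2 * R s) / r +
      ((∫ s in (0 : ℝ)..2, 4 * Real.pi * s * R s) -
        ∫ s in (0 : ℝ)..r, 4 * Real.pi * s * R s) with hW
    have hWd : ∀ r, 0 < r → HasDerivAt (fun r => V r + W r) 0 r := by
      intro r hr
      have d1 := ((by fun_prop :
        Continuous fun s => 4 * Real.pi * s ^ 2 * R s).integral_hasStrictDerivAt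
        0 r).hasDerivAt
      have d2 := ((by fun_prop :
        Continuous fun s => 4 * Real.pi * s * R s).integral_hasStrictDerivAt
        0 r).hasDerivAt
      have d3 := (hVd r).fun_add ((d1.fun_div (hasDerivAt_id r) hr.ne').fun_add (d2.const_sub
        (∫ s in (0 : ℝ)..2, 4 * Real.pi * s * R s)))
      refine d3.congr_deriv ?_
      simp only [id]
      rw [← hQ r hr.le]
      field_simp
      ring
    obtain ⟨c, hc⟩ := isOpen_Ioi.exists_is_const_of_deriv_eq_zero isPreconnected_Ioi
      (s := Ioi (0 : ℝ)) (fun r hr => (hWd r hr).differentiableAt.differentiableWithinAt)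
      (fun r hr => (hWd r hr).deriv)
    have hVlim : Tendsto V atTop (𝓝 0) := by
      have : Tendsto (fun r : ℝ => (EuclideanSpace.single 0 r : E3)) atTop (cocompact E3) := by
        rw [← Metric.cobounded_eq_cocompact, ← tendsto_norm_atTop_iff_cobounded]
        simpa using tendsto_abs_atTop_atTop
      exact hs.potential_at_infinity.comp this
    have hWlim : Tendsto W atTop (𝓝 0) := by
      have e : ∀ k : ℕ, ∀ r, 2 ≤ r → ∫ s in (0 : ℝ)..r, 4 * Real.pi * s ^ k * R s =
          ∫ s in (0 : ℝ)..2, 4 * Real.pi * s ^ k * R s := by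
        intro k r hr
        have i2 : ∀ a b : ℝ,
            IntervalIntegrable (fun s : ℝ => 4 * Real.pi * s ^ k * R s) volume a b :=
          fun a b => Continuous.intervalIntegrable (by fun_prop) a b
        rw [← intervalIntegral.integral_add_adjacent_intervals (i2 0 2) (i2 2 r)]
        have : ∫ s in (2 : ℝ)..r, 4 * Real.pi * s ^ k * R s = 0 := by
          rw [intervalIntegral.integral_congr (g := fun _ => 0)]
          · simp
          · intro s hs
            rw [uIcc_of_le hr] at hs
            simp [hR0 s (by linarith [hs.1])]
        rw [this, add_zero]
      have t := tendsto_const_nhds (x := ∫ s in (0 : ℝ)..2, 4 * Real.pi * s ^ 2 * R s)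
        (f := atTop) |>.div_atTop (tendsto_id (α := ℝ))
      refine t.congr' ?_
      filter_upwards [eventually_ge_atTop 2] with r hr
      have e1 := e 1 r hr
      simp only [pow_one] at e1
      simp only [hW, id]
      rw [e 2 r hr, e1, sub_self, add_zero]
    have hc0 : c = 0 := by
      have h1 := hVlim.add hWlim
      rw [add_zero] at h1
      refine tendsto_nhds_unique (tendsto_const_nhds.congr' ?_) h1
      filter_upwards [eventually_gt_atTop 0] with r hr using (hc r hr).symm
    have hne : ∀ x : E3, x ≠ 0 → U₀ x = -newton ρ₀ x := by
      intro x hx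
      have hr : 0 < ‖x‖ := norm_pos_iff.2 hx
      rw [newton_radial_formula hRc hρ hR0 hx, hU]
      have := hc ‖x‖ hr
      rw [hc0] at this
      linarith
    obtain ⟨A, hA⟩ := isSource_of_radial hRc hρ hR0
    have hd : Dense ({0}ᶜ : Set E3) := dense_compl_singleton 0
    have := Continuous.ext_on hd hs.contDiff_potential.continuous hA.continuous_newton.neg
      (fun x hx => hne x hx)
    exact fun x => congrFun this x

/-! ### The coefficient of the linearized problem -/

/-- The coefficient `q = -R' / V'` of the linearized equation `Δw = -4π q w`, in terms of the
density as a function of the potential its negative derivative. It is bounded, nonnegative, and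
zero outside `B_1`; at the origin it has the junk value zero. -/
def linCoeff (R V : ℝ → ℝ) (x : E3) : ℝ := -deriv R ‖x‖ / deriv V ‖x‖

theorem linCoeff_radial (R V : ℝ → ℝ) : Radial (linCoeff R V) := fun x y hxy => by
  simp only [linCoeff, hxy]

theorem linCoeff_iso (R V : ℝ → ℝ) (e : E3 ≃ₗᵢ[ℝ] E3) (x : E3) :
    linCoeff R V (e x) = linCoeff R V x := linCoeff_radial R V _ _ (e.norm_map x)

/-- `∂₃U₀`, written with the radial profile of `U₀`. -/
def dU3 (V : ℝ → ℝ) (x : E3) : ℝ := deriv V ‖x‖ / ‖x‖ * x 2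

namespace RadialProfiles

variable {ρ₀ U₀ : E3 → ℝ} {R V : ℝ → ℝ} {C : ℝ}

theorem C_nonneg (hP : RadialProfiles ρ₀ U₀ R V C) : 0 ≤ C := by
  have h1 := hP.neg_deriv_R_le 1 zero_le_one
  have h2 := hP.deriv_R_nonpos 1 zero_le_one
  have h3 := hP.deriv_V_pos 1 zero_lt_one
  exact nonneg_of_mul_nonneg_left (by linarith : 0 ≤ C * deriv V 1) h3

theorem deriv_V_nonneg (hP : RadialProfiles ρ₀ U₀ R V C) {r : ℝ} (hr : 0 ≤ r) : 0 ≤ deriv V r := by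
  rcases hr.eq_or_lt with h | h
  · rw [← h, hP.deriv_V_zero]
  · exact (hP.deriv_V_pos r h).le

theorem linCoeff_nonneg (hP : RadialProfiles ρ₀ U₀ R V C) (x : E3) : 0 ≤ linCoeff R V x :=
  div_nonneg (by linarith [hP.deriv_R_nonpos ‖x‖ (norm_nonneg x)])
    (hP.deriv_V_nonneg (norm_nonneg x))

theorem linCoeff_le (hP : RadialProfiles ρ₀ U₀ R V C) (x : E3) : linCoeff R V x ≤ C :=
  div_le_of_le_mul₀ (hP.deriv_V_nonneg (norm_nonneg x)) hP.C_nonneg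
    (hP.neg_deriv_R_le ‖x‖ (norm_nonneg x))

theorem linCoeff_mul (hP : RadialProfiles ρ₀ U₀ R V C) (x : E3) :
    linCoeff R V x * deriv V ‖x‖ = -deriv R ‖x‖ := by
  -- at the origin `V'` vanishes, and so does `R'` because `0 ≤ -R' ≤ C * V'`
  rcases eq_or_ne x 0 with rfl | hx
  · have h1 := hP.neg_deriv_R_le 0 le_rfl
    have h2 := hP.deriv_R_nonpos 0 le_rfl
    rw [hP.deriv_V_zero] at h1
    rw [norm_zero, hP.deriv_V_zero]
    linarith
  · exact div_mul_cancel₀ _ (hP.deriv_V_pos _ (norm_pos_iff.2 hx)).ne'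

theorem deriv_R_zero (hP : RadialProfiles ρ₀ U₀ R V C) {r : ℝ} (hr : 1 < r) : deriv R r = 0 := by
  have : R =ᶠ[𝓝 r] fun _ => 0 := by
    filter_upwards [lt_mem_nhds hr] with s hs using hP.R_zero s hs
  rw [this.deriv_eq, deriv_const]

theorem linCoeff_zero (hP : RadialProfiles ρ₀ U₀ R V C) {x : E3} (hx : 1 < ‖x‖) :
    linCoeff R V x = 0 := by
  rw [linCoeff, hP.deriv_R_zero hx, neg_zero, zero_div]

theorem contDiff_deriv_V (hP : RadialProfiles ρ₀ U₀ R V C) : ContDiff ℝ 1 (deriv V) :=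
  (contDiff_succ_iff_deriv.1 (by simpa [one_add_one_eq_two] using hP.contDiff_V)).2.2

theorem continuous_deriv_R (hP : RadialProfiles ρ₀ U₀ R V C) : Continuous (deriv R) :=
  hP.contDiff_R.continuous_deriv le_rfl

theorem measurable_linCoeff (hP : RadialProfiles ρ₀ U₀ R V C) : Measurable (linCoeff R V) := by
  have h1 := hP.continuous_deriv_R.measurable
  have h2 := hP.contDiff_deriv_V.continuous.measurable
  unfold linCoeff
  fun_prop

theorem isSource_mul (hP : RadialProfiles ρ₀ U₀ R V C) {w : E3 → ℝ} {M : ℝ} (hw : Measurable w)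
    (hM0 : 0 ≤ M) (hM : ∀ x ∈ B 1, |w x| ≤ M) : IsSource (C * M) (linCoeff R V * w) where
  meas := (hP.measurable_linCoeff.mul hw).aestronglyMeasurable
  bound y := by
    rw [Pi.mul_apply, abs_mul, abs_of_nonneg (hP.linCoeff_nonneg y)]
    by_cases hy : y ∈ B 1
    · exact mul_le_mul (hP.linCoeff_le y) (hM y hy) (abs_nonneg _) hP.C_nonneg
    · rw [mem_B, not_le] at hy
      rw [hP.linCoeff_zero hy, zero_mul]
      exact mul_nonneg hP.C_nonneg hM0
  zero y hy := by
    rw [mem_B, not_le] at hy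
    rw [Pi.mul_apply, hP.linCoeff_zero (by linarith), zero_mul]

/-- `V'(r)/r` is bounded from above and below by positive constants. -/
theorem exists_bounds (hP : RadialProfiles ρ₀ U₀ R V C) (b : ℝ) :
    ∃ c c' : ℝ, 0 < c ∧ 0 < c' ∧ ∀ r, 0 < r → r ≤ b → c * r ≤ deriv V r ∧ deriv V r ≤ c' * r := by
  rcases lt_or_ge b 0 with hb | hb
  · exact ⟨1, 1, one_pos, one_pos, fun r h1 h2 => by linarith⟩
  have hd : DifferentiableAt ℝ (deriv V) 0 := hP.contDiff_deriv_V.differentiable one_ne_zero 0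
  have hc : ContinuousOn (dslope (deriv V) 0) (Icc 0 b) :=
    ((continuousOn_dslope univ_mem).2
      ⟨hP.contDiff_deriv_V.continuous.continuousOn, hd⟩).mono (subset_univ _)
  have hval : ∀ r, 0 < r → dslope (deriv V) 0 r = deriv V r / r := by
    intro r hr
    rw [dslope_of_ne _ hr.ne', slope_def_field, hP.deriv_V_zero, sub_zero, sub_zero]
  have hpos : ∀ r ∈ Icc 0 b, 0 < dslope (deriv V) 0 r := by
    intro r hr
    rcases hr.1.eq_or_lt with h | h
    · rw [← h, dslope_same]; exact hP.deriv2_V_zero_pos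
    · rw [hval r h]; exact div_pos (hP.deriv_V_pos r h) h
  obtain ⟨r1, hr1, hmin⟩ := isCompact_Icc.exists_isMinOn (nonempty_Icc.2 hb) hc
  obtain ⟨r2, hr2, hmax⟩ := isCompact_Icc.exists_isMaxOn (nonempty_Icc.2 hb) hc
  refine ⟨_, _, hpos r1 hr1, hpos r2 hr2, fun r h1 h2 => ?_⟩
  have k1 := hmin (show r ∈ Icc 0 b from ⟨h1.le, h2⟩)
  have k2 := hmax (show r ∈ Icc 0 b from ⟨h1.le, h2⟩)
  simp only [mem_ofPred_eq] at k1 k2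
  rw [hval r h1] at k1 k2
  exact ⟨(le_div_iff₀ h1).1 k1, (div_le_iff₀ h1).1 k2⟩

theorem hasDerivAt_V (hP : RadialProfiles ρ₀ U₀ R V C) (r : ℝ) : HasDerivAt V (deriv V r) r :=
  (hP.contDiff_V.differentiable two_ne_zero r).hasDerivAt

theorem hasDerivAt_deriv_V (hP : RadialProfiles ρ₀ U₀ R V C) (r : ℝ) :
    HasDerivAt (deriv V) (deriv (deriv V) r) r :=
  (hP.contDiff_deriv_V.differentiable one_ne_zero r).hasDerivAt

theorem hasDerivAt_R (hP : RadialProfiles ρ₀ U₀ R V C) (r : ℝ) : HasDerivAt R (deriv R r) r :=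
  (hP.contDiff_R.differentiable one_ne_zero r).hasDerivAt

theorem isSource_density (hP : RadialProfiles ρ₀ U₀ R V C) : ∃ A, IsSource A ρ₀ :=
  isSource_of_radial hP.contDiff_R.continuous hP.density_eq hP.R_zero

end RadialProfiles

/-- Differentiation commutes with the Newtonian potential. -/
theorem inner_field_eq_newton_fderiv {ρ : E3 → ℝ} {A : ℝ} (hρ : ContDiff ℝ 1 ρ)
    (hA : IsSource A ρ) (h0 : ∀ y, y ∉ B 1 → ρ y = 0) {e : E3} (he : ‖e‖ ≤ 1) (x : E3) :
    inner ℝ (field ρ x) e = newton (fun y => fderiv ℝ ρ y e) x := by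
  have hline : HasDerivAt (fun t : ℝ => x + t • e) e 0 := by
    simpa using ((hasDerivAt_id (0 : ℝ)).smul_const e).const_add x
  have d1 : HasDerivAt (fun t : ℝ => newton ρ (x + t • e)) (inner ℝ (field ρ x) e) 0 := by
    have h1 : HasFDerivAt (newton ρ) (InnerProductSpace.toDual ℝ E3 (field ρ x))
        (x + (0 : ℝ) • e) := by
      rw [zero_smul, add_zero]
      exact (hA.hasGradientAt x).hasFDerivAt
    have h2 := h1.comp_hasDerivAt (0 : ℝ) hline
    exact h2.congr_deriv (by simp)
  have htrans : ∀ t : ℝ, newton ρ (x + t • e) = ∫ y, ρ (y + t • e) / ‖x - y‖ := by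
    intro t
    rw [newton, ← integral_add_right_eq_self _ (t • e)]
    simp only [add_sub_add_right_eq_sub]
  have hfd : Continuous (fderiv ℝ ρ) := hρ.continuous_fderiv one_ne_zero
  obtain ⟨M, hM⟩ := (isCompact_closedBall (0 : E3) 3).exists_bound_of_continuousOn
    hfd.continuousOn
  have hfd0 : ∀ y, y ∉ B 1 → fderiv ℝ ρ y = 0 := by
    intro y hy
    have : ρ =ᶠ[𝓝 y] fun _ => 0 := by
      filter_upwards [Metric.isClosed_closedBall.isOpen_compl.mem_nhds hy] with z hz using h0 z hz
    rw [this.fderiv_eq]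
    simp
  set bd : E3 → ℝ := (B 2).indicator (fun _ => |M|) with hbd
  have hbdS : IsSource |M| bd := by
    refine ⟨(measurable_const.indicator (measurableSet_B 2)).aestronglyMeasurable, fun y => ?_,
      fun y hy => indicator_of_notMem hy _⟩
    by_cases hy : y ∈ B 2
    · rw [hbd, indicator_of_mem hy, abs_abs]
    · rw [hbd, indicator_of_notMem hy, abs_zero]; exact abs_nonneg _
  have hkey := hasDerivAt_integral_of_dominated_loc_of_deriv_le (μ := (volume : Measure E3))
    (F := fun (t : ℝ) y => ρ (y + t • e) / ‖x - y‖)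
    (F' := fun (t : ℝ) y => fderiv ℝ ρ (y + t • e) e / ‖x - y‖) (x₀ := (0 : ℝ))
    (bound := fun y => bd y / ‖x - y‖) (s := Metric.ball 0 1)
    (Metric.ball_mem_nhds 0 one_pos) ?_ ?_ ?_ ?_ (hbdS.integrable_newton x).1 ?_
  · have d2 := hkey.2
    simp only [zero_smul, add_zero] at d2
    rw [funext htrans] at d1
    exact d1.unique d2
  · refine .of_forall fun t => ?_
    have := hρ.continuous
    exact Measurable.aestronglyMeasurable (by fun_prop)
  · simpa using (hA.integrable_newton x).1
  · exact Measurable.aestronglyMeasurable (by fun_prop)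
  · refine .of_forall fun y t ht => ?_
    have ht1 : ‖t • e‖ ≤ 1 := by
      rw [norm_smul]
      have : ‖t‖ ≤ 1 := by simpa using (Metric.mem_ball.1 ht).le
      exact mul_le_one₀ this (norm_nonneg _) he
    rw [norm_div, norm_norm]
    refine div_le_div_of_nonneg_right ?_ (norm_nonneg _)
    by_cases hy : y + t • e ∈ B 1
    · have hy2 : y ∈ B 2 := by
        rw [mem_B] at hy ⊢
        have := norm_sub_le (y + t • e) (t • e)
        rw [add_sub_cancel_right] at this
        linarith
      rw [hbd, indicator_of_mem hy2]
      have h3 := hM (y + t • e) (by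
        rw [mem_B] at hy
        rw [mem_closedBall_zero_iff]
        linarith)
      calc ‖fderiv ℝ ρ (y + t • e) e‖ ≤ ‖fderiv ℝ ρ (y + t • e)‖ * ‖e‖ :=
            ContinuousLinearMap.le_opNorm _ _
        _ ≤ M * 1 := mul_le_mul h3 he (norm_nonneg _) ((norm_nonneg _).trans h3)
        _ ≤ |M| := by rw [mul_one]; exact le_abs_self M
    · rw [hfd0 _ hy]
      simp only [zero_apply, norm_zero]
      exact indicator_nonneg (fun _ _ => abs_nonneg _) _
  · refine .of_forall fun y t _ => ?_
    have hl : HasDerivAt (fun t : ℝ => y + t • e) e t := by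
      simpa using ((hasDerivAt_id t).smul_const e).const_add y
    exact (((hρ.differentiable one_ne_zero _).hasFDerivAt.comp_hasDerivAt t hl)).div_const _

/-- Translations of the steady state generate a solution of the linearized equation: differentiate
`U₀ = -newton ρ₀` in the direction of the third axis. -/
theorem RadialProfiles.dU3_eq_newton {ρ₀ U₀ : E3 → ℝ} {R V : ℝ → ℝ} {C : ℝ}
    (hP : RadialProfiles ρ₀ U₀ R V C) {x : E3} (hx : x ≠ 0) :
    dU3 V x = newton (linCoeff R V * dU3 V) x := by
  set e : E3 := EuclideanSpace.single 2 1 with he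
  have hin : ∀ y : E3, inner ℝ y e = y 2 := fun y => by
    simp [he, EuclideanSpace.inner_single_right]
  obtain ⟨A, hA⟩ := hP.isSource_density
  have hU : U₀ = fun x => V ‖x‖ := funext hP.potential_eq
  have hρ : ρ₀ = fun x => R ‖x‖ := funext hP.density_eq
  have g1 : HasGradientAt U₀ ((deriv V ‖x‖ / ‖x‖) • x) x := by
    rw [hU]; exact hasGradientAt_radial hx (hP.hasDerivAt_V _)
  have g2 : HasGradientAt U₀ (-field ρ₀ x) x := by
    have h1 := (hA.hasGradientAt x).hasFDerivAt.neg
    rw [hasGradientAt_iff_hasFDerivAt, map_neg]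
    refine h1.congr_of_eventuallyEq (.of_forall fun y => ?_)
    rw [hP.potential_eq_newton, Pi.neg_apply]
  have g3 : (deriv V ‖x‖ / ‖x‖) • x = -field ρ₀ x := g1.unique g2
  have h4 := inner_field_eq_newton_fderiv hP.contDiff_density hA (fun y hy => by
    rw [mem_B, not_le] at hy
    rw [hP.density_eq, hP.R_zero _ hy]) (e := e) (by simp [he]) x
  have h5 : newton (fun y => fderiv ℝ ρ₀ y e) x = -newton (linCoeff R V * dU3 V) x := by
    rw [newton, newton, ← integral_neg]
    refine integral_congr_ae ?_
    filter_upwards [ae_sub_ne 0] with y hy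
    have hy0 : y ≠ 0 := by simpa using hy
    have g4 : HasGradientAt ρ₀ ((deriv R ‖y‖ / ‖y‖) • y) y := by
      rw [hρ]; exact hasGradientAt_radial hy0 (hP.hasDerivAt_R _)
    rw [g4.hasFDerivAt.fderiv, InnerProductSpace.toDual_apply_apply, inner_smul_left, hin,
      Pi.mul_apply, dU3]
    have := hP.linCoeff_mul y
    have h6 : deriv R ‖y‖ = -(linCoeff R V y * deriv V ‖y‖) := by linarith
    rw [h6, conj_trivial]
    ring
  have h7 : ((deriv V ‖x‖ / ‖x‖) • x) 2 = (-field ρ₀ x) 2 := by rw [g3]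
  rw [PiLp.smul_apply, PiLp.neg_apply, smul_eq_mul] at h7
  rw [dU3, h7, ← hin, h4, h5, neg_neg]

/-! ### Solutions of the linearized equation that are odd in the third coordinate -/

/-- A bounded function that is harmonic for a symmetric positive kernel is constant: testing the
equation with `a` gives `∬ P(x, y) (a(x) - a(y))² = 0`. -/
theorem exists_ae_eq_const {Ω : Type*} [MeasurableSpace Ω] {μ : Measure Ω} [IsFiniteMeasure μ]
    {P : Ω → Ω → ℝ} (hint : Integrable (fun z : Ω × Ω => P z.1 z.2) (μ.prod μ))
    (hsymm : ∀ x y, P x y = P y x) (hpos : ∀ᵐ z ∂(μ.prod μ), 0 < P z.1 z.2)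
    {a : Ω → ℝ} (ha : Measurable a) {A : ℝ} (hA : ∀ᵐ x ∂μ, |a x| ≤ A)
    (hharm : ∀ᵐ x ∂μ, ∫ y, P x y * (a x - a y) ∂μ = 0) :
    ∃ c, ∀ᵐ x ∂μ, a x = c := by
  have hA1 : ∀ᵐ z ∂(μ.prod μ), |a z.1| ≤ A := Measure.quasiMeasurePreserving_fst.ae hA
  have hA2 : ∀ᵐ z ∂(μ.prod μ), |a z.2| ≤ A := Measure.quasiMeasurePreserving_snd.ae hA
  have hint1 : Integrable (fun z : Ω × Ω => P z.1 z.2 * (a z.1 * (a z.1 - a z.2))) (μ.prod μ) := by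
    refine hint.mul_bdd (c := A * (A + A)) (Measurable.aestronglyMeasurable (by fun_prop)) ?_
    filter_upwards [hA1, hA2] with z h1 h2
    rw [Real.norm_eq_abs, abs_mul]
    exact mul_le_mul h1 ((abs_sub _ _).trans (add_le_add h1 h2)) (abs_nonneg _)
      ((abs_nonneg _).trans h1)
  have h0 : ∫ z, P z.1 z.2 * (a z.1 * (a z.1 - a z.2)) ∂(μ.prod μ) = 0 := by
    rw [integral_prod _ hint1]
    rw [integral_eq_zero_of_ae]
    filter_upwards [hharm] with x hx
    have : ∀ y, P x y * (a x * (a x - a y)) = a x * (P x y * (a x - a y)) := fun y => by ring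
    simp only [this, integral_const_mul, hx, mul_zero, Pi.zero_apply]
  have h0' : ∫ z, P z.1 z.2 * (a z.2 * (a z.2 - a z.1)) ∂(μ.prod μ) = 0 := by
    rw [← integral_prod_swap, ← h0]
    simp only [Prod.fst_swap, Prod.snd_swap]
    exact integral_congr_ae (.of_forall fun z => by simp only [hsymm z.2 z.1])
  have hint2 : Integrable (fun z : Ω × Ω => P z.1 z.2 * (a z.2 * (a z.2 - a z.1))) (μ.prod μ) := by
    have := hint1.swap
    refine this.congr (.of_forall fun z => ?_)
    simp only [Function.comp_apply, Prod.fst_swap, Prod.snd_swap, hsymm z.2 z.1]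
  have hsum := integral_add hint1 hint2
  rw [h0, h0', add_zero] at hsum
  have hae := (integral_eq_zero_iff_of_nonneg_ae (by
    filter_upwards [hpos] with z hz
    have : P z.1 z.2 * (a z.1 * (a z.1 - a z.2)) + P z.1 z.2 * (a z.2 * (a z.2 - a z.1)) =
      P z.1 z.2 * (a z.1 - a z.2) ^ 2 := by ring
    rw [Pi.add_apply, this]
    exact mul_nonneg hz.le (sq_nonneg _)) (hint1.add hint2)).1 hsum
  have hdiag : ∀ᵐ z ∂(μ.prod μ), a z.2 = a z.1 := by
    filter_upwards [hae, hpos] with z h1 h2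
    have : P z.1 z.2 * (a z.1 - a z.2) ^ 2 = 0 := by
      rw [← Pi.zero_apply (M := fun _ : Ω × Ω => ℝ) z, ← h1, Pi.add_apply]; ring
    have := (mul_eq_zero.1 this).resolve_left h2.ne'
    have := pow_eq_zero_iff two_ne_zero |>.1 this
    linarith
  have h3 := Measure.ae_ae_of_ae_prod hdiag
  rcases eq_or_ne μ 0 with hμ | hμ
  · exact ⟨0, by rw [hμ]; simp⟩
  · have : NeBot (ae μ) := ae_neBot.2 hμ
    obtain ⟨x, hx⟩ := h3.exists
    exact ⟨a x, hx⟩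

theorem norm_sub_refl3_sq (x y : E3) : ‖refl3 x - y‖ ^ 2 = ‖x - y‖ ^ 2 + 4 * (x 2 * y 2) := by
  rw [refl3_apply, planeReflection, norm_eq_three, norm_eq_three, Real.sq_sqrt (by positivity),
    Real.sq_sqrt (by positivity)]
  simp
  ring

theorem norm_sub_refl3_comm (x y : E3) : ‖refl3 x - y‖ = ‖refl3 y - x‖ := by
  have h := norm_sub_refl3_sq x y
  rw [norm_sub_rev x y, mul_comm (x 2), ← norm_sub_refl3_sq] at h
  exact (pow_left_inj₀ (norm_nonneg _) (norm_nonneg _) two_ne_zero).1 h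

theorem sub_refl3_norm (x : E3) : ‖x - refl3 x‖ = 2 * |x 2| := by
  rw [refl3_apply, planeReflection, norm_eq_three]
  have : x 2 + x 2 = 2 * x 2 := by ring
  simp [this, Real.sqrt_sq_eq_abs, abs_mul]

theorem ae_coord_ne : ∀ᵐ y : E3, y 2 ≠ 0 := by
  have h := Measure.addHaar_submodule (volume : Measure E3)
    (LinearMap.ker (EuclideanSpace.proj (2 : Fin 3) : E3 →L[ℝ] ℝ).toLinearMap) (by
      intro h
      have : (EuclideanSpace.single 2 1 : E3) ∈ (⊤ : Submodule ℝ E3) := trivial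
      rw [← h] at this
      simp at this)
  refine measure_mono_null (fun y hy => ?_) h
  simpa using hy

/-- Green's function of the half space `x₃ > 0` up to a constant factor, extended as an odd
function. -/
def halfKernel (x y : E3) : ℝ := ‖x - y‖⁻¹ - ‖refl3 x - y‖⁻¹

theorem halfKernel_symm (x y : E3) : halfKernel x y = halfKernel y x := by
  rw [halfKernel, halfKernel, norm_sub_rev x y, norm_sub_refl3_comm]

/-- The product with `x₃ y₃` is positive on both sides of the plane of reflection. -/
theorem halfKernel_pos {x y : E3} (h1 : x - y ≠ 0) (h2 : refl3 x - y ≠ 0) (hx : x 2 ≠ 0)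
    (hy : y 2 ≠ 0) : 0 < halfKernel x y * (x 2 * y 2) := by
  have hsq := norm_sub_refl3_sq x y
  have p1 := norm_pos_iff.2 h1
  have p2 := norm_pos_iff.2 h2
  have hid : halfKernel x y * (x 2 * y 2) =
      4 * (x 2 * y 2) ^ 2 / (‖x - y‖ * ‖refl3 x - y‖ * (‖x - y‖ + ‖refl3 x - y‖)) := by
    have : ‖refl3 x - y‖ - ‖x - y‖ = 4 * (x 2 * y 2) / (‖x - y‖ + ‖refl3 x - y‖) := by
      field_simp
      linarith
    rw [halfKernel, inv_sub_inv p1.ne' p2.ne', this]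
    field_simp
  rw [hid]
  have := mul_ne_zero hx hy
  positivity

theorem dU3_refl3 (V : ℝ → ℝ) (x : E3) : dU3 V (refl3 x) = -dU3 V x := by
  rw [dU3, dU3, refl3.norm_map, refl3_apply, planeReflection]
  simp

theorem RadialProfiles.measurable_dU3 {ρ₀ U₀ : E3 → ℝ} {R V : ℝ → ℝ} {C : ℝ}
    (hP : RadialProfiles ρ₀ U₀ R V C) : Measurable (dU3 V) := by
  have h2 := hP.contDiff_deriv_V.continuous.measurable
  unfold dU3
  fun_prop

theorem measurable_halfKernel : Measurable fun z : E3 × E3 => halfKernel z.1 z.2 := by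
  unfold halfKernel
  have := refl3.continuous.measurable
  fun_prop

/-- Solutions of the linearized equation that are odd in `x₃` are multiples of `∂₃U₀`. This is the
ground state argument of Perron and Frobenius: `u = ∂₃U₀` is an odd solution that is positive for
`x₃ > 0`, the odd part of the Newtonian kernel is positive there, and the quotient `v / u` is
harmonic for the symmetric kernel `halfKernel x y * (u x * u y)` with respect to the measure
`q dx`. -/
theorem RadialProfiles.exists_eq_mul_dU3 {ρ₀ U₀ : E3 → ℝ} {R V : ℝ → ℝ} {C : ℝ}
    (hP : RadialProfiles ρ₀ U₀ R V C) {v : E3 → ℝ} {M : ℝ} (hv : Measurable v)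
    (hM : ∀ x, |v x| ≤ M) (hodd : ∀ x, v (refl3 x) = -v x)
    (heq : ∀ x, newton (linCoeff R V * v) x = v x) :
    ∃ c, ∀ x, x ≠ 0 → v x = c * dU3 V x := by
  have hM0 : 0 ≤ M := (abs_nonneg _).trans (hM 0)
  set q := linCoeff R V with hq
  set u := dU3 V with hu
  have hqm : Measurable q := hP.measurable_linCoeff
  have hum : Measurable u := hP.measurable_dU3
  obtain ⟨b, b', hb, hb', hbd⟩ := hP.exists_bounds 1
  have hub : ∀ x ∈ B 1, |u x| ≤ b' := by
    intro x hx
    rw [mem_B] at hx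
    rcases eq_or_ne x 0 with rfl | hx0
    · simp [hu, dU3, hb'.le]
    have hr := norm_pos_iff.2 hx0
    rw [hu, dU3, abs_mul, abs_of_nonneg (div_nonneg (hP.deriv_V_pos _ hr).le hr.le)]
    have h1 : deriv V ‖x‖ / ‖x‖ ≤ b' := (div_le_iff₀ hr).2 (hbd _ hr hx).2
    have h2 : |x 2| ≤ 1 := (by simpa using PiLp.norm_apply_le x 2 : |x 2| ≤ ‖x‖).trans hx
    calc _ ≤ b' * 1 := mul_le_mul h1 h2 (abs_nonneg _) hb'.le
      _ = b' := mul_one _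
  have hsu : IsSource (C * b') (q * u) := hP.isSource_mul hum hb'.le hub
  have hsv : IsSource (C * M) (q * v) := hP.isSource_mul hv hM0 fun x _ => hM x
  -- the measure `q dx`
  set μ : Measure E3 := volume.withDensity fun x => ((q x).toNNReal : ENNReal) with hμ
  have hqn : Measurable fun x => (q x).toNNReal := hqm.real_toNNReal
  have hac : μ ≪ volume := withDensity_absolutelyContinuous _ _
  have hμB : ∀ᵐ x ∂μ, x ∈ B 1 := by
    rw [hμ, ae_withDensity_iff (by fun_prop)]
    refine .of_forall fun x hx => ?_
    by_contra h
    rw [mem_B, not_le] at h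
    simp [hq, hP.linCoeff_zero h] at hx
  have hfin : IsFiniteMeasure μ := by
    refine isFiniteMeasure_withDensity ?_
    have h1 : ∀ x, ((q x).toNNReal : ENNReal) ≤ (B 1).indicator (fun _ => ENNReal.ofReal C) x := by
      intro x
      by_cases hx : x ∈ B 1
      · rw [indicator_of_mem hx]
        exact ENNReal.ofReal_le_ofReal (hP.linCoeff_le x)
      · rw [indicator_of_notMem hx]
        rw [mem_B, not_le] at hx
        simp [hq, hP.linCoeff_zero hx]
    refine ((lintegral_mono h1).trans_lt ?_).ne
    rw [lintegral_indicator (measurableSet_B 1), setLIntegral_const]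
    exact ENNReal.mul_lt_top ENNReal.ofReal_lt_top (volume_B_ne_top 1).lt_top
  -- integrals against the kernel
  have hker : ∀ {f : E3 → ℝ} {A : ℝ}, IsSource A (q * f) → ∀ x,
      Integrable (fun y => halfKernel x y * f y) μ ∧
      ∫ y, halfKernel x y * f y ∂μ = newton (q * f) x - newton (q * f) (refl3 x) := by
    intro f A hf x
    have e : ∀ y, (q y).toNNReal • (halfKernel x y * f y) =
        (q * f) y / ‖x - y‖ - (q * f) y / ‖refl3 x - y‖ := by
      intro y
      rw [NNReal.smul_def, Real.coe_toNNReal _ (hP.linCoeff_nonneg y), halfKernel, Pi.mul_apply,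
        smul_eq_mul]
      ring
    constructor
    · rw [hμ, integrable_withDensity_iff_integrable_smul hqn]
      simp only [e]
      exact (hf.integrable_newton x).1.sub (hf.integrable_newton _).1
    · rw [hμ, integral_withDensity_eq_integral_smul hqn]
      simp only [e]
      exact integral_sub (hf.integrable_newton x).1 (hf.integrable_newton _).1
  set a : E3 → ℝ := fun x => v x / u x with ha
  have ham : Measurable a := hv.div hum
  have hune : ∀ᵐ x : E3, u x ≠ 0 := by
    filter_upwards [ae_coord_ne] with x hx
    have hx0 : x ≠ 0 := by rintro rfl; simp at hx
    have hr := norm_pos_iff.2 hx0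
    exact mul_ne_zero (div_pos (hP.deriv_V_pos _ hr) hr).ne' hx
  -- oddness and Lipschitz continuity make `v / u` bounded up to the plane of reflection
  have hvL : ∀ x, |v x| ≤ 2 * (C * M) * CJ * |x 2| := by
    intro x
    have h1 := hsv.newton_lipschitz x (refl3 x)
    rw [heq, heq, hodd, norm_sub_rev, sub_refl3_norm] at h1
    have h2 : |-v x - v x| = 2 * |v x| := by
      rw [show -v x - v x = -(2 * v x) by ring, abs_neg, abs_mul, abs_two]
    rw [h2] at h1
    linarith
  have haA : ∀ᵐ x ∂μ, |a x| ≤ 2 * (C * M) * CJ / b := by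
    have hA0 : 0 ≤ 2 * (C * M) * CJ :=
      mul_nonneg (mul_nonneg zero_le_two (mul_nonneg hP.C_nonneg hM0)) CJ_nonneg
    filter_upwards [hμB] with x hx
    rw [mem_B] at hx
    rw [ha]
    rcases eq_or_ne x 0 with rfl | hx0
    · simp only [hu, dU3, PiLp.zero_apply, mul_zero, div_zero, abs_zero]
      exact div_nonneg hA0 hb.le
    have hr := norm_pos_iff.2 hx0
    have h1 : b * |x 2| ≤ |u x| := by
      rw [hu, dU3, abs_mul, abs_of_nonneg (div_nonneg (hP.deriv_V_pos _ hr).le hr.le)]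
      exact mul_le_mul_of_nonneg_right ((le_div_iff₀ hr).2 (hbd _ hr hx).1) (abs_nonneg _)
    rw [abs_div]
    refine div_le_of_le_mul₀ (abs_nonneg _) (div_nonneg hA0 hb.le) ((hvL x).trans ?_)
    calc 2 * (C * M) * CJ * |x 2| = 2 * (C * M) * CJ / b * (b * |x 2|) := by field_simp
      _ ≤ _ := mul_le_mul_of_nonneg_left h1 (div_nonneg hA0 hb.le)
  have hu2 : ∀ x, x ≠ 0 → newton (q * u) x - newton (q * u) (refl3 x) = 2 * u x := by
    intro x hx
    have hx' : refl3 x ≠ 0 := by simpa using hx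
    have h1 := hP.dU3_eq_newton hx
    have h2 := hP.dU3_eq_newton hx'
    rw [← h1, ← h2, dU3_refl3]
    ring
  have hmain : ∃ c, ∀ᵐ x ∂μ, a x = c := by
    refine exists_ae_eq_const (P := fun x y => halfKernel x y * (u x * u y)) ?_ ?_ ?_ ham haA ?_
    · have hmeas : AEStronglyMeasurable
          (fun z : E3 × E3 => halfKernel z.1 z.2 * (u z.1 * u z.2)) (μ.prod μ) := by
        have := measurable_halfKernel
        exact Measurable.aestronglyMeasurable (by fun_prop)
      rw [integrable_prod_iff hmeas]
      have e : ∀ x y, halfKernel x y * (u x * u y) = u x * (halfKernel x y * u y) :=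
        fun x y => by ring
      refine ⟨.of_forall fun x => ?_, ?_⟩
      · simp only [e]
        exact (hker hsu x).1.const_mul _
      · refine Integrable.of_bound (C := b' * (4 * (C * b') * CJ))
          (hmeas.norm.integral_prod_right') ?_
        filter_upwards [hμB] with x hx
        have habs : IsSource (C * b') (q * fun y => |u y|) :=
          hP.isSource_mul hum.abs hb'.le fun y hy => by rw [abs_abs]; exact hub y hy
        rw [Real.norm_of_nonneg (integral_nonneg fun _ => norm_nonneg _)]
        have hcomp : ∀ x' : E3, Integrable (fun y => ‖x' - y‖⁻¹ * |u y|) μ ∧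
            ∫ y, ‖x' - y‖⁻¹ * |u y| ∂μ = newton (q * fun y => |u y|) x' := by
          intro x'
          have e2 : ∀ y, (q y).toNNReal • (‖x' - y‖⁻¹ * |u y|) =
              (q * fun y => |u y|) y / ‖x' - y‖ := by
            intro y
            rw [NNReal.smul_def, Real.coe_toNNReal _ (hP.linCoeff_nonneg y), Pi.mul_apply,
              smul_eq_mul]
            ring
          constructor
          · rw [hμ, integrable_withDensity_iff_integrable_smul hqn]
            simp only [e2]
            exact (habs.integrable_newton x').1
          · rw [hμ, integral_withDensity_eq_integral_smul hqn]
            simp only [e2]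
            rfl
        have hN : ∀ x', newton (q * fun y => |u y|) x' ≤ 2 * (C * b') * CJ := fun x' =>
          (le_abs_self _).trans (habs.integrable_newton x').2
        calc ∫ y, ‖halfKernel x y * (u x * u y)‖ ∂μ
            ≤ ∫ y, |u x| * (‖x - y‖⁻¹ * |u y| + ‖refl3 x - y‖⁻¹ * |u y|) ∂μ := by
              refine integral_mono_of_nonneg (.of_forall fun _ => norm_nonneg _)
                (((hcomp x).1.add (hcomp (refl3 x)).1).const_mul _) (.of_forall fun y => ?_)
              simp only [norm_mul, Real.norm_eq_abs]
              have : |halfKernel x y| ≤ ‖x - y‖⁻¹ + ‖refl3 x - y‖⁻¹ := by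
                rw [halfKernel]
                refine (abs_sub _ _).trans_eq ?_
                rw [abs_of_nonneg (by positivity), abs_of_nonneg (by positivity)]
              calc |halfKernel x y| * (|u x| * |u y|)
                  ≤ (‖x - y‖⁻¹ + ‖refl3 x - y‖⁻¹) * (|u x| * |u y|) :=
                    mul_le_mul_of_nonneg_right this (by positivity)
                _ = _ := by ring
          _ = |u x| * (newton (q * fun y => |u y|) x + newton (q * fun y => |u y|) (refl3 x)) := by
              rw [integral_const_mul, integral_add (hcomp x).1 (hcomp _).1, (hcomp x).2,
                (hcomp _).2]
          _ ≤ b' * (4 * (C * b') * CJ) := by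
              refine mul_le_mul (hub x hx) (by linarith [hN x, hN (refl3 x)]) ?_ hb'.le
              rw [← (hcomp x).2, ← (hcomp (refl3 x)).2]
              exact add_nonneg (integral_nonneg fun _ => by positivity)
                (integral_nonneg fun _ => by positivity)
    · intro x y
      rw [halfKernel_symm, mul_comm (u x)]
    · refine (Measure.AbsolutelyContinuous.prod hac hac).ae_le ?_
      have hm : MeasurableSet {z : E3 × E3 | 0 < halfKernel z.1 z.2 * (u z.1 * u z.2)} := by
        have := measurable_halfKernel
        exact measurableSet_lt measurable_const (by fun_prop)
      refine (Measure.ae_prod_iff_ae_ae hm).2 ?_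
      filter_upwards [ae_coord_ne] with x hx
      filter_upwards [ae_coord_ne, ae_sub_ne x, ae_sub_ne (refl3 x)] with y hy h1 h2
      have hx0 : 0 < ‖x‖ := norm_pos_iff.2 (by rintro rfl; simp at hx)
      have hy0 : 0 < ‖y‖ := norm_pos_iff.2 (by rintro rfl; simp at hy)
      have := halfKernel_pos h1 h2 hx hy
      have e : halfKernel x y * (u x * u y) = (deriv V ‖x‖ / ‖x‖) * (deriv V ‖y‖ / ‖y‖) *
          (halfKernel x y * (x 2 * y 2)) := by rw [hu, dU3, dU3]; ring
      rw [e]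
      exact mul_pos (mul_pos (div_pos (hP.deriv_V_pos _ hx0) hx0)
        (div_pos (hP.deriv_V_pos _ hy0) hy0)) this
    · filter_upwards [hac.ae_le hune] with x hx
      have hx0 : x ≠ 0 := by rintro rfl; simp [hu, dU3] at hx
      have e : ∀ᵐ y ∂μ, halfKernel x y * (u x * u y) * (a x - a y) =
          v x * (halfKernel x y * u y) - u x * (halfKernel x y * v y) := by
        filter_upwards [hac.ae_le hune] with y hy
        simp only [ha]
        field_simp
      rw [integral_congr_ae e, integral_sub ((hker hsu x).1.const_mul _)
        ((hker hsv x).1.const_mul _), integral_const_mul, integral_const_mul, (hker hsu x).2,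
        (hker hsv x).2, hu2 x hx0, heq, heq, hodd]
      ring
  obtain ⟨c, hc⟩ := hmain
  refine ⟨c, fun x hx => ?_⟩
  have h1 : newton (q * v) x = newton (c • (q * u)) x := by
    refine integral_congr_ae ?_
    rw [hμ, ae_withDensity_iff (by fun_prop)] at hc
    filter_upwards [hc, hune] with y hy hy2
    congr 1
    rw [Pi.smul_apply, Pi.mul_apply, Pi.mul_apply, smul_eq_mul]
    by_cases hqy : q y = 0
    · simp [hqy]
    · have hpos : 0 < q y := lt_of_le_of_ne (hP.linCoeff_nonneg y) (Ne.symm hqy)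
      have := hy (by simpa using hpos)
      rw [← this, ha]
      field_simp
  rw [← heq x, h1, newton_smul, ← hP.dU3_eq_newton hx]

/-! ### Uniqueness for the linearized equation -/

/-- A plane rotation carries a point to the second axis. -/
theorem exists_angle (a b : ℝ) : ∃ θ : ℝ, Real.cos θ * a - Real.sin θ * b = 0 ∧
    Real.sin θ * a + Real.cos θ * b = √(a ^ 2 + b ^ 2) := by
  have h1 := Complex.norm_mul_cos_arg (⟨b, a⟩ : ℂ)
  have h2 := Complex.norm_mul_sin_arg (⟨b, a⟩ : ℂ)
  have h3 : ‖(⟨b, a⟩ : ℂ)‖ = √(a ^ 2 + b ^ 2) := by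
    rw [Complex.norm_def, Complex.normSq_apply]; congr 1; simp; ring
  set θ := Complex.arg ⟨b, a⟩
  rw [h3] at h1 h2
  simp only at h1 h2
  refine ⟨θ, ?_, ?_⟩
  · linear_combination Real.sin θ * h1 - Real.cos θ * h2
  · have := Real.sin_sq_add_cos_sq θ
    calc Real.sin θ * a + Real.cos θ * b
        = Real.sin θ * (√(a ^ 2 + b ^ 2) * Real.sin θ) +
          Real.cos θ * (√(a ^ 2 + b ^ 2) * Real.cos θ) := by rw [h1, h2]
      _ = √(a ^ 2 + b ^ 2) * (Real.sin θ ^ 2 + Real.cos θ ^ 2) := by ring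
      _ = _ := by rw [this, mul_one]

/-- Rotations about the first and the third axis carry every point to the third axis. -/
theorem radial_of_rot {w : E3 → ℝ} (h3 : ∀ θ x, w (rot3 θ x) = w x)
    (h1 : ∀ θ x, w (rot1 θ x) = w x) : Radial w := by
  have key : ∀ x, w x = w !₂[0, 0, ‖x‖] := by
    intro x
    obtain ⟨θ, e1, e2⟩ := exists_angle (x 0) (x 1)
    have hx1 : rot3 θ x = !₂[0, √(x 0 ^ 2 + x 1 ^ 2), x 2] := by
      rw [rot3_apply, axisRotation, e1, e2]
    obtain ⟨η, e3, e4⟩ := exists_angle (√(x 0 ^ 2 + x 1 ^ 2)) (x 2)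
    have hx2 : rot1 η (rot3 θ x) = !₂[0, 0, ‖x‖] := by
      rw [rot1_apply, hx1, norm_eq_three]
      simp only [Matrix.cons_val]
      rw [e3, e4, Real.sq_sqrt (by positivity)]
    rw [← hx2, h1, h3]
  intro x y hxy
  rw [key x, key y, hxy]

/-- The exponential weight gains a factor `1 / l` from the integration over a ball; the factor
`1 / |y|` of the integrand is compensated by the volume element. -/
theorem integral_ball_exp_le {l : ℝ} (hl : 0 < l) {r : ℝ} (hr : 0 ≤ r) :
    Integrable (fun y : E3 => (Metric.ball (0 : E3) r).indicator
      ((B 1).indicator fun y => Real.exp (l * ‖y‖) / ‖y‖) y) ∧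
    ∫ y : E3, (Metric.ball (0 : E3) r).indicator
      ((B 1).indicator fun y => Real.exp (l * ‖y‖) / ‖y‖) y ≤
      3 * volume.real (Metric.ball (0 : E3) 1) * (Real.exp (l * r) / l) := by
  have hint : Integrable (fun y : E3 => (Metric.ball (0 : E3) r).indicator
      ((B 1).indicator fun y => Real.exp (l * ‖y‖) / ‖y‖) y) := by
    have hS : IsSource (Real.exp l) (fun y : E3 => (Metric.ball (0 : E3) r).indicator
      ((B 1).indicator fun y => Real.exp (l * ‖y‖)) y) := by
      refine ⟨?_, fun y => ?_, fun y hy => ?_⟩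
      · refine Measurable.aestronglyMeasurable (Measurable.indicator (Measurable.indicator ?_
          (measurableSet_B 1)) Metric.isOpen_ball.measurableSet)
        fun_prop
      · by_cases h1 : y ∈ Metric.ball (0 : E3) r
        · rw [indicator_of_mem h1]
          by_cases h2 : y ∈ B 1
          · rw [indicator_of_mem h2, abs_of_pos (Real.exp_pos _)]
            rw [mem_B] at h2
            exact Real.exp_le_exp.2 (by nlinarith)
          · rw [indicator_of_notMem h2, abs_zero]; positivity
        · rw [indicator_of_notMem h1, abs_zero]; positivity
      · have : y ∉ B 1 := by rw [mem_B] at hy ⊢; linarith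
        by_cases h1 : y ∈ Metric.ball (0 : E3) r
        · rw [indicator_of_mem h1, indicator_of_notMem this]
        · rw [indicator_of_notMem h1]
    refine (hS.integrable_newton 0).1.congr (.of_forall fun y => ?_)
    classical
    simp only [indicator_apply, zero_sub, norm_neg]
    split_ifs <;> simp
  refine ⟨hint, ?_⟩
  set f : ℝ → ℝ := (Iio r).indicator ((Iic 1).indicator fun s => Real.exp (l * s) / s) with hf
  have e : ∀ y : E3, (Metric.ball (0 : E3) r).indicator
      ((B 1).indicator fun y => Real.exp (l * ‖y‖) / ‖y‖) y = f ‖y‖ := by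
    intro y
    classical
    simp only [hf, indicator_apply, mem_B, mem_ball_zero_iff, mem_Iio, mem_Iic]
  simp only [e]
  rw [integral_fun_norm_addHaar]
  have hd : Module.finrank ℝ E3 = 3 := by simp
  rw [hd, nsmul_eq_mul, smul_eq_mul, ← mul_assoc]
  refine mul_le_mul_of_nonneg_left ?_ (by positivity)
  have hpt : ∀ s ∈ Ioi (0 : ℝ), s ^ (3 - 1) • f s ≤ (Ioc 0 r).indicator
      (fun s => Real.exp (l * s)) s := by
    intro s hs
    have hs0 : (0 : ℝ) < s := hs
    simp only [hf, indicator_apply, mem_Iio, mem_Iic, mem_Ioc, smul_eq_mul]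
    by_cases h1 : s < r
    · simp only [h1, hs0, h1.le, if_true, and_self]
      by_cases h2 : s ≤ 1
      · simp only [h2, if_true]
        have : s ^ (3 - 1) * (Real.exp (l * s) / s) = s * Real.exp (l * s) := by
          norm_num; field_simp
        rw [this]
        exact mul_le_of_le_one_left (Real.exp_pos _).le h2
      · simp only [h2, if_false, mul_zero]; positivity
    · simp only [h1, if_false, mul_zero]
      split_ifs <;> positivity
  have hI : IntegrableOn (fun s => Real.exp (l * s)) (Ioc 0 r) :=
    (Continuous.integrableOn_Icc (by fun_prop)).mono_set Ioc_subset_Icc_self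
  calc ∫ s in Ioi (0 : ℝ), s ^ (3 - 1) • f s
      ≤ ∫ s in Ioi (0 : ℝ), (Ioc 0 r).indicator (fun s => Real.exp (l * s)) s := by
        refine integral_mono_of_nonneg ?_ ?_ ?_
        · refine (ae_restrict_iff' measurableSet_Ioi).2 (.of_forall fun s hs => ?_)
          have hs0 : (0 : ℝ) < s := hs
          refine smul_nonneg (by positivity) ?_
          simp only [hf, indicator_apply]
          split_ifs <;> positivity
        · exact (hI.integrable_indicator measurableSet_Ioc).integrableOn
        · exact (ae_restrict_iff' measurableSet_Ioi).2 (.of_forall hpt)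
    _ = ∫ s in (0)..r, Real.exp (l * s) := by
        rw [setIntegral_indicator measurableSet_Ioc, intervalIntegral.integral_of_le hr]
        congr 2
        ext s; simp only [mem_inter_iff, mem_Ioi, mem_Ioc]; tauto
    _ ≤ Real.exp (l * r) / l := by
        rw [intervalIntegral.integral_comp_mul_left (fun s => Real.exp s) hl.ne', integral_exp]
        rw [smul_eq_mul, mul_zero, Real.exp_zero, inv_mul_eq_div]
        exact div_le_div_of_nonneg_right (by linarith) hl.le

namespace RadialProfiles

variable {ρ₀ U₀ : E3 → ℝ} {R V : ℝ → ℝ} {C : ℝ}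

/-- For radial `w` only the mass inside the ball of radius `|x|` enters, by Newton's theorem: the
equation is of Volterra type, and iteration in an exponentially weighted norm gives `w = 0`. -/
theorem eq_zero_of_radial (hP : RadialProfiles ρ₀ U₀ R V C) {w : E3 → ℝ} {M : ℝ}
    (hw : Measurable w) (hr : Radial w) (hM : ∀ x, |w x| ≤ M)
    (heq : ∀ x, w x = newton (linCoeff R V * w) x - newton (linCoeff R V * w) 0) : w = 0 := by
  have hM0 : 0 ≤ M := (abs_nonneg _).trans (hM 0)
  set q := linCoeff R V with hq
  have hS : IsSource (C * M) (q * w) := hP.isSource_mul hw hM0 fun x _ => hM x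
  have hmeas : Measurable (q * w) := hP.measurable_linCoeff.mul hw
  have hrad : Radial (q * w) := fun x y hxy => by
    rw [Pi.mul_apply, Pi.mul_apply, hr x y hxy, hq, linCoeff_radial R V x y hxy]
  set κ := 3 * volume.real (Metric.ball (0 : E3) 1) with hκ
  have hκ0 : 0 ≤ κ := by positivity
  set l := 2 * (C * κ) + 1 with hl
  have hl0 : 0 < l := by have := mul_nonneg hP.C_nonneg hκ0; linarith
  have step : ∀ A, 0 ≤ A → (∀ y, |w y| ≤ A * Real.exp (l * ‖y‖)) →
      ∀ x, |w x| ≤ A / 2 * Real.exp (l * ‖x‖) := by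
    intro A hA0 hA x
    obtain ⟨hint, hle⟩ := integral_ball_exp_le hl0 (norm_nonneg x)
    have i1 : Integrable fun y => (q * w) y / max ‖x‖ ‖y‖ := by
      refine (hS.integrable_newton 0).1.mono
        (hmeas.div (by fun_prop)).aestronglyMeasurable ?_
      filter_upwards [ae_sub_ne 0] with y hy
      rw [zero_sub, norm_div, norm_div, norm_neg]
      have hy0 : 0 < ‖y‖ := by simpa using hy
      refine div_le_div_of_nonneg_left (norm_nonneg _) (by simpa using hy) ?_
      rw [norm_norm, Real.norm_of_nonneg (le_max_of_le_left (norm_nonneg _))]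
      exact le_max_right _ _
    have i2 : Integrable fun y => (q * w) y / ‖y‖ := by
      simpa using (hS.integrable_newton 0).1
    have e1 : w x = ∫ y, ((q * w) y / max ‖x‖ ‖y‖ - (q * w) y / ‖y‖) := by
      rw [integral_sub i1 i2, ← newton_radial hS hmeas hrad, heq x]
      congr 1
      simp [newton]
    calc |w x| ≤ ∫ y, C * A * (Metric.ball (0 : E3) ‖x‖).indicator
          ((B 1).indicator fun y => Real.exp (l * ‖y‖) / ‖y‖) y := by
          rw [e1, ← Real.norm_eq_abs]
          refine norm_integral_le_of_norm_le (hint.const_mul _) (.of_forall fun y => ?_)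
          rw [Real.norm_eq_abs]
          by_cases h1 : y ∈ Metric.ball (0 : E3) ‖x‖
          · rw [indicator_of_mem h1]
            rw [mem_ball_zero_iff] at h1
            by_cases h2 : y ∈ B 1
            · rw [indicator_of_mem h2, max_eq_left h1.le]
              rcases eq_or_ne y 0 with rfl | hy
              · simp only [hq, Pi.mul_apply, linCoeff, norm_zero, hP.deriv_V_zero, div_zero,
                  zero_mul, zero_div, sub_zero, abs_zero, mul_zero, le_refl]
              have hy0 := norm_pos_iff.2 hy
              have hx0 : 0 < ‖x‖ := hy0.trans h1
              have h3 : |(q * w) y| ≤ C * (A * Real.exp (l * ‖y‖)) := by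
                rw [Pi.mul_apply, abs_mul, abs_of_nonneg (hP.linCoeff_nonneg y)]
                exact mul_le_mul (hP.linCoeff_le y) (hA y) (abs_nonneg _) hP.C_nonneg
              have h4 : |(q * w) y / ‖x‖ - (q * w) y / ‖y‖| ≤ |(q * w) y| * ‖y‖⁻¹ := by
                rw [div_eq_mul_inv, div_eq_mul_inv, ← mul_sub, abs_mul]
                refine mul_le_mul_of_nonneg_left ?_ (abs_nonneg _)
                rw [abs_sub_comm, abs_of_nonneg]
                · have : 0 < ‖x‖⁻¹ := by positivity
                  linarith
                · exact sub_nonneg.2 (inv_anti₀ hy0 h1.le)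
              refine h4.trans ((mul_le_mul_of_nonneg_right h3 (by positivity)).trans_eq ?_)
              field_simp
            · rw [indicator_of_notMem h2]
              rw [mem_B, not_le] at h2
              simp [hq, hP.linCoeff_zero h2]
          · rw [indicator_of_notMem h1]
            rw [mem_ball_zero_iff, not_lt] at h1
            rw [max_eq_right h1, sub_self, abs_zero, mul_zero]
      _ ≤ C * A * (κ * (Real.exp (l * ‖x‖) / l)) := by
          rw [integral_const_mul]
          exact mul_le_mul_of_nonneg_left hle (mul_nonneg hP.C_nonneg hA0)
      _ = (C * κ / l) * (A * Real.exp (l * ‖x‖)) := by ring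
      _ ≤ (1 / 2) * (A * Real.exp (l * ‖x‖)) := by
          refine mul_le_mul_of_nonneg_right ?_ (by positivity)
          rw [div_le_iff₀ hl0]; linarith
      _ = A / 2 * Real.exp (l * ‖x‖) := by ring
  have hall : ∀ n : ℕ, ∀ x, |w x| ≤ M * (1 / 2) ^ n * Real.exp (l * ‖x‖) := by
    intro n
    induction n with
    | zero =>
      intro x
      have : 1 ≤ Real.exp (l * ‖x‖) := Real.one_le_exp (by positivity)
      rw [pow_zero, mul_one]
      exact (hM x).trans (le_mul_of_one_le_right hM0 this)
    | succ n ih =>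
      intro x
      refine (step _ (by positivity) ih x).trans_eq ?_
      ring
  funext x
  have hlim : Tendsto (fun n : ℕ => M * (1 / 2 : ℝ) ^ n * Real.exp (l * ‖x‖)) atTop (𝓝 0) := by
    have := ((tendsto_pow_atTop_nhds_zero_of_lt_one (r := (1 / 2 : ℝ)) (by norm_num)
      (by norm_num)).const_mul M).mul_const (Real.exp (l * ‖x‖))
    simpa using this
  have := ge_of_tendsto' hlim (fun n => hall n x)
  exact abs_nonpos_iff.1 this

/-- The linearized equation has no nontrivial solution with the symmetries of the problem. The
difference of two opposite rotations of `w` about the first axis is odd in `x₃`, solves the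
equation without the constant `newton (q * w) 0`, and is therefore a multiple of `∂₃U₀`; it vanishes
on the third axis, so that it is zero and `w` is radial. -/
theorem eq_zero_of_linearized (hP : RadialProfiles ρ₀ U₀ R V C) {w : E3 → ℝ} {M : ℝ}
    (hw : Measurable w) (hS : SInv w) (hM : ∀ x, |w x| ≤ M)
    (heq : ∀ x, w x = newton (linCoeff R V * w) x - newton (linCoeff R V * w) 0) : w = 0 := by
  have hM0 : 0 ≤ M := (abs_nonneg _).trans (hM 0)
  set q := linCoeff R V with hq
  have h3 : ∀ θ x, w (rot3 θ x) = w x := fun θ x => hS _ (Or.inl ⟨θ, rfl⟩) x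
  have hrefl : ∀ x, w (refl3 x) = w x := fun x => hS _ (Or.inr rfl) x
  have hcomp : ∀ (e : E3 ≃ₗᵢ[ℝ] E3) x,
      newton (q * (w ∘ e)) x = w (e x) + newton (q * w) 0 := by
    intro e x
    have : q * (w ∘ e) = (q * w) ∘ e := by
      funext y
      simp only [Pi.mul_apply, Function.comp_apply, hq, linCoeff_iso]
    rw [this, newton_comp_iso, heq (e x)]
    ring
  have hsrc : ∀ e : E3 ≃ₗᵢ[ℝ] E3, IsSource (C * M) (q * (w ∘ e)) := fun e =>
    hP.isSource_mul (hw.comp e.continuous.measurable) hM0 fun x _ => hM _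
  have hanti : ∀ θ x, w (rot1 θ x) = w (rot1 (-θ) x) := by
    intro θ
    set v : E3 → ℝ := fun x => w (rot1 θ x) - w (rot1 (-θ) x) with hv
    have hvm : Measurable v := (hw.comp (rot1 θ).continuous.measurable).sub
      (hw.comp (rot1 (-θ)).continuous.measurable)
    obtain ⟨c, hc⟩ : ∃ c, ∀ x, x ≠ 0 → v x = c * dU3 V x := by
      refine hP.exists_eq_mul_dU3 (v := v) (M := M + M) hvm
        (fun x => (abs_sub _ _).trans (add_le_add (hM _) (hM _))) ?_ ?_
      · intro x
        have hcomm : ∀ η, rot1 η (refl3 x) = refl3 (rot1 (-η) x) := by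
          intro η
          rw [refl3_apply, refl3_apply, planeReflection, planeReflection, rot1_apply, rot1_apply]
          ext i; fin_cases i <;> simp; ring
        simp only [hv]
        rw [hcomm, hcomm, hrefl, hrefl, neg_neg]
        ring
      · intro x
        have h1 : q * v = q * (w ∘ rot1 θ) + (-1 : ℝ) • (q * (w ∘ rot1 (-θ))) := by
          funext y
          simp only [hv, Pi.mul_apply, Pi.add_apply, Pi.smul_apply, Function.comp_apply,
            smul_eq_mul]
          ring
        rw [← hq, h1, newton_add (hsrc _) ((hsrc _).const_smul (-1)), newton_smul, hcomp, hcomp]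
        simp only [hv]
        ring
    -- on the third axis the two rotations differ by a rotation about that axis
    have hc0 : c = 0 := by
      have h1 := hc !₂[0, 0, 1] (by
        intro h
        have := congrArg (fun z : E3 => z 2) h
        simp at this)
      have h2 : v !₂[0, 0, 1] = 0 := by
        have : rot1 (-θ) !₂[0, 0, 1] = rot3 Real.pi (rot1 θ !₂[0, 0, 1]) := by
          rw [rot3_apply, axisRotation, rot1_apply, rot1_apply]
          ext i; fin_cases i <;> simp
        simp only [hv]
        rw [this, h3, sub_self]
      have h4 : ‖(!₂[0, 0, 1] : E3)‖ = 1 := by rw [norm_eq_three]; simp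
      rw [h2, dU3, h4] at h1
      simp only [Matrix.cons_val, div_one, mul_one] at h1
      exact (mul_eq_zero.1 h1.symm).resolve_right (hP.deriv_V_pos 1 one_pos).ne'
    intro x
    rcases eq_or_ne x 0 with rfl | hx
    · simp
    · have := hc x hx
      rw [hc0, zero_mul] at this
      exact sub_eq_zero.1 this
  have h1 : ∀ θ x, w (rot1 θ x) = w x := by
    intro θ x
    have h := hanti (θ / 2) (rot1 (θ / 2) x)
    have e1 : rot1 (θ / 2) (rot1 (θ / 2) x) = rot1 θ x := by
      have hc : Real.cos θ = Real.cos (θ / 2) * Real.cos (θ / 2) -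
          Real.sin (θ / 2) * Real.sin (θ / 2) := by rw [← Real.cos_add, add_halves]
      have hs : Real.sin θ = Real.sin (θ / 2) * Real.cos (θ / 2) +
          Real.cos (θ / 2) * Real.sin (θ / 2) := by rw [← Real.sin_add, add_halves]
      rw [rot1_apply, rot1_apply, rot1_apply, hc, hs]
      ext i; fin_cases i <;> simp <;> ring
    have e2 : rot1 (-(θ / 2)) (rot1 (θ / 2) x) = x := by
      have := Real.sin_sq_add_cos_sq (θ / 2)
      rw [rot1_apply, rot1_apply]
      ext i; fin_cases i <;> simp
      · linear_combination (x 1) * this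
      · linear_combination (x 2) * this
    rwa [e1, e2] at h
  exact hP.eq_zero_of_radial hw (radial_of_rot h3 h1) hM heq

end RadialProfiles

/-! ### The Fredholm alternative for the linearized equation -/

theorem isCompactOperator_of_closure {E F : Type*} [NormedAddCommGroup E] [NormedSpace ℝ E]
    [NormedAddCommGroup F] [NormedSpace ℝ F] (T : E →L[ℝ] F)
    (hT : IsCompact (closure (T '' Metric.closedBall 0 1))) : IsCompactOperator T :=
  (isCompactOperator_iff_isCompact_closure_image_closedBall T.toLinearMap one_pos).2 hT

/-- An injective compact perturbation of the identity is boundedly invertible: a nonzero spectral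
value of a compact operator is an eigenvalue. -/
theorem exists_solution_of_isCompactOperator {E : Type*} [NormedAddCommGroup E] [NormedSpace ℝ E]
    [CompleteSpace E] (T : E →L[ℝ] E) (hT : IsCompactOperator T) (hinj : ∀ f, T f = f → f = 0) :
    ∃ Λ : ℝ, 0 ≤ Λ ∧ ∀ f, ∃ w, w = f + T w ∧ ‖w‖ ≤ Λ * ‖f‖ := by
  have hres : (1 : ℝ) ∈ resolventSet ℝ T := by
    refine (hT.hasEigenvalue_or_mem_resolventSet one_ne_zero).resolve_left fun hev => ?_
    obtain ⟨f, hf⟩ := hev.exists_hasEigenvector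
    exact hf.2 (hinj f (by simpa using hf.apply_eq_smul))
  obtain ⟨u, hu⟩ := hres
  set G : E →L[ℝ] E := (u⁻¹ : (E →L[ℝ] E)ˣ).val with hG
  refine ⟨‖G‖, norm_nonneg _, fun f => ⟨G f, ?_, G.le_opNorm f⟩⟩
  have h1 : (u : E →L[ℝ] E) * G = 1 := u.mul_inv
  rw [hu, _root_.map_one] at h1
  have h2 := congrArg (fun T : E →L[ℝ] E => T f) h1
  have h3 : G f - T (G f) = f := h2
  rw [← sub_eq_iff_eq_add, h3]

/-- The compact part of the linearized operator: the potential of the density `q w`, normalized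
to vanish at the origin. -/
def linPot (R V : ℝ → ℝ) (w : E3 → ℝ) (x : E3) : ℝ :=
  newton (linCoeff R V * w) x - newton (linCoeff R V * w) 0

instance : CompactSpace (B 3) := isCompact_iff_compactSpace.1 (isCompact_closedBall 0 3)

/-- The continuous functions on `B_3` that are invariant under `S`, as a closed subspace of the
Banach space `C(B_3)`. -/
def symmSub : Submodule ℝ (C(B 3, ℝ)) where
  carrier := {f | ∀ A ∈ S, ∀ x y : B 3, A x = y → f y = f x}
  zero_mem' := fun _ _ _ _ _ => rfl
  add_mem' := fun {f g} hf hg A hA x y h => by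
    simp only [ContinuousMap.add_apply, hf A hA x y h, hg A hA x y h]
  smul_mem' := fun c f hf A hA x y h => by
    simp only [ContinuousMap.smul_apply, hf A hA x y h]

theorem isClosed_symmSub : IsClosed (symmSub : Set (C(B 3, ℝ))) := by
  have : (symmSub : Set (C(B 3, ℝ))) =
      ⋂ A ∈ S, ⋂ x : B 3, ⋂ y : B 3, ⋂ _ : A x = y, {f | f y = f x} := by
    ext f
    simp only [mem_iInter]
    rfl
  rw [this]
  refine isClosed_biInter fun A _ => isClosed_iInter fun x => isClosed_iInter fun y =>
    isClosed_iInter fun _ => isClosed_eq ?_ ?_ <;>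
  exact continuous_eval_const _

instance : CompleteSpace symmSub := isClosed_symmSub.completeSpace_coe

/-- Extension by zero of a function on `B_3`. -/
def extB (f : B 3 → ℝ) : E3 → ℝ := Function.extend Subtype.val f 0

theorem extB_of_mem (f : B 3 → ℝ) {x : E3} (hx : x ∈ B 3) : extB f x = f ⟨x, hx⟩ :=
  Subtype.val_injective.extend_apply f 0 ⟨x, hx⟩

theorem extB_of_notMem (f : B 3 → ℝ) {x : E3} (hx : x ∉ B 3) : extB f x = 0 :=
  Function.extend_apply' (f := (Subtype.val : B 3 → E3)) f 0 x
    (by rintro ⟨y, rfl⟩; exact hx y.2)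

theorem measurable_extB {f : B 3 → ℝ} (hf : Continuous f) : Measurable (extB f) :=
  (MeasurableEmbedding.subtype_coe (measurableSet_B 3)).measurable_extend hf.measurable
    measurable_const

theorem abs_extB_le (f : C(B 3, ℝ)) (x : E3) : |extB f x| ≤ ‖f‖ := by
  by_cases hx : x ∈ B 3
  · rw [extB_of_mem _ hx]; exact f.norm_coe_le_norm ⟨x, hx⟩
  · rw [extB_of_notMem _ hx, abs_zero]; exact norm_nonneg _

theorem isCS_extB (f : symmSub) : IsCS 3 (extB f.1) where
  zero_outside _ hx := extB_of_notMem _ hx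
  continuousOn := by
    rw [continuousOn_iff_continuous_domRestrict]
    refine f.1.continuous.congr fun x => ?_
    rw [domRestrict_apply, extB_of_mem _ x.2]
  symm A hA x hx := by
    have hAx : A x ∈ B 3 := by
      obtain ⟨e, he⟩ := exists_iso_of_mem_S hA
      rwa [mem_B, ← he, e.norm_map, ← mem_B]
    rw [extB_of_mem _ hx, extB_of_mem _ hAx]
    exact f.2 A hA ⟨x, hx⟩ ⟨A x, hAx⟩ rfl

theorem IsCS.measurable {f : E3 → ℝ} (hf : IsCS 3 f) : Measurable f := by
  have h := measurable_extB (continuousOn_iff_continuous_domRestrict.1 hf.continuousOn)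
  convert h using 1
  funext x
  by_cases hx : x ∈ B 3
  · rw [extB_of_mem _ hx, domRestrict_apply]
  · rw [extB_of_notMem _ hx, hf.zero_outside x hx]

/-- An element of `C_S(B_3)` as a bounded continuous function on `B_3`. -/
def IsCS.toSymm {f : E3 → ℝ} (hf : IsCS 3 f) : symmSub :=
  ⟨⟨(B 3).domRestrict f, continuousOn_iff_continuous_domRestrict.1 hf.continuousOn⟩,
    fun A hA x y h => by
      change f y = f x
      rw [← h, hf.symm A hA x x.2]⟩

theorem IsCS.toSymm_apply {f : E3 → ℝ} (hf : IsCS 3 f) (x : B 3) : hf.toSymm.1 x = f x := rfl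

theorem IsCS.indicator {f : E3 → ℝ} (hc : Continuous f) (hS : SInv f) :
    IsCS 3 ((B 3).indicator f) where
  zero_outside _ hx := indicator_of_notMem hx _
  continuousOn := hc.continuousOn.congr fun _ hx => indicator_of_mem hx _
  symm A hA x hx := by
    have hAx : A x ∈ B 3 := by
      obtain ⟨e, he⟩ := exists_iso_of_mem_S hA
      rwa [mem_B, ← he, e.norm_map, ← mem_B]
    rw [indicator_of_mem hx, indicator_of_mem hAx, hS A hA]

namespace RadialProfiles

variable {ρ₀ U₀ : E3 → ℝ} {R V : ℝ → ℝ} {C : ℝ}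

theorem linPot_lipschitz (hP : RadialProfiles ρ₀ U₀ R V C) {w : E3 → ℝ} {M : ℝ}
    (hw : Measurable w) (hM0 : 0 ≤ M) (hM : ∀ x ∈ B 1, |w x| ≤ M) (x x' : E3) :
    |linPot R V w x' - linPot R V w x| ≤ 2 * (C * M) * CJ * ‖x' - x‖ := by
  rw [linPot, linPot, sub_sub_sub_cancel_right]
  exact (hP.isSource_mul hw hM0 hM).newton_lipschitz x x'

theorem abs_linPot_le (hP : RadialProfiles ρ₀ U₀ R V C) {w : E3 → ℝ} {M : ℝ}
    (hw : Measurable w) (hM0 : 0 ≤ M) (hM : ∀ x ∈ B 1, |w x| ≤ M) (x : E3) :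
    |linPot R V w x| ≤ 2 * (C * M) * CJ * ‖x‖ := by
  have := hP.linPot_lipschitz hw hM0 hM 0 x
  rwa [sub_zero, show linPot R V w 0 = 0 from sub_self _, sub_zero] at this

theorem continuous_linPot (hP : RadialProfiles ρ₀ U₀ R V C) {w : E3 → ℝ} {M : ℝ}
    (hw : Measurable w) (hM0 : 0 ≤ M) (hM : ∀ x ∈ B 1, |w x| ≤ M) :
    Continuous (linPot R V w) :=
  (hP.isSource_mul hw hM0 hM).continuous_newton.sub continuous_const

theorem sInv_linPot {w : E3 → ℝ} (hw : SInv w) : SInv (linPot R V w) := by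
  intro A hA x
  rw [linPot, linPot, ((linCoeff_radial R V).sInv.mul hw).newton A hA]

theorem linPot_add (hP : RadialProfiles ρ₀ U₀ R V C) {w w' : E3 → ℝ} {M M' : ℝ}
    (hw : Measurable w) (hM0 : 0 ≤ M) (hM : ∀ x ∈ B 1, |w x| ≤ M)
    (hw' : Measurable w') (hM0' : 0 ≤ M') (hM' : ∀ x ∈ B 1, |w' x| ≤ M') (x : E3) :
    linPot R V (w + w') x = linPot R V w x + linPot R V w' x := by
  have h1 := hP.isSource_mul hw hM0 hM
  have h2 := hP.isSource_mul hw' hM0' hM'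
  rw [linPot, linPot, linPot, mul_add, newton_add h1 h2, newton_add h1 h2]
  ring

theorem linPot_smul (c : ℝ) (w : E3 → ℝ) (x : E3) :
    linPot R V (c • w) x = c * linPot R V w x := by
  rw [linPot, linPot, mul_smul_comm, newton_smul, newton_smul]
  ring

/-- Only the values on `B_1` matter, since the coefficient vanishes outside. -/
theorem linPot_congr (hP : RadialProfiles ρ₀ U₀ R V C) {w w' : E3 → ℝ}
    (h : ∀ x ∈ B 1, w x = w' x) : linPot R V w = linPot R V w' := by
  have : linCoeff R V * w = linCoeff R V * w' := by
    funext y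
    rw [Pi.mul_apply, Pi.mul_apply]
    by_cases hy : y ∈ B 1
    · rw [h y hy]
    · rw [mem_B, not_le] at hy
      rw [hP.linCoeff_zero hy, zero_mul, zero_mul]
  funext x
  rw [linPot, linPot, this]

/-- `linPot` as a bounded operator on the space of continuous symmetric functions. -/
def linPotCLM (hP : RadialProfiles ρ₀ U₀ R V C) : symmSub →L[ℝ] symmSub :=
  LinearMap.mkContinuous
    { toFun := fun f => IsCS.toSymm (IsCS.indicator
        (f := linPot R V (extB f.1))
        (hP.continuous_linPot (measurable_extB f.1.continuous) (norm_nonneg f.1)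
          fun x _ => abs_extB_le f.1 x) (sInv_linPot (isCS_extB f).sInv))
      map_add' := fun f g => by
        ext x
        change (B 3).indicator (linPot R V (extB (f + g).1)) (x : E3) =
          (B 3).indicator (linPot R V (extB f.1)) (x : E3) +
            (B 3).indicator (linPot R V (extB g.1)) (x : E3)
        rw [indicator_of_mem x.2, indicator_of_mem x.2, indicator_of_mem x.2,
          ← hP.linPot_add (w := extB f.1) (w' := extB g.1) (measurable_extB f.1.continuous)
          (norm_nonneg f.1)
          (fun x _ => abs_extB_le f.1 x) (measurable_extB g.1.continuous) (norm_nonneg g.1)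
          (fun x _ => abs_extB_le g.1 x)]
        refine congrFun (hP.linPot_congr fun y hy => ?_) _
        have hy3 : y ∈ B 3 := by rw [mem_B] at hy ⊢; linarith
        rw [Pi.add_apply, extB_of_mem _ hy3, extB_of_mem _ hy3, extB_of_mem _ hy3]
        rfl
      map_smul' := fun c f => by
        ext x
        change (B 3).indicator (linPot R V (extB (c • f).1)) (x : E3) =
          c * (B 3).indicator (linPot R V (extB f.1)) (x : E3)
        rw [indicator_of_mem x.2, indicator_of_mem x.2, ← linPot_smul]
        refine congrFun (hP.linPot_congr fun y hy => ?_) _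
        have hy3 : y ∈ B 3 := by rw [mem_B] at hy ⊢; linarith
        rw [Pi.smul_apply, extB_of_mem _ hy3, extB_of_mem _ hy3]
        rfl }
    (2 * C * CJ * 3) fun f => by
      have h0 : 0 ≤ 2 * C * CJ * 3 * ‖f‖ := by
        have := hP.C_nonneg; have := CJ_nonneg; positivity
      refine (ContinuousMap.norm_le _ h0).2 fun x => ?_
      change ‖(B 3).indicator _ (x : E3)‖ ≤ _
      rw [indicator_of_mem x.2]
      have h1 := hP.abs_linPot_le (measurable_extB f.1.continuous) (norm_nonneg f.1)
        (fun x _ => abs_extB_le f.1 x) x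
      have h2 : ‖(x : E3)‖ ≤ 3 := mem_B.1 x.2
      refine h1.trans ((mul_le_mul_of_nonneg_left h2 ?_).trans_eq ?_)
      · have := hP.C_nonneg; have := CJ_nonneg; positivity
      · change 2 * (C * ‖f.1‖) * CJ * 3 = 2 * C * CJ * 3 * ‖f.1‖
        ring

theorem linPotCLM_apply (hP : RadialProfiles ρ₀ U₀ R V C) (f : symmSub) (x : B 3) :
    (hP.linPotCLM f).1 x = linPot R V (extB f.1) x := indicator_of_mem x.2 _

/-- Arzelà–Ascoli: `linPot` maps bounded sets to sets that are bounded in the Lipschitz norm. -/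
theorem isCompactOperator_linPotCLM (hP : RadialProfiles ρ₀ U₀ R V C) :
    IsCompactOperator hP.linPotCLM := by
  have h1 : IsCompactOperator (symmSub.subtypeL ∘L hP.linPotCLM) := by
    refine isCompactOperator_of_closure (E := symmSub) (F := C(B 3, ℝ)) _ ?_
    have hlip : ∀ f : symmSub, ‖f‖ ≤ 1 → ∀ x x' : B 3,
        |(hP.linPotCLM f).1 x' - (hP.linPotCLM f).1 x| ≤ 2 * C * CJ * dist x' x := by
      intro f hf x x'
      rw [linPotCLM_apply, linPotCLM_apply]
      refine (hP.linPot_lipschitz (measurable_extB f.1.continuous) zero_le_one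
        (fun x _ => (abs_extB_le f.1 x).trans hf) _ _).trans_eq ?_
      rw [mul_one, Subtype.dist_eq, dist_eq_norm]
    set e := ContinuousMap.isometryEquivBoundedOfCompact (B 3) ℝ
    rw [← e.toHomeomorph.isCompact_image, e.toHomeomorph.image_closure]
    refine BoundedContinuousFunction.arzela_ascoli
      (Icc (-(2 * C * CJ * 3)) (2 * C * CJ * 3)) isCompact_Icc _ ?_ ?_
    · rintro _ x ⟨_, ⟨f, hf, rfl⟩, rfl⟩
      rw [mem_closedBall_zero_iff] at hf
      have h2 := hP.abs_linPot_le (measurable_extB f.1.continuous) zero_le_one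
        (fun x _ => (abs_extB_le f.1 x).trans hf) x
      have h3 : ‖(x : E3)‖ ≤ 3 := mem_B.1 x.2
      rw [mul_one] at h2
      have h4 : |(hP.linPotCLM f).1 x| ≤ 2 * C * CJ * 3 := by
        rw [linPotCLM_apply]
        refine h2.trans (mul_le_mul_of_nonneg_left h3 ?_)
        have := hP.C_nonneg; have := CJ_nonneg; positivity
      exact abs_le.1 h4
    · refine Metric.equicontinuous_of_continuity_modulus (fun t => 2 * C * CJ * t) ?_ _ ?_
      · have : Continuous fun t : ℝ => 2 * C * CJ * t := by fun_prop
        simpa using this.tendsto 0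
      · rintro x x' ⟨_, _, ⟨f, hf, rfl⟩, rfl⟩
        rw [mem_closedBall_zero_iff] at hf
        rw [dist_comm x x', dist_comm, Real.dist_eq]
        exact hlip f hf x x'
  exact h1.codRestrict (V := symmSub) (fun f => (hP.linPotCLM f).2) isClosed_symmSub

/-- The linearized equation `w = f + linPot w` is solvable in `C_S(B_3)`, with a bound in the
maximum norm. -/
theorem exists_solution (hP : RadialProfiles ρ₀ U₀ R V C) :
    ∃ Λ : ℝ, 0 ≤ Λ ∧ ∀ (f : E3 → ℝ) (F : ℝ), IsCS 3 f → (∀ x ∈ B 3, |f x| ≤ F) →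
      ∃ w, IsCS 3 w ∧ (∀ x ∈ B 3, w x = f x + linPot R V w x) ∧ ∀ x, |w x| ≤ Λ * F := by
  obtain ⟨Λ, hΛ, hsol⟩ := exists_solution_of_isCompactOperator (E := symmSub) hP.linPotCLM
    hP.isCompactOperator_linPotCLM (fun f hf1 => by
    have hmeas := measurable_extB f.1.continuous
    have hbd : ∀ x ∈ B 1, |extB f.1 x| ≤ ‖f.1‖ := fun x _ => abs_extB_le f.1 x
    have hcongr : linPot R V (linPot R V (extB f.1)) = linPot R V (extB f.1) := by
      refine hP.linPot_congr fun y hy => ?_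
      have hy3 : y ∈ B 3 := by rw [mem_B] at hy ⊢; linarith
      rw [extB_of_mem _ hy3]
      have := hP.linPotCLM_apply f ⟨y, hy3⟩
      rw [hf1] at this
      exact this.symm
    have hsrc := hP.isSource_mul hmeas (norm_nonneg f.1) hbd
    have h0 := hP.eq_zero_of_linearized (w := linPot R V (extB f.1))
      (M := 2 * (C * ‖f.1‖) * CJ + 2 * (C * ‖f.1‖) * CJ)
      (hP.continuous_linPot hmeas (norm_nonneg f.1) hbd).measurable
      (sInv_linPot (isCS_extB f).sInv)
      (fun x => (abs_sub _ _).trans (add_le_add (hsrc.integrable_newton x).2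
        (hsrc.integrable_newton 0).2))
      (fun x => (congrFun hcongr x).symm)
    rw [← hf1]
    ext x
    exact (hP.linPotCLM_apply f x).trans (congrFun h0 x))
  refine ⟨Λ, hΛ, fun f F hf hF => ?_⟩
  have hF0 : 0 ≤ F := (abs_nonneg _).trans (hF 0 (by rw [mem_B]; simp))
  obtain ⟨w, hw, hwb⟩ := hsol hf.toSymm
  refine ⟨extB w.1, isCS_extB _, fun x hx => ?_, fun x => ?_⟩
  · have h1 : w.1 ⟨x, hx⟩ = hf.toSymm.1 ⟨x, hx⟩ + (hP.linPotCLM w).1 ⟨x, hx⟩ :=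
      congrArg (fun g : symmSub => g.1 ⟨x, hx⟩) hw
    rw [linPotCLM_apply, hf.toSymm_apply] at h1
    rw [extB_of_mem _ hx]
    exact h1
  · refine (abs_extB_le _ _).trans (hwb.trans (mul_le_mul_of_nonneg_left ?_ hΛ))
    exact (ContinuousMap.norm_le _ hF0).2 fun y => hF y y.2

/-- Uniqueness for the linearized equation on `B_3`. The function `linPot w` extends `w` to a
solution on the whole space. -/
theorem eq_zero_of_isCS (hP : RadialProfiles ρ₀ U₀ R V C) {w : E3 → ℝ} (hw : IsCS 3 w)
    (heq : ∀ x ∈ B 3, w x = linPot R V w x) : w = 0 := by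
  obtain ⟨M, hM⟩ := (isCompact_closedBall (0 : E3) 3).exists_bound_of_continuousOn hw.continuousOn
  have hM0 : 0 ≤ M := (norm_nonneg _).trans (hM 0 (by simp))
  have hbd : ∀ x ∈ B 1, |w x| ≤ M := fun x hx => hM x (by
    rw [mem_B] at hx; rw [mem_closedBall_zero_iff]; linarith)
  have hsrc := hP.isSource_mul hw.measurable hM0 hbd
  have hcongr : linPot R V (linPot R V w) = linPot R V w := by
    refine hP.linPot_congr fun y hy => (heq y ?_).symm
    rw [mem_B] at hy ⊢; linarith
  have h0 := hP.eq_zero_of_linearized (w := linPot R V w)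
      (M := 2 * (C * M) * CJ + 2 * (C * M) * CJ)
      (hP.continuous_linPot hw.measurable hM0 hbd).measurable (sInv_linPot hw.sInv)
      (fun x => (abs_sub _ _).trans (add_le_add (hsrc.integrable_newton x).2
        (hsrc.integrable_newton 0).2))
      (fun x => (congrFun hcongr x).symm)
  funext x
  by_cases hx : x ∈ B 3
  · rw [heq x hx, h0]
  · rw [hw.zero_outside x hx]; rfl

end RadialProfiles

/-! ### Uniform limits along rays -/

theorem norm_of_mem_S1 {x : E3} (hx : x ∈ S1) : ‖x‖ = 1 := by simpa [S1] using hx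

/-- `f t x` has a limit as `t ↘ 0`, uniformly in `x ∈ S_1`, and the limit is bounded. Boundedness
makes the notion stable under products. -/
def HasRadialLimit {F : Type*} [NormedAddCommGroup F] (f : ℝ → E3 → F) : Prop :=
  ∃ G : E3 → F, (∃ C, ∀ x ∈ S1, ‖G x‖ ≤ C) ∧ TendstoUniformlyOn f G (𝓝[>] 0) S1

namespace HasRadialLimit

variable {F H : Type*} [NormedAddCommGroup F] [NormedAddCommGroup H]

theorem of_bounded {f : ℝ → E3 → F} {G : E3 → F} {C : ℝ}
    (hf : TendstoUniformlyOn f G (𝓝[>] 0) S1)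
    (hC : ∀ᶠ t in 𝓝[>] (0 : ℝ), ∀ x ∈ S1, ‖f t x‖ ≤ C) : HasRadialLimit f := by
  refine ⟨G, ⟨C, fun x hx => ?_⟩, hf⟩
  refine le_of_tendsto (hf.tendsto_at hx).norm ?_
  filter_upwards [hC] with t ht using ht x hx

theorem congr {f g : ℝ → E3 → F} (hf : HasRadialLimit f)
    (h : ∀ᶠ t in 𝓝[>] (0 : ℝ), ∀ x ∈ S1, f t x = g t x) : HasRadialLimit g := by
  obtain ⟨G, hG, hfG⟩ := hf
  exact ⟨G, hG, hfG.congr h⟩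

theorem of_tendsto {f : ℝ → F} {a : F} (h : Tendsto f (𝓝[>] 0) (𝓝 a)) :
    HasRadialLimit fun t _ => f t := by
  refine ⟨fun _ => a, ⟨‖a‖, fun _ _ => le_rfl⟩, ?_⟩
  rw [Metric.tendstoUniformlyOn_iff]
  intro ε hε
  filter_upwards [h (Metric.ball_mem_nhds a hε)] with t ht x _
  rw [dist_comm]; exact ht

theorem id : HasRadialLimit fun (_ : ℝ) (x : E3) => x := by
  refine ⟨fun x => x, ⟨1, fun x hx => (norm_of_mem_S1 hx).le⟩, ?_⟩
  rw [Metric.tendstoUniformlyOn_iff]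
  intro ε hε
  exact .of_forall fun t x _ => by simpa using hε

theorem prodMk {f : ℝ → E3 → F} {g : ℝ → E3 → H} (hf : HasRadialLimit f)
    (hg : HasRadialLimit g) : HasRadialLimit fun t x => (f t x, g t x) := by
  obtain ⟨G, ⟨C, hC⟩, hfG⟩ := hf
  obtain ⟨K, ⟨D, hD⟩, hgK⟩ := hg
  refine ⟨fun x => (G x, K x), ⟨max C D, fun x hx => ?_⟩, ?_⟩
  · exact max_le_max (hC x hx) (hD x hx)
  rw [Metric.tendstoUniformlyOn_iff] at hfG hgK ⊢
  intro ε hε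
  filter_upwards [hfG ε hε, hgK ε hε] with t h1 h2 x hx
  exact max_lt (h1 x hx) (h2 x hx)

theorem comp [ProperSpace F] {f : ℝ → E3 → F} (hf : HasRadialLimit f) {Φ : F → H}
    (hΦ : Continuous Φ) : HasRadialLimit fun t x => Φ (f t x) := by
  obtain ⟨G, ⟨C, hC⟩, hfG⟩ := hf
  have hcpt := isCompact_closedBall (0 : F) (C + 1)
  have hin : ∀ x ∈ S1, G x ∈ Metric.closedBall (0 : F) (C + 1) := fun x hx => by
    rw [mem_closedBall_zero_iff]; linarith [hC x hx]
  obtain ⟨D, hD⟩ := hcpt.exists_bound_of_continuousOn hΦ.continuousOn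
  refine ⟨fun x => Φ (G x), ⟨D, fun x hx => hD _ (hin x hx)⟩, ?_⟩
  have huc := hcpt.uniformContinuousOn_of_continuous hΦ.continuousOn
  rw [Metric.uniformContinuousOn_iff] at huc
  rw [Metric.tendstoUniformlyOn_iff] at hfG ⊢
  intro ε hε
  obtain ⟨δ, hδ, h⟩ := huc ε hε
  filter_upwards [hfG δ hδ, hfG 1 one_pos] with t h1 h2 x hx
  refine h _ (hin x hx) _ ?_ (h1 x hx)
  rw [mem_closedBall_zero_iff]
  have h3 := h2 x hx
  rw [dist_eq_norm] at h3
  have h4 := norm_sub_le (G x) (G x - f t x)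
  rw [sub_sub_cancel] at h4
  linarith [hC x hx]

/-- The radius may be replaced by any positive function that tends to zero uniformly. -/
theorem comp_radius {f : ℝ → E3 → F} (hf : HasRadialLimit f) {s : ℝ → E3 → ℝ}
    (hs : ∀ ε > 0, ∀ᶠ t in 𝓝[>] (0 : ℝ), ∀ x ∈ S1, 0 < s t x ∧ s t x < ε) :
    HasRadialLimit fun t x => f (s t x) x := by
  obtain ⟨G, hG, hfG⟩ := hf
  refine ⟨G, hG, ?_⟩
  rw [Metric.tendstoUniformlyOn_iff] at hfG ⊢
  intro ε hε
  obtain ⟨δ, hδ, h⟩ := mem_nhdsGT_iff_exists_Ioo_subset.1 (hfG ε hε)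
  filter_upwards [hs δ hδ] with t ht x hx
  exact h (ht x hx) x hx

theorem add [ProperSpace F] {f g : ℝ → E3 → F} (hf : HasRadialLimit f) (hg : HasRadialLimit g) :
    HasRadialLimit fun t x => f t x + g t x :=
  (hf.prodMk hg).comp (Φ := fun z : F × F => z.1 + z.2) (by fun_prop)

theorem sub [ProperSpace F] {f g : ℝ → E3 → F} (hf : HasRadialLimit f) (hg : HasRadialLimit g) :
    HasRadialLimit fun t x => f t x - g t x :=
  (hf.prodMk hg).comp (Φ := fun z : F × F => z.1 - z.2) (by fun_prop)

theorem smul [ProperSpace F] [NormedSpace ℝ F] {f : ℝ → E3 → ℝ} {g : ℝ → E3 → F}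
    (hf : HasRadialLimit f) (hg : HasRadialLimit g) :
    HasRadialLimit fun t x => f t x • g t x :=
  (hf.prodMk hg).comp (Φ := fun z : ℝ × F => z.1 • z.2) (by fun_prop)

theorem inner {f g : ℝ → E3 → E3} (hf : HasRadialLimit f) (hg : HasRadialLimit g) :
    HasRadialLimit fun t x => inner ℝ (f t x) (g t x) :=
  (hf.prodMk hg).comp (Φ := fun z : E3 × E3 => Inner.inner ℝ z.1 z.2) (by fun_prop)

end HasRadialLimit

/-! ### Functions on the ball and their gradients -/

theorem eventually_Ioo {ε : ℝ} (hε : 0 < ε) : ∀ᶠ t : ℝ in 𝓝[>] 0, t ∈ Ioo (0 : ℝ) ε :=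
  Ioo_mem_nhdsGT hε

theorem mem_Bdot {x : E3} : x ∈ Bdot 3 ↔ ‖x‖ ≤ 3 ∧ x ≠ 0 := by
  rw [Bdot, Set.mem_sdiff, mem_B, mem_singleton_iff]

theorem grad_eq {f : E3 → ℝ} {p x : E3} (hx : x ∈ B 3) (h : HasGradientWithinAt f p (B 3) x) :
    grad f x = p := by
  rw [grad, gradientWithin, h.hasFDerivWithinAt.fderivWithin (uniqueDiff_B3 x hx)]
  simp

section Ray

variable {f : E3 → ℝ} {p : E3 → E3}

theorem hasDerivAt_ray (hd : ∀ x ∈ Bdot 3, HasGradientWithinAt f (p x) (B 3) x) {x : E3}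
    (hx : x ∈ Bdot 3) {t : ℝ} (ht : t ∈ Ioo (0 : ℝ) 1) :
    HasDerivAt (fun t : ℝ => f (t • x)) (inner ℝ (p (t • x)) x) t := by
  rw [mem_Bdot] at hx
  have hmem : ∀ s ∈ Ioo (0 : ℝ) 1, s • x ∈ B 3 := by
    intro s hs
    rw [mem_B, norm_smul, Real.norm_eq_abs, abs_of_pos hs.1]
    nlinarith [hs.2, norm_nonneg x]
  have htm : t • x ∈ Bdot 3 := ⟨hmem t ht, by simpa [ht.1.ne'] using hx.2⟩
  have h4 : HasDerivWithinAt (fun t : ℝ => t • x) x (Ioo 0 1) t := by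
    simpa using ((hasDerivAt_id t).smul_const x).hasDerivWithinAt
  have h5 := (hd _ htm).hasFDerivWithinAt.comp_hasDerivWithinAt t h4 hmem
  have h6 := h5.hasDerivAt (Ioo_mem_nhds ht.1 ht.2)
  simpa [Function.comp_def] using h6

theorem continuousOn_ray (hc : ContinuousOn f (B 3)) {x : E3} (hx : x ∈ B 3) :
    ContinuousOn (fun t : ℝ => f (t • x)) (Icc 0 1) := by
  refine hc.comp (by fun_prop) fun t ht => ?_
  rw [mem_B] at hx ⊢
  rw [norm_smul, Real.norm_eq_abs, abs_of_nonneg ht.1]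
  nlinarith [ht.2, ht.1, norm_nonneg x]

theorem exists_ray_eq (hc : ContinuousOn f (B 3))
    (hd : ∀ x ∈ Bdot 3, HasGradientWithinAt f (p x) (B 3) x) {x : E3} (hx : x ∈ Bdot 3) :
    ∃ c ∈ Ioo (0 : ℝ) 1, f x - f 0 = inner ℝ (p (c • x)) x := by
  obtain ⟨c, hc1, hc2⟩ := exists_hasDerivAt_eq_slope (fun t : ℝ => f (t • x)) _
    zero_lt_one (continuousOn_ray hc hx.1) fun t ht => hasDerivAt_ray hd hx ht
  refine ⟨c, hc1, ?_⟩
  simp at hc2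
  exact hc2.symm

/-- The mean value theorem along a ray, relative to `t ↦ t²`. -/
theorem exists_ray_eq_half (hc : ContinuousOn f (B 3))
    (hd : ∀ x ∈ Bdot 3, HasGradientWithinAt f (p x) (B 3) x) {x : E3} (hx : x ∈ Bdot 3) :
    ∃ c ∈ Ioo (0 : ℝ) 1, f x - f 0 = (1 / 2) * inner ℝ (c⁻¹ • p (c • x)) x := by
  obtain ⟨c, hc1, hc2⟩ := exists_ratio_hasDerivAt_eq_ratio_slope (fun t : ℝ => f (t • x)) _
    zero_lt_one (continuousOn_ray hc hx.1) (fun t ht => hasDerivAt_ray hd hx ht)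
    (fun t : ℝ => t ^ 2) (fun t => 2 * t) (by fun_prop)
    (fun t _ => by simpa using hasDerivAt_pow 2 t)
  refine ⟨c, hc1, ?_⟩
  simp only [one_smul, zero_smul, one_pow, ne_eq, OfNat.ofNat_ne_zero, not_false_eq_true,
    zero_pow, sub_zero, one_mul] at hc2
  have hc0 : c ≠ 0 := hc1.1.ne'
  rw [real_inner_smul_left, hc2]
  field_simp

theorem abs_sub_zero_le (hc : ContinuousOn f (B 3))
    (hd : ∀ x ∈ Bdot 3, HasGradientWithinAt f (p x) (B 3) x) {N : ℝ}
    (hb : ∀ x ∈ Bdot 3, ‖p x‖ ≤ N) {x : E3} (hx : x ∈ B 3) : |f x - f 0| ≤ N * ‖x‖ := by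
  rcases eq_or_ne x 0 with rfl | hx0
  · simp
  obtain ⟨c, hc1, hc2⟩ := exists_ray_eq hc hd ⟨hx, hx0⟩
  rw [hc2]
  refine (abs_real_inner_le_norm _ _).trans (mul_le_mul_of_nonneg_right (hb _ ?_) (norm_nonneg _))
  rw [mem_B] at hx
  rw [mem_Bdot, norm_smul, Real.norm_eq_abs, abs_of_pos hc1.1]
  exact ⟨by nlinarith [hc1.2, norm_nonneg x], by simp [hc1.1.ne', hx0]⟩

theorem abs_sub_zero_le_sq (hc : ContinuousOn f (B 3))
    (hd : ∀ x ∈ Bdot 3, HasGradientWithinAt f (p x) (B 3) x) {N : ℝ}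
    (hb : ∀ x ∈ Bdot 3, ‖p x‖ ≤ N * ‖x‖) {x : E3} (hx : x ∈ B 3) :
    |f x - f 0| ≤ N * ‖x‖ ^ 2 := by
  rcases eq_or_ne x 0 with rfl | hx0
  · simp
  obtain ⟨c, hc1, hc2⟩ := exists_ray_eq hc hd ⟨hx, hx0⟩
  rw [hc2]
  rw [mem_B] at hx
  have hn : ‖c • x‖ = c * ‖x‖ := by rw [norm_smul, Real.norm_eq_abs, abs_of_pos hc1.1]
  have hm : c • x ∈ Bdot 3 := by
    rw [mem_Bdot, hn]
    exact ⟨by nlinarith [hc1.2, norm_nonneg x], by simp [hc1.1.ne', hx0]⟩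
  have h1 := hb _ hm
  have hpos := norm_pos_iff.2 hx0
  have hN : 0 ≤ N := by
    have := (norm_nonneg _).trans h1
    rw [hn] at this
    exact nonneg_of_mul_nonneg_left this (mul_pos hc1.1 hpos)
  calc |inner ℝ (p (c • x)) x| ≤ ‖p (c • x)‖ * ‖x‖ := abs_real_inner_le_norm _ _
    _ ≤ (N * ‖x‖) * ‖x‖ := by
        refine mul_le_mul_of_nonneg_right (h1.trans (mul_le_mul_of_nonneg_left ?_ hN))
          (norm_nonneg _)
        rw [hn]; nlinarith [hc1.2]
    _ = N * ‖x‖ ^ 2 := by ring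

/-- A bound for the gradient off the origin is a Lipschitz bound, since a segment through the
origin can be cut there. -/
theorem abs_sub_le_of_grad (hc : ContinuousOn f (B 3))
    (hd : ∀ x ∈ Bdot 3, HasGradientWithinAt f (p x) (B 3) x) {N : ℝ}
    (hb : ∀ x ∈ Bdot 3, ‖p x‖ ≤ N) {x y : E3} (hx : x ∈ B 3) (hy : y ∈ B 3) :
    |f x - f y| ≤ N * ‖x - y‖ := by
  by_cases h0 : (0 : E3) ∈ segment ℝ y x
  · have h1 := dist_add_dist_of_mem_segment h0
    rw [dist_zero_right, dist_zero_left, dist_eq_norm, norm_sub_rev] at h1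
    have h2 := abs_sub_zero_le hc hd hb hx
    have h3 := abs_sub_zero_le hc hd hb hy
    have h4 : |f x - f y| ≤ |f x - f 0| + |f y - f 0| := by
      rw [abs_sub_comm (f y)]; exact abs_sub_le _ _ _
    calc |f x - f y| ≤ N * ‖x‖ + N * ‖y‖ := by linarith
      _ = N * ‖x - y‖ := by rw [← h1]; ring
  · have hsub : segment ℝ y x ⊆ B 3 := (convex_closedBall (0 : E3) 3).segment_subset hy hx
    have hmem : ∀ z ∈ segment ℝ y x, z ∈ Bdot 3 := fun z hz =>
      ⟨hsub hz, fun h => h0 (by rw [mem_singleton_iff] at h; rwa [← h])⟩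
    exact Convex.norm_image_sub_le_of_norm_hasFDerivWithin_le (f := f)
      (f' := fun z => InnerProductSpace.toDual ℝ E3 (p z))
      (fun z hz => (hd z (hmem z hz)).hasFDerivWithinAt.mono hsub)
      (fun z hz => by simpa using hb z (hmem z hz)) (convex_segment y x)
      (left_mem_segment ℝ y x) (right_mem_segment ℝ y x)

end Ray

theorem contDiffOn_one_of_gradient {f : E3 → ℝ} {p : E3 → E3} {s : Set E3} (hs : UniqueDiffOn ℝ s)
    (hd : ∀ x ∈ s, HasGradientWithinAt f (p x) s x) (hc : ContinuousOn p s) :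
    ContDiffOn ℝ 1 f s := by
  rw [← zero_add (1 : WithTop ℕ∞), contDiffOn_succ_iff_fderivWithin hs]
  refine ⟨fun x hx => (hd x hx).differentiableWithinAt, by simp, ?_⟩
  rw [contDiffOn_zero]
  refine ((InnerProductSpace.toDual ℝ E3).continuous.comp_continuousOn hc).congr fun x hx => ?_
  exact (hd x hx).hasFDerivWithinAt.fderivWithin (hs x hx)

theorem uniqueDiff_Bdot : UniqueDiffOn ℝ (Bdot 3) :=
  uniqueDiff_B3.inter isOpen_compl_singleton

/-- Membership in `X`, given a candidate for the gradient off the origin. -/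
theorem memX_of_gradient {f : E3 → ℝ} {p : E3 → E3} (hf : IsCS 3 f) (h0 : f 0 = 0)
    (hd : ∀ x ∈ Bdot 3, HasGradientWithinAt f (p x) (B 3) x) (hc : ContinuousOn p (Bdot 3))
    {C : ℝ} (hb : ∀ x ∈ Bdot 3, ‖p x‖ ≤ C) (hl : HasRadialLimit fun t x => p (t • x)) :
    MemX f where
  isCS := hf
  map_zero := h0
  contDiffOn := contDiffOn_one_of_gradient uniqueDiff_Bdot
    (fun x hx => HasFDerivWithinAt.mono (hd x hx) sdiff_subset) hc
  grad_bound := ⟨C, fun x hx => by rw [grad_eq hx.1 (hd x hx)]; exact hb x hx⟩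
  grad_limit := by
    obtain ⟨G, -, hG⟩ := hl
    refine ⟨G, hG.congr ?_⟩
    filter_upwards [eventually_Ioc] with t ht x hx
    have hm := smul_mem_Bdot ht hx
    exact (grad_eq hm.1 (hd _ hm)).symm

/-- Membership in `Y`, given a candidate for the gradient off the origin. -/
theorem memY_of_gradient {f : E3 → ℝ} {p : E3 → E3} (hf : IsCS 3 f) (h0 : f 0 = 0)
    (hd : ∀ x ∈ Bdot 3, HasGradientWithinAt f (p x) (B 3) x) (hc : ContinuousOn p (Bdot 3))
    {C : ℝ} (hb : ∀ x ∈ Bdot 3, ‖p x‖ ≤ C * ‖x‖)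
    (hl : HasRadialLimit fun t x => t⁻¹ • p (t • x)) : MemY f := by
  -- the gradient extends continuously by zero to the origin
  set p' : E3 → E3 := fun x => if x = 0 then 0 else p x with hp'
  have hp'eq : ∀ x, x ≠ 0 → p' x = p x := fun x hx => if_neg hx
  have hC : ∀ x ∈ B 3, ‖p' x‖ ≤ |C| * ‖x‖ := by
    intro x hx
    rcases eq_or_ne x 0 with rfl | hx0
    · simp [hp']
    · rw [hp'eq x hx0]
      exact (hb x ⟨hx, hx0⟩).trans (mul_le_mul_of_nonneg_right (le_abs_self C) (norm_nonneg _))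
  have hd' : ∀ x ∈ B 3, HasGradientWithinAt f (p' x) (B 3) x := by
    intro x hx
    rcases eq_or_ne x 0 with rfl | hx0
    · rw [hasGradientWithinAt_iff_isLittleO]
      have h1 : ∀ x' ∈ B 3, ‖f x' - f 0 - inner ℝ (p' 0) (x' - 0)‖ ≤ C * ‖x' - 0‖ ^ 2 := by
        intro x' hx'
        have : p' 0 = 0 := if_pos rfl
        rw [this, inner_zero_left, sub_zero, sub_zero]
        exact abs_sub_zero_le_sq hf.continuousOn hd hb hx'
      refine Asymptotics.IsBigO.trans_isLittleO (g := fun x' : E3 => ‖x' - 0‖ ^ 2) ?_ ?_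
      · refine Asymptotics.IsBigO.of_bound C ?_
        filter_upwards [self_mem_nhdsWithin] with x' hx'
        rw [Real.norm_of_nonneg (sq_nonneg ‖x' - 0‖)]
        exact h1 x' hx'
      · have h2 := (Asymptotics.isLittleO_norm_pow_norm_pow (E' := E3) (m := 1) (n := 2)
          one_lt_two)
        simp only [pow_one, sub_zero] at h2 ⊢
        exact (h2.mono nhdsWithin_le_nhds).of_norm_right
    · rw [hp'eq x hx0]; exact hd x ⟨hx, hx0⟩
  have hc' : ContinuousOn p' (B 3) := by
    intro x hx
    rcases eq_or_ne x 0 with rfl | hx0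
    · have : p' 0 = 0 := if_pos rfl
      rw [ContinuousWithinAt, this, tendsto_zero_iff_norm_tendsto_zero]
      refine squeeze_zero' (.of_forall fun _ => norm_nonneg _)
        (g := fun x : E3 => |C| * ‖x‖) ?_ ?_
      · filter_upwards [self_mem_nhdsWithin] with x' hx' using hC x' hx'
      · have : Continuous fun x : E3 => |C| * ‖x‖ := by fun_prop
        have h := this.tendsto 0
        simp only [norm_zero, mul_zero] at h
        exact h.mono_left nhdsWithin_le_nhds
    · rw [ContinuousWithinAt, ← nhdsWithin_Bdot hx0]
      refine ((hc x ⟨hx, hx0⟩).tendsto.congr' ?_).trans (by rw [hp'eq x hx0])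
      filter_upwards [self_mem_nhdsWithin] with x' hx' using (hp'eq x' hx'.2).symm
  refine ⟨hf, h0, contDiffOn_one_of_gradient uniqueDiff_B3 hd' hc', ⟨|C|, fun x hx => ?_⟩, ?_⟩
  · rw [grad_eq hx (hd' x hx)]; exact hC x hx
  · obtain ⟨G, -, hG⟩ := hl
    refine ⟨G, hG.congr ?_⟩
    filter_upwards [eventually_Ioc] with t ht x hx
    have hm := smul_mem_Bdot ht hx
    simp only
    rw [grad_eq hm.1 (hd _ hm)]

namespace MemX

variable {ζ : E3 → ℝ}

theorem hasGradientWithinAt (hζ : MemX ζ) (x : E3) (hx : x ∈ Bdot 3) :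
    HasGradientWithinAt ζ (grad ζ x) (B 3) x := (hζ.diff hx).hasGradientWithinAt

theorem continuousOn_grad (hζ : MemX ζ) : ContinuousOn (grad ζ) (Bdot 3) := by
  have h1 := hζ.contDiffOn.continuousOn_fderivWithin uniqueDiff_Bdot le_rfl
  refine ((InnerProductSpace.toDual ℝ E3).symm.continuous.comp_continuousOn h1).congr
    fun x hx => ?_
  rw [grad, gradientWithin, Function.comp_apply]
  congr 1
  exact ((hζ.diff hx).hasFDerivWithinAt.mono sdiff_subset).fderivWithin (uniqueDiff_Bdot x hx)
    |>.symm

theorem hasRadialLimit (hζ : MemX ζ) : HasRadialLimit fun t x => grad ζ (t • x) := by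
  obtain ⟨G, hG⟩ := hζ.grad_limit
  obtain ⟨C, hC⟩ := hζ.grad_bound
  refine HasRadialLimit.of_bounded (C := C) hG ?_
  filter_upwards [eventually_Ioc] with t ht x hx using hC _ (smul_mem_Bdot ht hx)

theorem abs_le (hζ : MemX ζ) {N : ℝ} (hN : ∀ x ∈ Bdot 3, ‖grad ζ x‖ ≤ N) {x : E3}
    (hx : x ∈ B 3) : |ζ x| ≤ N * ‖x‖ := by
  have := abs_sub_zero_le hζ.isCS.continuousOn hζ.hasGradientWithinAt hN hx
  rwa [hζ.map_zero, sub_zero] at this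

theorem abs_sub_le (hζ : MemX ζ) {N : ℝ} (hN : ∀ x ∈ Bdot 3, ‖grad ζ x‖ ≤ N) {x y : E3}
    (hx : x ∈ B 3) (hy : y ∈ B 3) : |ζ x - ζ y| ≤ N * ‖x - y‖ :=
  abs_sub_le_of_grad hζ.isCS.continuousOn hζ.hasGradientWithinAt hN hx hy

theorem hasRadialLimit_div (hζ : MemX ζ) : HasRadialLimit fun t x => ζ (t • x) / t := by
  have hex : ∀ (t : ℝ) (x : E3), ∃ c ∈ Ioo (0 : ℝ) 1, t ∈ Ioc (0 : ℝ) 3 → x ∈ S1 →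
      ζ (t • x) = inner ℝ (grad ζ (c • t • x)) (t • x) := by
    intro t x
    by_cases h : t ∈ Ioc (0 : ℝ) 3 ∧ x ∈ S1
    · obtain ⟨c, hc, h1⟩ := exists_ray_eq hζ.isCS.continuousOn hζ.hasGradientWithinAt
        (smul_mem_Bdot h.1 h.2)
      rw [hζ.map_zero, sub_zero] at h1
      exact ⟨c, hc, fun _ _ => h1⟩
    · exact ⟨1 / 2, by norm_num, fun h1 h2 => absurd ⟨h1, h2⟩ h⟩
  choose c hc hceq using hex
  have h1 := hζ.hasRadialLimit.comp_radius (s := fun t x => c t x * t) (fun ε hε => by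
    filter_upwards [eventually_Ioo hε] with t ht x _
    exact ⟨mul_pos (hc t x).1 ht.1, by nlinarith [(hc t x).2, ht.1, ht.2]⟩)
  refine (h1.inner HasRadialLimit.id).congr ?_
  filter_upwards [eventually_Ioc] with t ht x hx
  rw [hceq t x ht hx, smul_smul, real_inner_smul_right, mul_div_cancel_left₀ _ ht.1.ne']

end MemX

namespace MemY

variable {w : E3 → ℝ}

theorem hasGradientWithinAt (hw : MemY w) (x : E3) (hx : x ∈ Bdot 3) :
    HasGradientWithinAt w (grad w x) (B 3) x := (hw.diff hx.1).hasGradientWithinAt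

theorem continuousOn_grad (hw : MemY w) : ContinuousOn (grad w) (B 3) :=
  (InnerProductSpace.toDual ℝ E3).symm.continuous.comp_continuousOn
    (hw.contDiffOn.continuousOn_fderivWithin uniqueDiff_B3 le_rfl)

theorem hasRadialLimit (hw : MemY w) : HasRadialLimit fun t x => t⁻¹ • grad w (t • x) := by
  obtain ⟨G, hG⟩ := hw.grad_limit
  obtain ⟨C, hC⟩ := hw.grad_bound
  refine HasRadialLimit.of_bounded (C := C) hG ?_
  filter_upwards [eventually_Ioc] with t ht x hx
  have := hC _ (smul_mem_Bdot ht hx).1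
  rw [norm_smul, norm_of_mem_S1 hx, mul_one, Real.norm_of_nonneg ht.1.le] at this
  rw [norm_smul, norm_inv, Real.norm_of_nonneg ht.1.le, inv_mul_le_iff₀ ht.1, mul_comm]
  exact this

theorem abs_le (hw : MemY w) {N : ℝ} (hN : ∀ x ∈ Bdot 3, ‖grad w x‖ ≤ N * ‖x‖) {x : E3}
    (hx : x ∈ B 3) : |w x| ≤ N * ‖x‖ ^ 2 := by
  have := abs_sub_zero_le_sq hw.isCS.continuousOn hw.hasGradientWithinAt hN hx
  rwa [hw.map_zero, sub_zero] at this

theorem hasRadialLimit_div (hw : MemY w) : HasRadialLimit fun t x => w (t • x) / t ^ 2 := by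
  have hex : ∀ (t : ℝ) (x : E3), ∃ c ∈ Ioo (0 : ℝ) 1, t ∈ Ioc (0 : ℝ) 3 → x ∈ S1 →
      w (t • x) = (1 / 2) * inner ℝ (c⁻¹ • grad w (c • t • x)) (t • x) := by
    intro t x
    by_cases h : t ∈ Ioc (0 : ℝ) 3 ∧ x ∈ S1
    · obtain ⟨c, hc, h1⟩ := exists_ray_eq_half hw.isCS.continuousOn hw.hasGradientWithinAt
        (smul_mem_Bdot h.1 h.2)
      rw [hw.map_zero, sub_zero] at h1
      exact ⟨c, hc, fun _ _ => h1⟩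
    · exact ⟨1 / 2, by norm_num, fun h1 h2 => absurd ⟨h1, h2⟩ h⟩
  choose c hc hceq using hex
  have h1 := hw.hasRadialLimit.comp_radius (s := fun t x => c t x * t) (fun ε hε => by
    filter_upwards [eventually_Ioo hε] with t ht x _
    exact ⟨mul_pos (hc t x).1 ht.1, by nlinarith [(hc t x).2, ht.1, ht.2]⟩)
  refine ((h1.inner HasRadialLimit.id).comp (Φ := fun z : ℝ => 1 / 2 * z) (by fun_prop)).congr ?_
  filter_upwards [eventually_Ioc] with t ht x hx
  have hc0 : c t x ≠ 0 := (hc t x).1.ne'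
  have ht0 : t ≠ 0 := ht.1.ne'
  rw [hceq t x ht hx, smul_smul, real_inner_smul_right, real_inner_smul_left,
    real_inner_smul_left]
  field_simp

end MemY

theorem norm_grad_le_X (ζ : X) (x : E3) (hx : x ∈ Bdot 3) : ‖grad ζ x‖ ≤ ‖ζ‖ :=
  le_ciSup (bddX ζ) ⟨x, hx⟩

theorem norm_grad_le_Y (w : Y) (x : E3) (hx : x ∈ Bdot 3) : ‖grad w x‖ ≤ ‖w‖ * ‖x‖ :=
  (div_le_iff₀ (norm_pos_iff.2 hx.2)).1 (le_ciSup (bddY w) ⟨x, hx⟩)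

theorem norm_X_le {ζ : X} {C : ℝ} (h : ∀ x ∈ Bdot 3, ‖grad ζ x‖ ≤ C) : ‖ζ‖ ≤ C :=
  have := nonempty_Bdot
  ciSup_le fun x => h x x.2

theorem norm_Y_le {w : Y} {C : ℝ} (h : ∀ x ∈ Bdot 3, ‖grad w x‖ ≤ C * ‖x‖) : ‖w‖ ≤ C :=
  have := nonempty_Bdot
  ciSup_le fun x => (div_le_iff₀ (norm_pos_iff.2 x.2.2)).2 (h x x.2)

/-! ### Radial deformations of the ball -/

/-- A function in `X` with gradient bounded by `N ≤ 1/6`: small enough for the deformation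
`g_ζ` to be a homeomorphism of `B_3` onto a set that contains `B_2`. -/
structure IsSmall (N : ℝ) (ζ : E3 → ℝ) : Prop where
  memX : MemX ζ
  grad_le : ∀ x ∈ Bdot 3, ‖grad ζ x‖ ≤ N
  le : N ≤ 1 / 6

theorem isSmall_zero : IsSmall 0 (0 : E3 → ℝ) :=
  ⟨(0 : XSub).2, fun x _ => by rw [grad_zero, norm_zero], by norm_num⟩

theorem norm_normalize_sub_le {x y : E3} (hx : x ≠ 0) (hy : y ≠ 0) :
    ‖y‖ * ‖‖x‖⁻¹ • x - ‖y‖⁻¹ • y‖ ≤ 2 * ‖x - y‖ := by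
  have hx' := norm_pos_iff.2 hx
  have hy' := norm_pos_iff.2 hy
  have e : ‖y‖ • (‖x‖⁻¹ • x - ‖y‖⁻¹ • y) = ((‖y‖ - ‖x‖) * ‖x‖⁻¹) • x + (x - y) := by
    rw [smul_sub, smul_smul, smul_smul, mul_inv_cancel₀ hy'.ne', sub_mul,
      mul_inv_cancel₀ hx'.ne', sub_smul]
    module
  have h1 : ‖y‖ * ‖‖x‖⁻¹ • x - ‖y‖⁻¹ • y‖ = ‖((‖y‖ - ‖x‖) * ‖x‖⁻¹) • x + (x - y)‖ := by
    rw [← e, norm_smul, norm_norm]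
  rw [h1]
  refine (norm_add_le _ _).trans ?_
  have h2 : ‖((‖y‖ - ‖x‖) * ‖x‖⁻¹) • x‖ = |‖y‖ - ‖x‖| := by
    rw [norm_smul, norm_mul, norm_inv, norm_norm, mul_assoc, inv_mul_cancel₀ hx'.ne', mul_one,
      Real.norm_eq_abs]
  rw [h2]
  have := abs_norm_sub_norm_le y x
  rw [norm_sub_rev] at this
  linarith

theorem deform_zero_right (ζ : E3 → ℝ) : deform ζ 0 = 0 := by simp [deform]

theorem deform_eq_smul (ζ : E3 → ℝ) (x : E3) : deform ζ x = (1 + ζ x / ‖x‖) • x := by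
  rw [deform, add_smul, one_smul]

theorem deform_zero_left (x : E3) : deform 0 x = x := by simp [deform]

theorem deform_iso {ζ : E3 → ℝ} (e : E3 ≃ₗᵢ[ℝ] E3) {x : E3} (h : ζ (e x) = ζ x) :
    deform ζ (e x) = e (deform ζ x) := by
  rw [deform, deform, h, e.norm_map, map_add, map_smul]

namespace IsSmall

variable {N : ℝ} {ζ : E3 → ℝ}

theorem nonneg (h : IsSmall N ζ) : 0 ≤ N := by
  obtain ⟨x⟩ := nonempty_Bdot
  exact (norm_nonneg _).trans (h.grad_le x x.2)

theorem abs_le (h : IsSmall N ζ) {x : E3} (hx : x ∈ B 3) : |ζ x| ≤ N * ‖x‖ :=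
  h.memX.abs_le h.grad_le hx

theorem abs_div_le (h : IsSmall N ζ) {x : E3} (hx : x ∈ B 3) : |ζ x / ‖x‖| ≤ N := by
  rw [abs_div, abs_norm]
  exact div_le_of_le_mul₀ (norm_nonneg _) h.nonneg (h.abs_le hx)

theorem factor_pos (h : IsSmall N ζ) {x : E3} (hx : x ∈ B 3) : 0 < 1 + ζ x / ‖x‖ := by
  have := (_root_.abs_le.1 (h.abs_div_le hx)).1
  have := h.le
  linarith

theorem norm_deform (h : IsSmall N ζ) {x : E3} (hx : x ∈ B 3) :
    ‖deform ζ x‖ = ‖x‖ + ζ x := by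
  rcases eq_or_ne x 0 with rfl | hx0
  · rw [deform_zero_right, norm_zero, h.memX.map_zero, add_zero]
  rw [deform_eq_smul, norm_smul, Real.norm_of_nonneg (h.factor_pos hx).le]
  have := norm_pos_iff.2 hx0
  field_simp

theorem deform_ne_zero (h : IsSmall N ζ) {x : E3} (hx : x ∈ Bdot 3) : deform ζ x ≠ 0 := by
  rw [deform_eq_smul]
  exact smul_ne_zero (h.factor_pos hx.1).ne' hx.2

theorem norm_deform_le (h : IsSmall N ζ) {x : E3} (hx : x ∈ B 3) :
    ‖deform ζ x‖ ≤ (1 + N) * ‖x‖ := by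
  rw [h.norm_deform hx]
  linarith [le_abs_self (ζ x), h.abs_le hx]

theorem norm_deform_le_four (h : IsSmall N ζ) {x : E3} (hx : x ∈ B 3) : ‖deform ζ x‖ ≤ 4 := by
  have h1 := h.norm_deform_le hx
  have h2 := h.le
  rw [mem_B] at hx
  nlinarith [norm_nonneg x]

theorem le_norm_deform (h : IsSmall N ζ) {x : E3} (hx : x ∈ B 3) :
    (1 / 2) * ‖x‖ ≤ ‖deform ζ x‖ := by
  rw [h.norm_deform hx]
  have h1 := neg_abs_le (ζ x)
  have h2 := h.abs_le hx
  have h3 := h.le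
  nlinarith [norm_nonneg x]

theorem norm_deform_sub_self (h : IsSmall N ζ) {x : E3} (hx : x ∈ B 3) :
    ‖deform ζ x - x‖ ≤ N * ‖x‖ := by
  rw [deform, add_sub_cancel_left, norm_smul, Real.norm_eq_abs]
  exact mul_le_mul_of_nonneg_right (h.abs_div_le hx) (norm_nonneg x)

/-- The displacement field `g_ζ - id` is Lipschitz continuous with constant `3 N`. -/
theorem norm_displacement_sub_le (h : IsSmall N ζ) {x y : E3} (hx : x ∈ B 3) (hy : y ∈ B 3) :
    ‖(deform ζ x - x) - (deform ζ y - y)‖ ≤ 3 * N * ‖x - y‖ := by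
  have hN := h.nonneg
  rcases eq_or_ne y 0 with rfl | hy0
  · rw [deform_zero_right, sub_zero, sub_zero, sub_zero]
    nlinarith [h.norm_deform_sub_self hx, norm_nonneg x]
  rcases eq_or_ne x 0 with rfl | hx0
  · rw [deform_zero_right, sub_zero, zero_sub, zero_sub, norm_neg, norm_neg]
    nlinarith [h.norm_deform_sub_self hy, norm_nonneg y]
  have hx' := norm_pos_iff.2 hx0
  have hy' := norm_pos_iff.2 hy0
  have e : (deform ζ x - x) - (deform ζ y - y) =
      (ζ x - ζ y) • (‖x‖⁻¹ • x) + ζ y • (‖x‖⁻¹ • x - ‖y‖⁻¹ • y) := by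
    simp only [deform, add_sub_cancel_left, div_eq_mul_inv]
    module
  have h1 : ‖‖x‖⁻¹ • x‖ = 1 := by
    rw [norm_smul, norm_inv, norm_norm, inv_mul_cancel₀ hx'.ne']
  rw [e]
  refine (norm_add_le _ _).trans ?_
  rw [norm_smul (ζ x - ζ y), norm_smul (ζ y), h1, mul_one, Real.norm_eq_abs, Real.norm_eq_abs]
  have h2 := h.memX.abs_sub_le h.grad_le hx hy
  have h3 : |ζ y| * ‖‖x‖⁻¹ • x - ‖y‖⁻¹ • y‖ ≤ N * (2 * ‖x - y‖) := by
    calc |ζ y| * ‖‖x‖⁻¹ • x - ‖y‖⁻¹ • y‖ ≤ (N * ‖y‖) * ‖‖x‖⁻¹ • x - ‖y‖⁻¹ • y‖ :=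
          mul_le_mul_of_nonneg_right (h.abs_le hy) (norm_nonneg _)
      _ = N * (‖y‖ * ‖‖x‖⁻¹ • x - ‖y‖⁻¹ • y‖) := by ring
      _ ≤ _ := mul_le_mul_of_nonneg_left (norm_normalize_sub_le hx0 hy0) hN
  linarith

theorem half_norm_sub_le (h : IsSmall N ζ) {x y : E3} (hx : x ∈ B 3) (hy : y ∈ B 3) :
    (1 / 2) * ‖x - y‖ ≤ ‖deform ζ x - deform ζ y‖ := by
  have h1 := h.norm_displacement_sub_le hx hy
  have h2 := norm_sub_le (deform ζ x - deform ζ y) ((deform ζ x - x) - (deform ζ y - y))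
  have e : (deform ζ x - deform ζ y) - ((deform ζ x - x) - (deform ζ y - y)) = x - y := by abel
  rw [e] at h2
  have h3 := h.le
  nlinarith [norm_nonneg (x - y)]

/-- `g_ζ` is a perturbation of the identity with Lipschitz constant at most `1/2`. -/
theorem injOn_deform (h : IsSmall N ζ) : InjOn (deform ζ) (B 3) := by
  intro x hx y hy hxy
  have := h.half_norm_sub_le hx hy
  rw [hxy, sub_self, norm_zero] at this
  have h2 : ‖x - y‖ ≤ 0 := by linarith
  exact sub_eq_zero.1 (norm_le_zero_iff.1 h2)

theorem continuousOn_deform (h : IsSmall N ζ) : ContinuousOn (deform ζ) (B 3) := by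
  have h1 : ContinuousOn (fun x => deform ζ x - x) (B 3) := by
    refine (LipschitzOnWith.of_dist_le_mul (K := (3 * N).toNNReal) fun x hx y hy => ?_).continuousOn
    rw [Real.coe_toNNReal _ (by have := h.nonneg; positivity), dist_eq_norm, dist_eq_norm]
    exact h.norm_displacement_sub_le hx hy
  exact (h1.add continuousOn_id).congr fun x _ => by simp

/-- `g_ζ` preserves rays, and on each ray the intermediate value theorem applies to the radius
`r + ζ(r e)`. -/
theorem subset_image_deform (h : IsSmall N ζ) : B 2 ⊆ deform ζ '' B 3 := by
  intro y hy
  rw [mem_B] at hy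
  rcases eq_or_ne y 0 with rfl | hy0
  · exact ⟨0, by rw [mem_B]; simp, deform_zero_right ζ⟩
  have hy' := norm_pos_iff.2 hy0
  set e := ‖y‖⁻¹ • y with he
  have hen : ‖e‖ = 1 := by rw [he, norm_smul, norm_inv, norm_norm, inv_mul_cancel₀ hy'.ne']
  have hmem : ∀ r ∈ Icc (0 : ℝ) 3, r • e ∈ B 3 := fun r hr => by
    rw [mem_B, norm_smul, hen, mul_one, Real.norm_of_nonneg hr.1]; exact hr.2
  have hc : ContinuousOn (fun r : ℝ => r + ζ (r • e)) (Icc 0 3) :=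
    continuousOn_id.add (h.memX.isCS.continuousOn.comp (by fun_prop) hmem)
  have h3 : 2 ≤ 3 + ζ ((3 : ℝ) • e) := by
    have h1 := h.abs_le (hmem 3 (by norm_num))
    rw [norm_smul, hen] at h1
    have h2 := h.le
    have := neg_abs_le (ζ ((3 : ℝ) • e))
    norm_num at h1
    linarith
  obtain ⟨r, hr, hry⟩ := intermediate_value_Icc (by norm_num : (0 : ℝ) ≤ 3) hc
    (show ‖y‖ ∈ Icc _ _ from ⟨by simp [h.memX.map_zero], by linarith⟩)
  simp only at hry
  refine ⟨r • e, hmem r hr, ?_⟩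
  have hr0 : r ≠ 0 := by
    rintro rfl
    rw [zero_smul, h.memX.map_zero, add_zero] at hry
    exact hy'.ne hry
  rw [deform_eq_smul, norm_smul, hen, mul_one, Real.norm_of_nonneg hr.1, smul_smul]
  have : (1 + ζ (r • e) / r) * r = ‖y‖ := by rw [← hry]; field_simp
  rw [this, he, smul_smul, mul_inv_cancel₀ hy'.ne', one_smul]

theorem deformInv_mem (h : IsSmall N ζ) {y : E3} (hy : y ∈ B 2) : deformInv ζ y ∈ B 3 :=
  Function.invFunOn_mem (h.subset_image_deform hy)

theorem deform_deformInv (h : IsSmall N ζ) {y : E3} (hy : y ∈ B 2) :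
    deform ζ (deformInv ζ y) = y :=
  Function.invFunOn_eq (h.subset_image_deform hy)

theorem norm_deformInv_le (h : IsSmall N ζ) {y : E3} (hy : y ∈ B 2) :
    ‖deformInv ζ y‖ ≤ 2 * ‖y‖ := by
  have := h.le_norm_deform (h.deformInv_mem hy)
  rw [h.deform_deformInv hy] at this
  linarith

theorem norm_deformInv (h : IsSmall N ζ) {y : E3} (hy : y ∈ B 2) :
    ‖deformInv ζ y‖ = ‖y‖ - ζ (deformInv ζ y) := by
  have := h.norm_deform (h.deformInv_mem hy)
  rw [h.deform_deformInv hy] at this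
  linarith

theorem norm_deformInv_sub_self (h : IsSmall N ζ) {y : E3} (hy : y ∈ B 2) :
    ‖deformInv ζ y - y‖ ≤ 2 * N * ‖y‖ := by
  have h1 := h.norm_deform_sub_self (h.deformInv_mem hy)
  rw [h.deform_deformInv hy, norm_sub_rev] at h1
  nlinarith [h.norm_deformInv_le hy, h.nonneg]

theorem continuousOn_deformInv (h : IsSmall N ζ) : ContinuousOn (deformInv ζ) (B 2) := by
  refine (LipschitzOnWith.of_dist_le_mul (K := 2) fun x hx y hy => ?_).continuousOn
  have := h.half_norm_sub_le (h.deformInv_mem hx) (h.deformInv_mem hy)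
  rw [h.deform_deformInv hx, h.deform_deformInv hy] at this
  rw [dist_eq_norm, dist_eq_norm]
  push_cast
  linarith

theorem norm_deformInv_symm (h : IsSmall N ζ) {A : E3 → E3} (hA : A ∈ S) {y : E3}
    (hy : y ∈ B 2) : ‖deformInv ζ (A y)‖ = ‖deformInv ζ y‖ := by
  have hz := h.memX.isCS.sInv A hA (deformInv ζ y)
  obtain ⟨e, he⟩ := exists_iso_of_mem_S hA
  rw [← he] at hz ⊢
  have h1 := h.deformInv_mem hy
  have hey : e y ∈ B 2 := by rwa [mem_B, e.norm_map, ← mem_B]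
  have h2 : deformInv ζ (e y) = e (deformInv ζ y) := by
    refine h.injOn_deform (h.deformInv_mem hey) ?_ ?_
    · rwa [mem_B, e.norm_map, ← mem_B]
    · rw [h.deform_deformInv hey, deform_iso e hz, h.deform_deformInv hy]
  rw [h2, e.norm_map]

end IsSmall

/-! ### Composition of potentials with deformations -/

/-- The gradient of `Φ ∘ g_ζ`, where `P` is the gradient of `Φ`. -/
def pullGrad (ζ : E3 → ℝ) (P : E3 → E3) (x : E3) : E3 :=
  (1 + ζ x / ‖x‖) • P (deform ζ x) +
    inner ℝ (P (deform ζ x)) x • (‖x‖⁻¹ • grad ζ x - (ζ x / ‖x‖ ^ 3) • x)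

/-- A function `Φ` with gradient `P` off the origin, of the kind whose restriction to `B_3`
belongs to `Y` up to a constant. -/
structure IsPotential (C : ℝ) (Φ : E3 → ℝ) (P : E3 → E3) : Prop where
  hasGradientAt : ∀ y, y ≠ 0 → HasGradientAt Φ (P y) y
  continuous : Continuous Φ
  continuousOn : ContinuousOn P {0}ᶜ
  bound : ∀ y, y ≠ 0 → ‖y‖ ≤ 4 → ‖P y‖ ≤ C * ‖y‖
  radialLimit : HasRadialLimit fun t x => t⁻¹ • P (t • x)
  sInv : SInv Φ

theorem hasGradientAt_inv_norm {x : E3} (hx : x ≠ 0) :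
    HasGradientAt (fun x : E3 => ‖x‖⁻¹) (-(‖x‖ ^ 3)⁻¹ • x) x := by
  have hx' := norm_pos_iff.2 hx
  have h1 := hasGradientAt_radial hx (V := fun r => r⁻¹) (hasDerivAt_inv hx'.ne')
  convert h1 using 2
  field_simp

theorem hasGradientWithinAt_comp_deform {ζ : E3 → ℝ} {Φ : E3 → ℝ} {P : E3 → E3} {x : E3}
    (hx : x ≠ 0) (hζ : HasGradientWithinAt ζ (grad ζ x) (B 3) x)
    (hΦ : HasGradientAt Φ (P (deform ζ x)) (deform ζ x)) :
    HasGradientWithinAt (fun x => Φ (deform ζ x)) (pullGrad ζ P x) (B 3) x := by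
  have h1 : HasFDerivWithinAt (fun x => ζ x * ‖x‖⁻¹) _ (B 3) x :=
    hζ.hasFDerivWithinAt.mul (hasGradientAt_inv_norm hx).hasFDerivAt.hasFDerivWithinAt
  have h2 := (h1.const_add 1).smul (hasFDerivWithinAt_id x (B 3))
  have e : (fun x => 1 + ζ x * ‖x‖⁻¹) • id = deform ζ := by
    funext y
    rw [deform_eq_smul, div_eq_mul_inv]
    rfl
  have h3 := h2
  rw [e] at h3
  have h4 := hΦ.hasFDerivAt.comp_hasFDerivWithinAt x h3
  rw [hasGradientWithinAt_iff_hasFDerivWithinAt]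
  refine h4.congr_fderiv ?_
  ext v
  simp only [pullGrad, ContinuousLinearMap.comp_apply, InnerProductSpace.toDual_apply_apply,
    _root_.add_apply, _root_.smul_apply,
    ContinuousLinearMap.smulRight_apply, ContinuousLinearMap.id_apply, inner_add_right,
    inner_add_left, real_inner_smul_right, real_inner_smul_left, inner_sub_left, id,
    smul_eq_mul, neg_smul, map_neg, map_smul, _root_.neg_apply]
  ring

theorem norm_pullGrad_sub_le {N : ℝ} {ζ : E3 → ℝ} (h : IsSmall N ζ) {P : E3 → E3} {x : E3}
    (hx : x ∈ Bdot 3) : ‖pullGrad ζ P x - P (deform ζ x)‖ ≤ 3 * N * ‖P (deform ζ x)‖ := by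
  have hx' := norm_pos_iff.2 hx.2
  have hN := h.nonneg
  set p := P (deform ζ x)
  have e : pullGrad ζ P x - p = (ζ x / ‖x‖) • p +
      inner ℝ p x • (‖x‖⁻¹ • grad ζ x - (ζ x / ‖x‖ ^ 3) • x) := by
    rw [pullGrad]; module
  have h1 : ‖(ζ x / ‖x‖) • p‖ ≤ N * ‖p‖ := by
    rw [norm_smul, Real.norm_eq_abs]
    exact mul_le_mul_of_nonneg_right (h.abs_div_le hx.1) (norm_nonneg _)
  have h2 : ‖‖x‖⁻¹ • grad ζ x - (ζ x / ‖x‖ ^ 3) • x‖ ≤ 2 * N * ‖x‖⁻¹ := by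
    refine (norm_sub_le _ _).trans ?_
    have a1 : ‖‖x‖⁻¹ • grad ζ x‖ ≤ N * ‖x‖⁻¹ := by
      rw [norm_smul, norm_inv, norm_norm, mul_comm]
      exact mul_le_mul_of_nonneg_right (h.grad_le x hx) (by positivity)
    have a2 : ‖(ζ x / ‖x‖ ^ 3) • x‖ ≤ N * ‖x‖⁻¹ := by
      have : ‖(ζ x / ‖x‖ ^ 3) • x‖ = |ζ x / ‖x‖| * ‖x‖⁻¹ := by
        rw [norm_smul, Real.norm_eq_abs, abs_div, abs_div, abs_norm, abs_pow, abs_norm]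
        field_simp
      rw [this]
      exact mul_le_mul_of_nonneg_right (h.abs_div_le hx.1) (by positivity)
    linarith
  have h3 : ‖inner ℝ p x • (‖x‖⁻¹ • grad ζ x - (ζ x / ‖x‖ ^ 3) • x)‖ ≤ 2 * N * ‖p‖ := by
    rw [norm_smul]
    calc ‖(inner ℝ p x : ℝ)‖ * ‖‖x‖⁻¹ • grad ζ x - (ζ x / ‖x‖ ^ 3) • x‖
        ≤ (‖p‖ * ‖x‖) * (2 * N * ‖x‖⁻¹) :=
          mul_le_mul (norm_inner_le_norm _ _) h2 (norm_nonneg _) (by positivity)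
      _ = 2 * N * ‖p‖ := by field_simp
  rw [e]
  refine (norm_add_le _ _).trans ?_
  linarith

namespace IsPotential

variable {C N : ℝ} {Φ : E3 → ℝ} {P : E3 → E3} {ζ : E3 → ℝ}

theorem nonneg (hΦ : IsPotential C Φ P) : 0 ≤ C := by
  obtain ⟨x⟩ := nonempty_Bdot
  have hx := norm_pos_of_Bdot x
  have h1 := hΦ.bound x x.2.2 (by have := mem_B.1 x.2.1; linarith)
  exact nonneg_of_mul_nonneg_left ((norm_nonneg _).trans h1) hx

theorem hasGradientWithinAt_comp (hΦ : IsPotential C Φ P) (h : IsSmall N ζ) (x : E3)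
    (hx : x ∈ Bdot 3) :
    HasGradientWithinAt ((B 3).indicator fun x => Φ (deform ζ x) - Φ 0)
      (pullGrad ζ P x) (B 3) x := by
  have h1 := hasGradientWithinAt_comp_deform hx.2 (h.memX.hasGradientWithinAt x hx)
    (hΦ.hasGradientAt _ (h.deform_ne_zero hx))
  have h2 : HasGradientWithinAt (fun x => Φ (deform ζ x) - Φ 0) (pullGrad ζ P x) (B 3) x :=
    HasFDerivWithinAt.sub_const (Φ 0) h1
  exact h2.congr (fun y hy => indicator_of_mem hy _) (indicator_of_mem hx.1 _)

theorem memY_comp (hΦ : IsPotential C Φ P) (h : IsSmall N ζ) :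
    MemY ((B 3).indicator fun x => Φ (deform ζ x) - Φ 0) := by
  have hN := h.nonneg
  have hC := hΦ.nonneg
  refine memY_of_gradient (p := pullGrad ζ P) (C := (1 + 3 * N) * (C * (1 + N))) ⟨?_, ?_, ?_⟩ ?_
    (hΦ.hasGradientWithinAt_comp h) ?_ ?_ ?_
  · exact fun x hx => indicator_of_notMem hx _
  · exact ((hΦ.continuous.comp_continuousOn h.continuousOn_deform).sub continuousOn_const).congr
      fun x hx => indicator_of_mem hx _
  · intro A hA x hx
    have h1 := h.memX.isCS.sInv A hA x
    have h2 := hΦ.sInv A hA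
    obtain ⟨e, he⟩ := exists_iso_of_mem_S hA
    rw [← he] at h1 ⊢
    have hex : e x ∈ B 3 := by rwa [mem_B, e.norm_map, ← mem_B]
    rw [indicator_of_mem hx, indicator_of_mem hex, deform_iso e h1, he, h2]
  · rw [indicator_of_mem (by rw [mem_B]; simp), deform_zero_right, sub_self]
  · have hg : ContinuousOn (deform ζ) (Bdot 3) := h.continuousOn_deform.mono sdiff_subset
    have hPg : ContinuousOn (fun x => P (deform ζ x)) (Bdot 3) :=
      hΦ.continuousOn.comp hg fun x hx => h.deform_ne_zero hx
    have hζc : ContinuousOn ζ (Bdot 3) := h.memX.isCS.continuousOn.mono sdiff_subset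
    have hgr := h.memX.continuousOn_grad
    have hn : ∀ x ∈ Bdot 3, ‖x‖ ≠ 0 := fun x hx => norm_ne_zero_iff.2 hx.2
    have hid : ContinuousOn (fun x : E3 => x) (Bdot 3) := continuousOn_id
    have c1 : ContinuousOn (fun x => 1 + ζ x / ‖x‖) (Bdot 3) :=
      continuousOn_const.add (hζc.div hid.norm hn)
    have c2 : ContinuousOn (fun x => (inner ℝ (P (deform ζ x)) x : ℝ)) (Bdot 3) :=
      ContinuousOn.inner (𝕜 := ℝ) hPg hid
    have c3 : ContinuousOn (fun x => ‖x‖⁻¹ • grad ζ x) (Bdot 3) := (hid.norm.inv₀ hn).smul hgr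
    have c4 : ContinuousOn (fun x => (ζ x / ‖x‖ ^ 3) • x) (Bdot 3) :=
      (hζc.div (hid.norm.pow 3) fun x hx => pow_ne_zero 3 (hn x hx)).smul hid
    exact (c1.smul hPg).add (c2.smul (c3.sub c4))
  · intro x hx
    have h1 := norm_pullGrad_sub_le h (P := P) hx
    have h2 := hΦ.bound _ (h.deform_ne_zero hx) (h.norm_deform_le_four hx.1)
    have h3 := h.norm_deform_le hx.1
    have h4 : ‖pullGrad ζ P x‖ ≤ (1 + 3 * N) * ‖P (deform ζ x)‖ := by
      have := norm_add_le (pullGrad ζ P x - P (deform ζ x)) (P (deform ζ x))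
      rw [sub_add_cancel] at this
      linarith
    calc ‖pullGrad ζ P x‖ ≤ (1 + 3 * N) * ‖P (deform ζ x)‖ := h4
      _ ≤ (1 + 3 * N) * (C * ((1 + N) * ‖x‖)) :=
          mul_le_mul_of_nonneg_left (h2.trans (mul_le_mul_of_nonneg_left h3 hC)) (by positivity)
      _ = _ := by ring
  · have l1 := h.memX.hasRadialLimit
    have l2 := h.memX.hasRadialLimit_div
    have lam : HasRadialLimit fun t x => 1 + ζ (t • x) / t :=
      l2.comp (Φ := fun z : ℝ => 1 + z) (by fun_prop)
    have lQ : HasRadialLimit fun t x =>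
        (t * (1 + ζ (t • x) / t))⁻¹ • P ((t * (1 + ζ (t • x) / t)) • x) := by
      refine hΦ.radialLimit.comp_radius (s := fun t x => t * (1 + ζ (t • x) / t)) fun ε hε => ?_
      filter_upwards [eventually_Ioc, eventually_Ioo (half_pos hε)] with t ht ht2 x hx
      have hm := smul_mem_Bdot ht hx
      have hn : ‖t • x‖ = t := by
        rw [norm_smul, norm_of_mem_S1 hx, mul_one, Real.norm_of_nonneg ht.1.le]
      have h1 := h.factor_pos hm.1
      have h2 := h.abs_div_le hm.1
      rw [hn] at h1 h2
      have h3 := h.le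
      refine ⟨mul_pos ht.1 h1, ?_⟩
      have h4 := (_root_.abs_le.1 h2).2
      nlinarith [ht.1, ht2.2]
    have l3 := (lam.smul lQ)
    have l4 := ((lam.smul (lQ.inner HasRadialLimit.id))).smul
      (l1.sub (l2.smul HasRadialLimit.id))
    refine (lam.smul l3 |>.add l4).congr ?_
    filter_upwards [eventually_Ioc] with t ht x hx
    have hm := smul_mem_Bdot ht hx
    have ht0 : t ≠ 0 := ht.1.ne'
    have hn : ‖t • x‖ = t := by
      rw [norm_smul, norm_of_mem_S1 hx, mul_one, Real.norm_of_nonneg ht.1.le]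
    have hl0 := (h.factor_pos hm.1).ne'
    rw [hn] at hl0
    have hdef : deform ζ (t • x) = (t * (1 + ζ (t • x) / t)) • x := by
      rw [deform_eq_smul, hn, smul_smul, mul_comm]
    rw [pullGrad, hdef, hn]
    set l := 1 + ζ (t • x) / t with hl
    set p := P ((t * l) • x)
    rw [real_inner_smul_right, real_inner_smul_left, smul_eq_mul]
    have e1 : ζ (t • x) / t = l - 1 := by rw [hl]; ring
    have e2 : ζ (t • x) / t ^ 3 = (l - 1) / t ^ 2 := by rw [← e1]; field_simp
    rw [e1, e2]
    simp only [smul_add, smul_sub, smul_smul]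
    match_scalars <;> field_simp

end IsPotential

/-! ### The linearized operator as an isomorphism of `X` onto `Y` -/

/-- The potential of a density of linear growth belongs to `Y` up to a constant. -/
theorem IsLinSource.isPotential {A : ℝ} {f : E3 → ℝ} (hf : IsLinSource A f) (hS : SInv f) :
    IsPotential (4 * A * CJ) (newton f) (field f) where
  hasGradientAt y _ := hf.isSource.hasGradientAt y
  continuous := hf.isSource.continuous_newton
  continuousOn := hf.isSource.continuous_field.continuousOn
  bound y _ _ := hf.norm_field_le y
  radialLimit := by
    refine ⟨fieldDeriv f, ⟨8 * A * CJ, fun x hx => ?_⟩, ?_⟩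
    · have := (hf.integrable_fieldDeriv x).2
      rwa [norm_of_mem_S1 hx, mul_one] at this
    rw [Metric.tendstoUniformlyOn_iff]
    intro ε hε
    have hlim : Tendsto (fun t : ℝ => 128 * A * CJ * √t) (𝓝[>] 0) (𝓝 0) := by
      have : Continuous fun t : ℝ => 128 * A * CJ * √t := by fun_prop
      simpa using (this.tendsto 0).mono_left nhdsWithin_le_nhds
    filter_upwards [hlim (Iio_mem_nhds hε), eventually_Ioc] with t ht1 ht x hx
    have hn : ‖t • x‖ = t := by
      rw [norm_smul, norm_of_mem_S1 hx, mul_one, Real.norm_of_nonneg ht.1.le]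
    have h1 := hf.norm_field_sub_fieldDeriv_le (t • x)
    rw [hn, fieldDeriv_smul] at h1
    have e : t⁻¹ • field f (t • x) - fieldDeriv f x =
        t⁻¹ • (field f (t • x) - t • fieldDeriv f x) := by
      rw [smul_sub, smul_smul, inv_mul_cancel₀ ht.1.ne', one_smul]
    rw [dist_comm, dist_eq_norm, e, norm_smul, norm_inv, Real.norm_of_nonneg ht.1.le]
    refine lt_of_le_of_lt ?_ ht1
    rw [inv_mul_le_iff₀ ht.1, mul_comm t]
    exact h1
  sInv := hS.newton

/-- The gradient of the radial function `V(|x|)`. -/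
def radGrad (V : ℝ → ℝ) (x : E3) : E3 := (deriv V ‖x‖ / ‖x‖) • x

theorem norm_radGrad (V : ℝ → ℝ) {x : E3} (hx : x ≠ 0) : ‖radGrad V x‖ = |deriv V ‖x‖| := by
  have := norm_pos_iff.2 hx
  rw [radGrad, norm_smul, Real.norm_eq_abs, abs_div, abs_norm]
  field_simp

theorem hasGradientWithinAt_radial_mul {f : E3 → ℝ} {p x : E3} {a : ℝ → ℝ} {a' : ℝ} (hx : x ≠ 0)
    (hf : HasGradientWithinAt f p (B 3) x) (ha : HasDerivAt a a' ‖x‖) :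
    HasGradientWithinAt (fun x => a ‖x‖ * f x) (a ‖x‖ • p + (a' * f x / ‖x‖) • x) (B 3) x := by
  have h1 := (hasGradientAt_radial hx ha).hasFDerivAt.hasFDerivWithinAt (s := B 3)
  have h2 := h1.mul hf.hasFDerivWithinAt
  rw [hasGradientWithinAt_iff_hasFDerivWithinAt]
  refine h2.congr_fderiv ?_
  rw [map_add, map_smul, map_smul, map_smul, smul_smul]
  congr 2
  ring

/-- Multiplication of `ζ` by the radial derivative of the potential. -/
def radMul (V : ℝ → ℝ) (ζ : E3 → ℝ) (x : E3) : ℝ := deriv V ‖x‖ * ζ x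

/-- The derivative of `T(0, ·)` at zero, `ζ ↦ K(V'ζ) - V'ζ` with the compact operator `K` of
`linPot`. -/
def linOp (R V : ℝ → ℝ) (ζ : E3 → ℝ) : E3 → ℝ :=
  (B 3).indicator (linPot R V (radMul V ζ)) - radMul V ζ

namespace RadialProfiles

variable {ρ₀ U₀ : E3 → ℝ} {R V : ℝ → ℝ} {C : ℝ}

theorem continuous_deriv2_V (hP : RadialProfiles ρ₀ U₀ R V C) : Continuous (deriv (deriv V)) :=
  hP.contDiff_deriv_V.continuous_deriv le_rfl

theorem tendsto_deriv_V_div (hP : RadialProfiles ρ₀ U₀ R V C) :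
    Tendsto (fun t => deriv V t / t) (𝓝[>] 0) (𝓝 (deriv (deriv V) 0)) := by
  have := (hP.hasDerivAt_deriv_V 0).tendsto_slope_zero_right
  refine this.congr fun t => ?_
  rw [zero_add, hP.deriv_V_zero, sub_zero, smul_eq_mul, inv_mul_eq_div]

theorem exists_profile_bounds (hP : RadialProfiles ρ₀ U₀ R V C) :
    ∃ c c' D : ℝ, 0 < c ∧ 0 < c' ∧ 0 ≤ D ∧
      (∀ r, 0 < r → r ≤ 4 → c * r ≤ deriv V r ∧ deriv V r ≤ c' * r) ∧
      ∀ r, 0 ≤ r → r ≤ 4 → |deriv (deriv V) r| ≤ D := by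
  obtain ⟨c, c', hc, hc', h⟩ := hP.exists_bounds 4
  obtain ⟨D, hD⟩ := (isCompact_Icc (a := (0 : ℝ)) (b := 4)).exists_bound_of_continuousOn
    hP.continuous_deriv2_V.continuousOn
  exact ⟨c, c', D, hc, hc', (norm_nonneg _).trans (hD 0 (by norm_num)), h,
    fun r h1 h2 => hD r ⟨h1, h2⟩⟩

/-- The potential of the steady state belongs to `Y` up to a constant. -/
theorem exists_isPotential (hP : RadialProfiles ρ₀ U₀ R V C) :
    ∃ c', IsPotential c' U₀ (radGrad V) := by
  obtain ⟨c, c', D, hc, hc', hD, hV, hVD⟩ := hP.exists_profile_bounds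
  have hU : U₀ = fun x => V ‖x‖ := funext hP.potential_eq
  refine ⟨c', fun y hy => ?_, hP.contDiff_potential.continuous, ?_, fun y hy hy4 => ?_, ?_, ?_⟩
  · rw [hU]; exact hasGradientAt_radial hy (hP.hasDerivAt_V _)
  · have hV' := hP.contDiff_deriv_V.continuous
    unfold radGrad
    exact (((hV'.comp continuous_norm).continuousOn).div continuous_norm.continuousOn
      fun x hx => norm_ne_zero_iff.2 hx).smul continuousOn_id
  · have hr := norm_pos_iff.2 hy
    rw [norm_radGrad V hy, abs_of_pos (hP.deriv_V_pos _ hr)]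
    exact (hV _ hr hy4).2
  · refine ((HasRadialLimit.of_tendsto hP.tendsto_deriv_V_div).smul HasRadialLimit.id).congr ?_
    filter_upwards [eventually_Ioc] with t ht x hx
    have hn : ‖t • x‖ = t := by
      rw [norm_smul, norm_of_mem_S1 hx, mul_one, Real.norm_of_nonneg ht.1.le]
    have := ht.1.ne'
    rw [radGrad, hn, smul_smul, smul_smul]
    congr 1
    field_simp
  · exact Radial.sInv fun x y hxy => by rw [hP.potential_eq, hP.potential_eq, hxy]

theorem hasGradientWithinAt_radMul (hP : RadialProfiles ρ₀ U₀ R V C) {ζ : E3 → ℝ} (hζ : MemX ζ)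
    (x : E3) (hx : x ∈ Bdot 3) : HasGradientWithinAt (radMul V ζ)
      (deriv V ‖x‖ • grad ζ x + (deriv (deriv V) ‖x‖ * ζ x / ‖x‖) • x) (B 3) x :=
  hasGradientWithinAt_radial_mul hx.2 (hζ.hasGradientWithinAt x hx) (hP.hasDerivAt_deriv_V _)

theorem isCS_radMul (hP : RadialProfiles ρ₀ U₀ R V C) {ζ : E3 → ℝ} (hζ : IsCS 3 ζ) :
    IsCS 3 (radMul V ζ) where
  zero_outside x hx := by rw [radMul, hζ.zero_outside x hx, mul_zero]
  continuousOn := (hP.contDiff_deriv_V.continuous.comp continuous_norm).continuousOn.mul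
    hζ.continuousOn
  symm A hA x hx := by
    have h1 := hζ.symm A hA x hx
    obtain ⟨e, he⟩ := exists_iso_of_mem_S hA
    rw [radMul, radMul, h1, ← he, e.norm_map]

theorem continuousOn_deriv_norm_div (hP : RadialProfiles ρ₀ U₀ R V C) :
    ContinuousOn (fun x : E3 => deriv (deriv V) ‖x‖ / ‖x‖) (Bdot 3) :=
  (hP.continuous_deriv2_V.comp continuous_norm).continuousOn.div continuous_norm.continuousOn
    fun _ hx => norm_ne_zero_iff.2 hx.2

/-- Since `V'(r)` is comparable to `r`, multiplication by it maps `X` to `Y`, boundedly. -/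
theorem exists_radMul_bound (hP : RadialProfiles ρ₀ U₀ R V C) :
    ∃ K : ℝ, 0 ≤ K ∧ ∀ (ζ : E3 → ℝ) (N : ℝ), MemX ζ → 0 ≤ N → (∀ x ∈ Bdot 3, ‖grad ζ x‖ ≤ N) →
      MemY (radMul V ζ) ∧ (∀ x ∈ Bdot 3, ‖grad (radMul V ζ) x‖ ≤ K * N * ‖x‖) ∧
      ∀ x ∈ B 1, |radMul V ζ x| ≤ K * N * ‖x‖ := by
  obtain ⟨c, c', D, hc, hc', hD, hV, hVD⟩ := hP.exists_profile_bounds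
  refine ⟨c' + D, by positivity, fun ζ N hζ hN0 hN => ?_⟩
  have hbd : ∀ x ∈ Bdot 3, ‖deriv V ‖x‖ • grad ζ x +
      (deriv (deriv V) ‖x‖ * ζ x / ‖x‖) • x‖ ≤ (c' + D) * N * ‖x‖ := by
    intro x hx
    have hx3 := mem_B.1 hx.1
    have hr := norm_pos_iff.2 hx.2
    refine (norm_add_le _ _).trans ?_
    rw [norm_smul, norm_smul, Real.norm_of_nonneg (hP.deriv_V_pos _ hr).le, Real.norm_eq_abs,
      abs_div, abs_mul, abs_norm, div_mul_cancel₀ _ hr.ne']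
    have h1 : deriv V ‖x‖ * ‖grad ζ x‖ ≤ (c' * ‖x‖) * N :=
      mul_le_mul (hV _ hr (by linarith)).2 (hN x hx) (norm_nonneg _) (by positivity)
    have h2 : |deriv (deriv V) ‖x‖| * |ζ x| ≤ D * (N * ‖x‖) :=
      mul_le_mul (hVD _ hr.le (by linarith)) (hζ.abs_le hN hx.1) (abs_nonneg _) hD
    linarith
  refine ⟨memY_of_gradient (hP.isCS_radMul hζ.isCS) ?_ (hP.hasGradientWithinAt_radMul hζ) ?_ hbd ?_,
    fun x hx => ?_, fun x hx => ?_⟩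
  · rw [radMul, hζ.map_zero, mul_zero]
  · have h1 : ContinuousOn (fun x : E3 => deriv V ‖x‖) (Bdot 3) :=
      (hP.contDiff_deriv_V.continuous.comp continuous_norm).continuousOn
    have h2 : ContinuousOn ζ (Bdot 3) := hζ.isCS.continuousOn.mono sdiff_subset
    have h3 := ((hP.continuousOn_deriv_norm_div).mul h2).smul continuousOn_id
    refine (h1.smul hζ.continuousOn_grad).add (h3.congr fun x _ => ?_)
    change _ = (deriv (deriv V) ‖x‖ / ‖x‖ * ζ x) • x
    rw [div_mul_eq_mul_div]
  · have l1 := (HasRadialLimit.of_tendsto hP.tendsto_deriv_V_div).smul hζ.hasRadialLimit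
    have l2 : HasRadialLimit fun (t : ℝ) (_ : E3) => deriv (deriv V) t :=
      HasRadialLimit.of_tendsto ((hP.continuous_deriv2_V.tendsto 0).mono_left nhdsWithin_le_nhds)
    have l3 := (l2.smul hζ.hasRadialLimit_div).smul HasRadialLimit.id
    refine (l1.add l3).congr ?_
    filter_upwards [eventually_Ioc] with t ht x hx
    have hn : ‖t • x‖ = t := by
      rw [norm_smul, norm_of_mem_S1 hx, mul_one, Real.norm_of_nonneg ht.1.le]
    have := ht.1.ne'
    rw [hn, smul_eq_mul, smul_add, smul_smul, smul_smul, smul_smul]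
    match_scalars <;> field_simp
  · rw [grad_eq hx.1 (hP.hasGradientWithinAt_radMul hζ x hx)]
    exact hbd x hx
  · rw [mem_B] at hx
    have hx3 : x ∈ B 3 := by rw [mem_B]; linarith
    rcases eq_or_ne x 0 with rfl | hx0
    · rw [radMul, hζ.map_zero, mul_zero, abs_zero, norm_zero, mul_zero]
    have hr := norm_pos_iff.2 hx0
    rw [radMul, abs_mul, abs_of_pos (hP.deriv_V_pos _ hr)]
    calc deriv V ‖x‖ * |ζ x| ≤ (c' * ‖x‖) * (N * ‖x‖) :=
          mul_le_mul (hV _ hr (by linarith)).2 (hζ.abs_le hN hx3) (abs_nonneg _) (by positivity)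
      _ = (c' * N * ‖x‖) * ‖x‖ := by ring
      _ ≤ (c' * N * ‖x‖) * 1 := mul_le_mul_of_nonneg_left hx (by positivity)
      _ ≤ (c' + D) * N * ‖x‖ := by
          have : 0 ≤ D * N * ‖x‖ := by positivity
          linarith

/-- Division by `V'(|x|)` maps `Y` to `X`, boundedly. -/
theorem exists_radMul_eq (hP : RadialProfiles ρ₀ U₀ R V C) :
    ∃ K : ℝ, 0 ≤ K ∧ ∀ (w : E3 → ℝ) (N : ℝ), MemY w → 0 ≤ N →
      (∀ x ∈ Bdot 3, ‖grad w x‖ ≤ N * ‖x‖) →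
      ∃ ζ, MemX ζ ∧ radMul V ζ = w ∧ ∀ x ∈ Bdot 3, ‖grad ζ x‖ ≤ K * N := by
  obtain ⟨c, c', D, hc, hc', hD, hV, hVD⟩ := hP.exists_profile_bounds
  refine ⟨1 / c + D / c ^ 2, by positivity, fun w N hw hN0 hN => ?_⟩
  set ζ : E3 → ℝ := fun x => (deriv V ‖x‖)⁻¹ * w x with hζ
  set p : E3 → E3 := fun x => (deriv V ‖x‖)⁻¹ • grad w x +
    (-deriv (deriv V) ‖x‖ / deriv V ‖x‖ ^ 2 * w x / ‖x‖) • x with hp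
  have hVpos : ∀ x : E3, x ≠ 0 → 0 < deriv V ‖x‖ := fun x hx =>
    hP.deriv_V_pos _ (norm_pos_iff.2 hx)
  have hd : ∀ x ∈ Bdot 3, HasGradientWithinAt ζ (p x) (B 3) x := fun x hx =>
    hasGradientWithinAt_radial_mul (a := fun r => (deriv V r)⁻¹) hx.2
      (hw.hasGradientWithinAt x hx) ((hP.hasDerivAt_deriv_V _).inv (hVpos x hx.2).ne')
  have hζb : ∀ x ∈ B 3, |ζ x| ≤ N / c * ‖x‖ := by
    intro x hx
    rcases eq_or_ne x 0 with rfl | hx0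
    · simp [hζ, hw.map_zero]
    have hr := norm_pos_iff.2 hx0
    have hx3 := mem_B.1 hx
    rw [hζ, abs_mul, abs_inv, abs_of_pos (hVpos x hx0), inv_mul_le_iff₀ (hVpos x hx0)]
    refine (hw.abs_le hN hx).trans ?_
    calc N * ‖x‖ ^ 2 = (c * ‖x‖) * (N / c * ‖x‖) := by field_simp
      _ ≤ _ := mul_le_mul_of_nonneg_right (hV _ hr (by linarith)).1 (by positivity)
  have hVc : Continuous fun x : E3 => deriv V ‖x‖ :=
    hP.contDiff_deriv_V.continuous.comp continuous_norm
  have hbd : ∀ x ∈ Bdot 3, ‖p x‖ ≤ (1 / c + D / c ^ 2) * N := by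
    intro x hx
    have hr := norm_pos_iff.2 hx.2
    have hx3 := mem_B.1 hx.1
    have hV1 := hVpos x hx.2
    have hVl := (hV _ hr (by linarith)).1
    refine (norm_add_le _ _).trans ?_
    have h1 : ‖(deriv V ‖x‖)⁻¹ • grad w x‖ ≤ 1 / c * N := by
      rw [norm_smul, norm_inv, Real.norm_of_nonneg hV1.le, inv_mul_le_iff₀ hV1]
      refine (hN x hx).trans ?_
      calc N * ‖x‖ = (c * ‖x‖) * (1 / c * N) := by field_simp
        _ ≤ _ := mul_le_mul_of_nonneg_right hVl (by positivity)
    have h2 : ‖(-deriv (deriv V) ‖x‖ / deriv V ‖x‖ ^ 2 * w x / ‖x‖) • x‖ ≤ D / c ^ 2 * N := by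
      rw [norm_smul, Real.norm_eq_abs, abs_div, abs_mul, abs_norm, div_mul_cancel₀ _ hr.ne',
        abs_div, abs_neg, abs_pow, abs_of_pos hV1, div_mul_eq_mul_div,
        div_le_iff₀ (by positivity)]
      calc |deriv (deriv V) ‖x‖| * |w x| ≤ D * (N * ‖x‖ ^ 2) :=
            mul_le_mul (hVD _ hr.le (by linarith)) (hw.abs_le hN hx.1) (abs_nonneg _) hD
        _ = D / c ^ 2 * N * (c * ‖x‖) ^ 2 := by field_simp
        _ ≤ _ := mul_le_mul_of_nonneg_left
            (pow_le_pow_left₀ (by positivity) hVl 2) (by positivity)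
    linarith
  have hcs : IsCS 3 ζ := by
    refine ⟨fun x hx => by rw [hζ]; simp [hw.isCS.zero_outside x hx], fun x hx => ?_,
      fun A hA x hx => ?_⟩
    · rcases eq_or_ne x 0 with rfl | hx0
      · have h0 : ζ 0 = 0 := by simp [hζ, hw.map_zero]
        rw [ContinuousWithinAt, h0, tendsto_zero_iff_norm_tendsto_zero]
        refine squeeze_zero' (.of_forall fun _ => norm_nonneg _)
          (g := fun x : E3 => N / c * ‖x‖) ?_ ?_
        · filter_upwards [self_mem_nhdsWithin] with x' hx' using hζb x' hx'
        · have : Continuous fun x : E3 => N / c * ‖x‖ := by fun_prop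
          have h := this.tendsto 0
          simp only [norm_zero, mul_zero] at h
          exact h.mono_left nhdsWithin_le_nhds
      · exact (hVc.continuousWithinAt.inv₀ (hVpos x hx0).ne').mul (hw.isCS.continuousOn x hx)
    · have h1 := hw.isCS.symm A hA x hx
      obtain ⟨e, he⟩ := exists_iso_of_mem_S hA
      rw [hζ]
      simp only
      rw [h1, ← he, e.norm_map]
  refine ⟨ζ, memX_of_gradient hcs (by simp [hζ, hw.map_zero]) hd ?_ hbd ?_, ?_, ?_⟩
  · have hVi : ContinuousOn (fun x : E3 => (deriv V ‖x‖)⁻¹) (Bdot 3) :=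
      hVc.continuousOn.inv₀ fun x hx => (hVpos x hx.2).ne'
    have h1 : ContinuousOn (fun x => (deriv V ‖x‖)⁻¹ • grad w x) (Bdot 3) :=
      hVi.smul (hw.continuousOn_grad.mono sdiff_subset)
    have h2 : ContinuousOn (fun x : E3 => (deriv (deriv V) ‖x‖ / ‖x‖ * (deriv V ‖x‖)⁻¹ ^ 2 *
        w x) • x) (Bdot 3) :=
      (((hP.continuousOn_deriv_norm_div).mul (hVi.pow 2)).mul
        (hw.isCS.continuousOn.mono sdiff_subset)).smul continuousOn_id
    refine (h1.sub h2).congr fun x _ => ?_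
    simp only [hp, Pi.sub_apply]
    rw [sub_eq_add_neg, ← neg_smul]
    congr 2
    ring
  · have l0 : HasRadialLimit fun (t : ℝ) (_ : E3) => (deriv V t / t)⁻¹ :=
      HasRadialLimit.of_tendsto (hP.tendsto_deriv_V_div.inv₀ hP.deriv2_V_zero_pos.ne')
    have l1 := l0.smul hw.hasRadialLimit
    have l2 : HasRadialLimit fun (t : ℝ) (_ : E3) => deriv (deriv V) t :=
      HasRadialLimit.of_tendsto ((hP.continuous_deriv2_V.tendsto 0).mono_left nhdsWithin_le_nhds)
    have l3 := (l2.smul ((l0.smul l0).smul hw.hasRadialLimit_div)).smul HasRadialLimit.id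
    refine (l1.sub l3).congr ?_
    filter_upwards [eventually_Ioc] with t ht x hx
    have hn : ‖t • x‖ = t := by
      rw [norm_smul, norm_of_mem_S1 hx, mul_one, Real.norm_of_nonneg ht.1.le]
    have ht0 := ht.1.ne'
    have hV0 := (hP.deriv_V_pos t ht.1).ne'
    simp only [hp, hn, smul_eq_mul, smul_smul]
    match_scalars <;> field_simp
  · funext x
    rcases eq_or_ne x 0 with rfl | hx0
    · simp [radMul, hζ, hw.map_zero]
    · rw [radMul, hζ]
      exact mul_inv_cancel_left₀ (hVpos x hx0).ne' _
  · intro x hx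
    rw [grad_eq hx.1 (hd x hx)]
    exact hbd x hx

theorem isLinSource_mul (hP : RadialProfiles ρ₀ U₀ R V C) {w : E3 → ℝ} {A : ℝ} (hA : 0 ≤ A)
    (hw : IsCS 3 w) (hb : ∀ x ∈ B 1, |w x| ≤ A * ‖x‖) :
    IsLinSource (C * A) (linCoeff R V * w) where
  meas := (hP.measurable_linCoeff.mul hw.measurable).aestronglyMeasurable
  bound y := by
    rw [Pi.mul_apply, abs_mul, abs_of_nonneg (hP.linCoeff_nonneg y), mul_assoc]
    by_cases hy : y ∈ B 1
    · exact mul_le_mul (hP.linCoeff_le y) (hb y hy) (abs_nonneg _) hP.C_nonneg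
    · rw [mem_B, not_le] at hy
      rw [hP.linCoeff_zero hy, zero_mul]
      have := hP.C_nonneg
      positivity
  zero y hy := by
    rw [mem_B, not_le] at hy
    rw [Pi.mul_apply, hP.linCoeff_zero (by linarith), zero_mul]
  even y := ((linCoeff_radial R V).sInv.mul hw.sInv).even y

theorem memY_linPot (hP : RadialProfiles ρ₀ U₀ R V C) {w : E3 → ℝ} {A : ℝ} (hA : 0 ≤ A)
    (hw : IsCS 3 w) (hb : ∀ x ∈ B 1, |w x| ≤ A * ‖x‖) :
    MemY ((B 3).indicator (linPot R V w)) ∧ ∀ x ∈ Bdot 3,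
      HasGradientWithinAt ((B 3).indicator (linPot R V w))
        (field (linCoeff R V * w) x) (B 3) x := by
  have hpot := (hP.isLinSource_mul hA hw hb).isPotential
    ((linCoeff_radial R V).sInv.mul hw.sInv)
  have h0 := isSmall_zero
  have h1 := hpot.memY_comp h0
  have h2 := hpot.hasGradientWithinAt_comp h0
  have e : (fun x => newton (linCoeff R V * w) (deform 0 x) - newton (linCoeff R V * w) 0) =
      linPot R V w := by
    funext x
    rw [deform_zero_left, linPot]
  rw [e] at h1 h2
  refine ⟨h1, fun x hx => ?_⟩
  have := h2 x hx
  rwa [pullGrad, grad_zero, deform_zero_left, Pi.zero_apply, zero_div, add_zero, one_smul,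
    zero_div, zero_smul, smul_zero, sub_zero, smul_zero, add_zero] at this

theorem memY_linOp (hP : RadialProfiles ρ₀ U₀ R V C) {ζ : E3 → ℝ} (hζ : MemX ζ) :
    MemY (linOp R V ζ) := by
  obtain ⟨K, hK, h⟩ := hP.exists_radMul_bound
  obtain ⟨N, hN⟩ := hζ.grad_bound
  have hN0 : 0 ≤ N := by
    obtain ⟨x⟩ := nonempty_Bdot
    exact (norm_nonneg _).trans (hN x x.2)
  obtain ⟨h1, -, h3⟩ := h ζ N hζ hN0 hN
  exact YSub.sub_mem (hP.memY_linPot (by positivity) h1.isCS h3).1 h1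

/-- `linOp` as a linear map between `X` and `Y`. -/
def linOpMap (hP : RadialProfiles ρ₀ U₀ R V C) : X →ₗ[ℝ] Y where
  toFun ζ := ⟨linOp R V ζ, hP.memY_linOp ζ.2⟩
  map_add' ζ η := by
    refine Subtype.ext (funext fun x => ?_)
    change linOp R V (ζ + η : X) x = linOp R V ζ x + linOp R V η x
    obtain ⟨K, hK, h⟩ := hP.exists_radMul_bound
    obtain ⟨h1, -, h3⟩ := h ζ _ ζ.2 (norm_nonneg ζ) (norm_grad_le_X ζ)
    obtain ⟨k1, -, k3⟩ := h η _ η.2 (norm_nonneg η) (norm_grad_le_X η)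
    have b : ∀ {a r : ℝ}, 0 ≤ a → r ≤ 1 → a * r ≤ a := fun ha hr => mul_le_of_le_one_right ha hr
    have e : radMul V (ζ + η : X) = radMul V ζ + radMul V η :=
      funext fun x => mul_add _ _ _
    have e2 := hP.linPot_add h1.isCS.measurable (M := K * ‖ζ‖) (by positivity)
      (fun x hx => (h3 x hx).trans (b (by positivity) (mem_B.1 hx)))
      k1.isCS.measurable (M' := K * ‖η‖) (by positivity)
      (fun x hx => (k3 x hx).trans (b (by positivity) (mem_B.1 hx)))
    rw [linOp, linOp, linOp, e, Pi.sub_apply, Pi.sub_apply, Pi.sub_apply, Pi.add_apply]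
    by_cases hx : x ∈ B 3
    · rw [indicator_of_mem hx, indicator_of_mem hx, indicator_of_mem hx, e2]; ring
    · rw [indicator_of_notMem hx, indicator_of_notMem hx, indicator_of_notMem hx]; ring
  map_smul' c ζ := by
    refine Subtype.ext (funext fun x => ?_)
    change linOp R V (c • ζ : X) x = c * linOp R V ζ x
    have e : radMul V (c • ζ : X) = c • radMul V ζ := funext fun x => mul_left_comm _ _ _
    rw [linOp, linOp, e, Pi.sub_apply, Pi.sub_apply, Pi.smul_apply, smul_eq_mul]
    by_cases hx : x ∈ B 3
    · rw [indicator_of_mem hx, indicator_of_mem hx, linPot_smul]; ring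
    · rw [indicator_of_notMem hx, indicator_of_notMem hx]; ring

theorem hasGradientWithinAt_linOp (hP : RadialProfiles ρ₀ U₀ R V C) {ζ : E3 → ℝ} (hζ : MemX ζ)
    (x : E3) (hx : x ∈ Bdot 3) : HasGradientWithinAt (linOp R V ζ)
      (field (linCoeff R V * radMul V ζ) x -
        (deriv V ‖x‖ • grad ζ x + (deriv (deriv V) ‖x‖ * ζ x / ‖x‖) • x)) (B 3) x := by
  obtain ⟨K, hK, h⟩ := hP.exists_radMul_bound
  obtain ⟨N, hN⟩ := hζ.grad_bound
  have hN0 : 0 ≤ N := (norm_nonneg _).trans (hN x hx)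
  obtain ⟨h1, -, h3⟩ := h ζ N hζ hN0 hN
  have h4 := (hP.memY_linPot (by positivity) h1.isCS h3).2 x hx
  rw [hasGradientWithinAt_iff_hasFDerivWithinAt, map_sub]
  exact h4.hasFDerivWithinAt.sub (hP.hasGradientWithinAt_radMul hζ x hx).hasFDerivWithinAt

theorem exists_linOp_bound (hP : RadialProfiles ρ₀ U₀ R V C) :
    ∃ K : ℝ, ∀ ζ : X, ‖hP.linOpMap ζ‖ ≤ K * ‖ζ‖ := by
  obtain ⟨K, hK, h⟩ := hP.exists_radMul_bound
  refine ⟨4 * (C * K) * CJ + K, fun ζ => norm_Y_le fun x hx => ?_⟩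
  obtain ⟨h1, h2, h3⟩ := h ζ _ ζ.2 (norm_nonneg ζ) (norm_grad_le_X ζ)
  have h4 := hP.hasGradientWithinAt_linOp ζ.2 x hx
  have h5 := h2 x hx
  rw [grad_eq hx.1 (hP.hasGradientWithinAt_radMul ζ.2 x hx)] at h5
  have h6 := (hP.isLinSource_mul (A := K * ‖ζ‖) (by positivity) h1.isCS h3).norm_field_le x
  have h7 : grad (hP.linOpMap ζ) x = _ := grad_eq hx.1 h4
  rw [h7]
  refine (norm_sub_le _ _).trans ((add_le_add h6 h5).trans_eq ?_)
  ring

theorem linOpMap_injective (hP : RadialProfiles ρ₀ U₀ R V C) :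
    Function.Injective hP.linOpMap := by
  rw [← LinearMap.ker_eq_bot, LinearMap.ker_eq_bot']
  intro ζ hζ
  have h0 : linOp R V ζ = 0 := congrArg Subtype.val hζ
  have hw : radMul V ζ = 0 := by
    refine hP.eq_zero_of_isCS (hP.isCS_radMul ζ.2.isCS) fun x hx => ?_
    have := congrFun h0 x
    rw [linOp, Pi.sub_apply, indicator_of_mem hx, Pi.zero_apply, sub_eq_zero] at this
    exact this.symm
  refine Subtype.ext (funext fun x => ?_)
  rcases eq_or_ne x 0 with rfl | hx0
  · exact ζ.2.map_zero
  · exact (mul_eq_zero.1 (congrFun hw x)).resolve_left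
      (hP.deriv_V_pos _ (norm_pos_iff.2 hx0)).ne'

/-- Surjectivity with a bound. The equation for `w = V'ζ` has a continuous solution by the Fredholm
alternative. The right side of `w = -f + linPot w` is first seen to grow linearly at the origin;
then the potential of `q w` is of class `Y`, and so is `w`. -/
theorem exists_preimage (hP : RadialProfiles ρ₀ U₀ R V C) :
    ∃ K : ℝ, ∀ f : Y, ∃ ζ : X, hP.linOpMap ζ = f ∧ ‖ζ‖ ≤ K * ‖f‖ := by
  obtain ⟨Λ, hΛ, hsol⟩ := hP.exists_solution
  obtain ⟨K, hK, hmul⟩ := hP.exists_radMul_eq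
  have hC := hP.C_nonneg
  have hCJ := CJ_nonneg
  set A := 1 + 2 * (C * (Λ * 9)) * CJ with hA
  refine ⟨K * (1 + 4 * (C * A) * CJ), fun f => ?_⟩
  have hfn := norm_nonneg f
  have hfsq : ∀ x ∈ B 3, |f x| ≤ ‖f‖ * ‖x‖ ^ 2 := fun x hx => f.2.abs_le (norm_grad_le_Y f) hx
  have hneg : MemY (-f : Y) := (-f : Y).2
  obtain ⟨w, hw, hweq, hwb⟩ := hsol (-f : Y) (9 * ‖f‖) hneg.isCS fun x hx => by
    change |-f x| ≤ _
    rw [abs_neg]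
    refine (hfsq x hx).trans ?_
    rw [mem_B] at hx
    have : ‖x‖ ^ 2 ≤ 9 := by nlinarith [norm_nonneg x]
    nlinarith
  have hwlin : ∀ x ∈ B 1, |w x| ≤ (A * ‖f‖) * ‖x‖ := by
    intro x hx
    rw [mem_B] at hx
    have hx3 : x ∈ B 3 := by rw [mem_B]; linarith
    rw [hweq x hx3]
    refine (abs_add_le _ _).trans ?_
    have h1 : |(-f : Y) x| ≤ ‖f‖ * ‖x‖ := by
      change |-f x| ≤ _
      rw [abs_neg]
      refine (hfsq x hx3).trans (mul_le_mul_of_nonneg_left ?_ hfn)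
      nlinarith [norm_nonneg x]
    have h2 := hP.abs_linPot_le hw.measurable (M := Λ * (9 * ‖f‖)) (by positivity)
      (fun x _ => hwb x) x
    refine (add_le_add h1 h2).trans_eq ?_
    rw [hA]; ring
  obtain ⟨k1, k2⟩ := hP.memY_linPot (A := A * ‖f‖) (by positivity) hw hwlin
  have hweq' : w = (-f : Y).1 + (B 3).indicator (linPot R V w) := by
    funext x
    by_cases hx : x ∈ B 3
    · rw [Pi.add_apply, indicator_of_mem hx]; exact hweq x hx
    · rw [Pi.add_apply, indicator_of_notMem hx, hw.zero_outside x hx,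
        hneg.isCS.zero_outside x hx, add_zero]
  have hwY : MemY w := by rw [hweq']; exact YSub.add_mem (-f : Y).2 k1
  have hgrad : ∀ x ∈ Bdot 3, ‖grad w x‖ ≤ ((1 + 4 * (C * A) * CJ) * ‖f‖) * ‖x‖ := by
    intro x hx
    have h1 : grad w x = grad (-f : Y) x + field (linCoeff R V * w) x := by
      conv_lhs => rw [hweq']
      rw [grad_add hx.1 (hneg.diff hx.1) (k1.diff hx.1), grad_eq hx.1 (k2 x hx)]
    have h2 := norm_grad_le_Y (-f) x hx
    rw [norm_neg] at h2
    have h3 := (hP.isLinSource_mul (A := A * ‖f‖) (by positivity) hw hwlin).norm_field_le x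
    rw [h1]
    refine (norm_add_le _ _).trans ((add_le_add h2 h3).trans_eq ?_)
    ring
  obtain ⟨ζ, hζ, hζw, hζb⟩ := hmul w _ hwY (by positivity) hgrad
  refine ⟨⟨ζ, hζ⟩, Subtype.ext ?_, ?_⟩
  · change linOp R V ζ = f.1
    rw [linOp, hζw]
    conv_lhs => rw [sub_eq_add_neg, add_comm]; arg 1; rw [hweq']
    change -(-f.1 + _) + _ = f.1
    abel
  · refine (norm_X_le (ζ := ⟨ζ, hζ⟩) hζb).trans_eq ?_
    ring

/-- `linOp` as an isomorphism of `X` onto `Y`. -/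
theorem exists_linEquiv (hP : RadialProfiles ρ₀ U₀ R V C) :
    ∃ L : X ≃L[ℝ] Y, ∀ ζ, L ζ = hP.linOpMap ζ := by
  obtain ⟨K, hK⟩ := hP.exists_linOp_bound
  obtain ⟨K', hK'⟩ := hP.exists_preimage
  have hsurj : Function.Surjective hP.linOpMap := fun f => by
    obtain ⟨ζ, hζ, -⟩ := hK' f
    exact ⟨ζ, hζ⟩
  set e := LinearEquiv.ofBijective hP.linOpMap ⟨hP.linOpMap_injective, hsurj⟩ with he
  refine ⟨e.toContinuousLinearEquivOfBounds K K' hK fun f => ?_, fun ζ => rfl⟩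
  obtain ⟨ζ, hζ, hb⟩ := hK' f
  have : e.symm f = ζ := by rw [LinearEquiv.symm_apply_eq]; exact hζ.symm
  rwa [this]

end RadialProfiles

/-! ### The map `T(0, ·)` near the steady state -/

/-- First order Taylor expansion with a remainder that is uniform on `[0, 4]`. -/
theorem exists_taylor_modulus {f : ℝ → ℝ} (hf : ContDiff ℝ 1 f) {ε : ℝ} (hε : 0 < ε) :
    ∃ δ : ℝ, 0 < δ ∧ ∀ a ∈ Icc (0 : ℝ) 4, ∀ b ∈ Icc (0 : ℝ) 4, |b - a| < δ →
      |f b - f a - deriv f a * (b - a)| ≤ ε * |b - a| := by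
  have huc := (isCompact_Icc (a := (0 : ℝ)) (b := 4)).uniformContinuousOn_of_continuous
    (hf.continuous_deriv le_rfl).continuousOn
  rw [Metric.uniformContinuousOn_iff] at huc
  obtain ⟨δ, hδ, h⟩ := huc ε hε
  refine ⟨δ, hδ, fun a ha b hb hab => ?_⟩
  have hsub : uIcc a b ⊆ Icc 0 4 := uIcc_subset_Icc ha hb
  have hd : ∀ t ∈ uIcc a b, HasDerivWithinAt (fun t => f t - deriv f a * t)
      (deriv f t - deriv f a) (uIcc a b) t := fun t _ => by
    have h1 := (hf.differentiable one_ne_zero t).hasDerivAt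
    have h2 := (hasDerivAt_id t).const_mul (deriv f a)
    rw [mul_one] at h2
    exact (h1.sub h2).hasDerivWithinAt
  have := Convex.norm_image_sub_le_of_norm_hasDerivWithin_le hd (C := ε) (fun t ht => ?_)
    (convex_uIcc a b) left_mem_uIcc right_mem_uIcc
  · rw [Real.norm_eq_abs, Real.norm_eq_abs] at this
    convert this using 2
    ring
  · refine (h t (hsub ht) a ha ?_).le
    rw [Real.dist_eq]
    exact (abs_sub_left_of_mem_uIcc ht).trans_lt hab

theorem exists_lipschitz {f : ℝ → ℝ} (hf : ContDiff ℝ 1 f) :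
    ∃ D : ℝ, 0 ≤ D ∧ (∀ a ∈ Icc (0 : ℝ) 4, |deriv f a| ≤ D) ∧
      ∀ a ∈ Icc (0 : ℝ) 4, ∀ b ∈ Icc (0 : ℝ) 4, |f b - f a| ≤ D * |b - a| := by
  obtain ⟨D, hD⟩ := (isCompact_Icc (a := (0 : ℝ)) (b := 4)).exists_bound_of_continuousOn
    (hf.continuous_deriv le_rfl).continuousOn
  refine ⟨D, (norm_nonneg _).trans (hD 0 (by norm_num)), hD, fun a ha b hb => ?_⟩
  exact Convex.norm_image_sub_le_of_norm_hasDerivWithin_le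
    (fun t _ => (hf.differentiable one_ne_zero t).hasDerivAt.hasDerivWithinAt) hD
    (convex_Icc 0 4) ha hb

theorem norm_mem_of_mem_B2 {y : E3} (hy : y ∈ B 2) : ‖y‖ ∈ Icc (0 : ℝ) 4 :=
  ⟨norm_nonneg _, by linarith [mem_B.1 hy]⟩

/-- The change of the spatial density under the deformation, on the domain of integration `B_2` of
`T`. -/
def densityShift (R : ℝ → ℝ) (ζ : E3 → ℝ) : E3 → ℝ :=
  (B 2).indicator fun y => R ‖deformInv ζ y‖ - R ‖y‖

namespace IsSmall

variable {N : ℝ} {ζ : E3 → ℝ}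

theorem norm_deformInv_mem (h : IsSmall N ζ) {y : E3} (hy : y ∈ B 2) :
    ‖deformInv ζ y‖ ∈ Icc (0 : ℝ) 4 :=
  ⟨norm_nonneg _, by linarith [mem_B.1 (h.deformInv_mem hy)]⟩

theorem abs_deformInv_le (h : IsSmall N ζ) {y : E3} (hy : y ∈ B 2) :
    |ζ (deformInv ζ y)| ≤ 2 * N * ‖y‖ := by
  have h1 := h.abs_le (h.deformInv_mem hy)
  nlinarith [h.norm_deformInv_le hy, h.nonneg]

theorem abs_norm_deformInv_sub (h : IsSmall N ζ) {y : E3} (hy : y ∈ B 2) :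
    |‖deformInv ζ y‖ - ‖y‖| ≤ 2 * N * ‖y‖ := by
  rw [h.norm_deformInv hy, sub_sub_cancel_left, abs_neg]
  exact h.abs_deformInv_le hy

theorem sInv_densityShift (h : IsSmall N ζ) (R : ℝ → ℝ) : SInv (densityShift R ζ) := by
  intro A hA y
  obtain ⟨e, he⟩ := exists_iso_of_mem_S hA
  have hiff : A y ∈ B 2 ↔ y ∈ B 2 := by rw [← he, mem_B, e.norm_map, ← mem_B]
  by_cases hy : y ∈ B 2
  · rw [densityShift, indicator_of_mem hy, indicator_of_mem (hiff.2 hy),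
      h.norm_deformInv_symm hA hy, ← he, e.norm_map]
  · rw [densityShift, indicator_of_notMem hy, indicator_of_notMem (mt hiff.1 hy)]

theorem isLinSource_densityShift (h : IsSmall N ζ) {R : ℝ → ℝ} (hR : Continuous R) {D : ℝ}
    (hD : 0 ≤ D) (hRD : ∀ a ∈ Icc (0 : ℝ) 4, ∀ b ∈ Icc (0 : ℝ) 4, |R b - R a| ≤ D * |b - a|) :
    IsLinSource (2 * D * N) (densityShift R ζ) where
  meas := by
    refine (aestronglyMeasurable_indicator_iff (measurableSet_B 2)).2 ?_
    exact ContinuousOn.aestronglyMeasurable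
      ((hR.comp_continuousOn h.continuousOn_deformInv.norm).sub
        (hR.comp continuous_norm).continuousOn) (measurableSet_B 2)
  bound y := by
    have := h.nonneg
    by_cases hy : y ∈ B 2
    · rw [densityShift, indicator_of_mem hy]
      refine (hRD _ (norm_mem_of_mem_B2 hy) _ (h.norm_deformInv_mem hy)).trans ?_
      calc D * |‖deformInv ζ y‖ - ‖y‖| ≤ D * (2 * N * ‖y‖) :=
            mul_le_mul_of_nonneg_left (h.abs_norm_deformInv_sub hy) hD
        _ = _ := by ring
    · rw [densityShift, indicator_of_notMem hy, abs_zero]; positivity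
  zero y hy := indicator_of_notMem hy _
  even := (h.sInv_densityShift R).even

end IsSmall

theorem pullGrad_zero (P : E3 → E3) (x : E3) : pullGrad 0 P x = P x := by
  rw [pullGrad, grad_zero, deform_zero_left, Pi.zero_apply, zero_div, add_zero, one_smul,
    zero_div, zero_smul, smul_zero, sub_zero, smul_zero, add_zero]

/-- For a radial potential the gradient of the composition with `g_ζ` involves only the value of
`V'` at the deformed radius. -/
theorem pullGrad_radGrad {V : ℝ → ℝ} {N : ℝ} {ζ : E3 → ℝ} (h : IsSmall N ζ) {x : E3}
    (hx : x ∈ Bdot 3) : pullGrad ζ (radGrad V) x =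
      (deriv V (‖x‖ + ζ x) / ‖x‖) • x + deriv V (‖x‖ + ζ x) • grad ζ x := by
  have hr := norm_pos_iff.2 hx.2
  have hl := h.factor_pos hx.1
  have hs : ‖x‖ + ζ x = ‖x‖ * (1 + ζ x / ‖x‖) := by field_simp
  have hg : radGrad V (deform ζ x) = (deriv V (‖x‖ + ζ x) / ‖x‖) • x := by
    rw [radGrad, h.norm_deform hx.1, deform_eq_smul, smul_smul]
    congr 1
    have hs0 : ‖x‖ + ζ x ≠ 0 := by rw [hs]; exact (mul_pos hr hl).ne'
    field_simp
  rw [pullGrad, hg, real_inner_smul_left, real_inner_self_eq_norm_sq]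
  match_scalars <;> field_simp
  ring

namespace RadialProfiles

variable {φ ψ : ℝ → ℝ} {E₀ : ℝ} {f₀ : E3 → E3 → ℝ} {ρ₀ U₀ : E3 → ℝ} {R V : ℝ → ℝ} {C N : ℝ}
  {ζ : E3 → ℝ}

theorem exists_isLinSource_densityShift (hP : RadialProfiles ρ₀ U₀ R V C) (h : IsSmall N ζ) :
    ∃ A, IsLinSource A (densityShift R ζ) := by
  obtain ⟨D, hD, -, hRD⟩ := exists_lipschitz hP.contDiff_R
  exact ⟨_, h.isLinSource_densityShift hP.contDiff_R.continuous hD hRD⟩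

/-- The two terms with `U₀` come from the density of the steady state, since `U₀ = -newton ρ₀`; what
remains is the potential of the density shift, composed with the deformation. -/
theorem T_eq (hP : RadialProfiles ρ₀ U₀ R V C) (hφ : EnergyProfile φ E₀)
    (hs : SphericalSteadyState φ f₀ ρ₀ U₀) (hψ : MomentumProfile ψ) (h : IsSmall N ζ) :
    T φ ψ E₀ U₀ 0 ζ =
      (B 3).indicator (fun x => U₀ (deform 0 x) - U₀ 0) -
        (B 3).indicator (fun x => U₀ (deform ζ x) - U₀ 0) +
        (B 3).indicator (fun x =>
          newton (densityShift R ζ) (deform ζ x) - newton (densityShift R ζ) 0) := by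
  obtain ⟨A, hA⟩ := hP.isSource_density
  obtain ⟨A', hA'⟩ := hP.exists_isLinSource_densityShift h
  have hnew : ∀ z : E3, ∫ y in B 2, AxialVP.h φ ψ E₀ 0 (axisDist y) (U₀ (deformInv ζ y)) / ‖z - y‖
      = -U₀ z + newton (densityShift R ζ) z := by
    intro z
    rw [hP.potential_eq_newton, neg_neg, ← newton_add hA hA'.isSource, newton,
      ← integral_indicator (measurableSet_B 2)]
    congr 1
    funext y
    by_cases hy : y ∈ B 2
    · rw [indicator_of_mem hy, h_zero_eq hφ hψ, ← hs.density_eq_densityOf, Pi.add_apply,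
        densityShift, indicator_of_mem hy, hP.density_eq, hP.density_eq, add_sub_cancel]
    · rw [indicator_of_notMem hy, Pi.add_apply, densityShift, indicator_of_notMem hy,
        hA.zero y hy, add_zero, zero_div]
  have hnew0 : ∫ y in B 2, AxialVP.h φ ψ E₀ 0 (axisDist y) (U₀ (deformInv ζ y)) / ‖y‖
      = -U₀ 0 + newton (densityShift R ζ) 0 := by
    rw [← hnew 0]
    simp only [zero_sub, norm_neg]
  funext x
  rw [T, Pi.add_apply, Pi.sub_apply]
  by_cases hx : x ∈ B 3
  · rw [indicator_of_mem hx, indicator_of_mem hx, indicator_of_mem hx, indicator_of_mem hx,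
      hnew, hnew0, deform_zero_left]
    ring
  · rw [indicator_of_notMem hx, indicator_of_notMem hx, indicator_of_notMem hx,
      indicator_of_notMem hx]
    ring

theorem memY_T (hP : RadialProfiles ρ₀ U₀ R V C) (hφ : EnergyProfile φ E₀)
    (hs : SphericalSteadyState φ f₀ ρ₀ U₀) (hψ : MomentumProfile ψ) (h : IsSmall N ζ) :
    MemY (T φ ψ E₀ U₀ 0 ζ) := by
  obtain ⟨c, hU⟩ := hP.exists_isPotential
  obtain ⟨A, hA⟩ := hP.exists_isLinSource_densityShift h
  rw [hP.T_eq hφ hs hψ h]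
  exact YSub.add_mem (YSub.sub_mem (hU.memY_comp isSmall_zero) (hU.memY_comp h))
    ((hA.isPotential (h.sInv_densityShift R)).memY_comp h)

theorem hasGradientWithinAt_T (hP : RadialProfiles ρ₀ U₀ R V C) (hφ : EnergyProfile φ E₀)
    (hs : SphericalSteadyState φ f₀ ρ₀ U₀) (hψ : MomentumProfile ψ) (h : IsSmall N ζ)
    {x : E3} (hx : x ∈ Bdot 3) :
    HasGradientWithinAt (T φ ψ E₀ U₀ 0 ζ) (radGrad V x - pullGrad ζ (radGrad V) x +
      pullGrad ζ (field (densityShift R ζ)) x) (B 3) x := by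
  obtain ⟨c, hU⟩ := hP.exists_isPotential
  obtain ⟨A, hA⟩ := hP.exists_isLinSource_densityShift h
  rw [hP.T_eq hφ hs hψ h, hasGradientWithinAt_iff_hasFDerivWithinAt, map_add, map_sub]
  have h1 := hU.hasGradientWithinAt_comp isSmall_zero x hx
  rw [pullGrad_zero] at h1
  exact (h1.hasFDerivWithinAt.sub (hU.hasGradientWithinAt_comp h x hx).hasFDerivWithinAt).add
    ((hA.isPotential (h.sInv_densityShift R)).hasGradientWithinAt_comp h x hx).hasFDerivWithinAt

/-- The potential part of `T(0, ·)` has derivative `-V'ζ`, with a remainder that is small in `Y`. -/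
theorem norm_radial_remainder_le (h : IsSmall N ζ) {ε D : ℝ} (hε : 0 ≤ ε) (hD : 0 ≤ D)
    (hVt : ∀ a ∈ Icc (0 : ℝ) 4, ∀ b ∈ Icc (0 : ℝ) 4, |b - a| ≤ 3 * N →
      |deriv V b - deriv V a - deriv (deriv V) a * (b - a)| ≤ ε * |b - a|)
    (hVl : ∀ a ∈ Icc (0 : ℝ) 4, ∀ b ∈ Icc (0 : ℝ) 4, |deriv V b - deriv V a| ≤ D * |b - a|)
    {x : E3} (hx : x ∈ Bdot 3) :
    ‖radGrad V x - pullGrad ζ (radGrad V) x +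
      (deriv V ‖x‖ • grad ζ x + (deriv (deriv V) ‖x‖ * ζ x / ‖x‖) • x)‖ ≤
      (ε + D * N) * N * ‖x‖ := by
  have hN := h.nonneg
  have hr := norm_pos_iff.2 hx.2
  have hx3 := mem_B.1 hx.1
  have hζ := h.abs_le hx.1
  have ha : ‖x‖ ∈ Icc (0 : ℝ) 4 := ⟨hr.le, by linarith⟩
  have hb : ‖x‖ + ζ x ∈ Icc (0 : ℝ) 4 := by
    rw [← h.norm_deform hx.1]
    exact ⟨norm_nonneg _, h.norm_deform_le_four hx.1⟩
  have h1 := hVt _ ha _ hb (by rw [add_sub_cancel_left]; nlinarith)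
  have h2 := hVl _ ha _ hb
  rw [add_sub_cancel_left] at h1 h2
  have e : radGrad V x - pullGrad ζ (radGrad V) x +
      (deriv V ‖x‖ • grad ζ x + (deriv (deriv V) ‖x‖ * ζ x / ‖x‖) • x) =
      -(((deriv V (‖x‖ + ζ x) - deriv V ‖x‖ - deriv (deriv V) ‖x‖ * ζ x) / ‖x‖) • x) -
        (deriv V (‖x‖ + ζ x) - deriv V ‖x‖) • grad ζ x := by
    rw [pullGrad_radGrad h hx, radGrad]
    match_scalars <;> ring
  rw [e]
  refine (norm_sub_le _ _).trans ?_
  rw [norm_neg, norm_smul, norm_smul, Real.norm_eq_abs, Real.norm_eq_abs, abs_div, abs_norm,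
    div_mul_cancel₀ _ hr.ne']
  have h3 : |deriv V (‖x‖ + ζ x) - deriv V ‖x‖| * ‖grad ζ x‖ ≤ (D * (N * ‖x‖)) * N :=
    mul_le_mul (h2.trans (mul_le_mul_of_nonneg_left hζ hD)) (h.grad_le x hx) (norm_nonneg _)
      (by positivity)
  have h4 := h1.trans (mul_le_mul_of_nonneg_left hζ hε)
  linarith

/-- The density shift has derivative `q V'ζ = -R'ζ`, with a remainder that is small relative to
`|y|`; the factor `|y|` of the bound is what the estimates of the field in `Y` need. -/
theorem isLinSource_remainder (hP : RadialProfiles ρ₀ U₀ R V C) (h : IsSmall N ζ) {ε D : ℝ}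
    (hε : 0 ≤ ε) (hD : 0 ≤ D)
    (hRt : ∀ a ∈ Icc (0 : ℝ) 4, ∀ b ∈ Icc (0 : ℝ) 4, |b - a| ≤ 3 * N →
      |R b - R a - deriv R a * (b - a)| ≤ ε * |b - a|)
    (hRd : ∀ a ∈ Icc (0 : ℝ) 4, |deriv R a| ≤ D)
    {A A' : ℝ} (hσ : IsLinSource A (densityShift R ζ))
    (hq : IsLinSource A' (linCoeff R V * radMul V ζ)) :
    IsLinSource (2 * (ε + D * N) * N)
      (densityShift R ζ + (-1 : ℝ) • (linCoeff R V * radMul V ζ)) where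
  meas := hσ.meas.add (hq.meas.const_smul (-1 : ℝ))
  bound y := by
    have hN := h.nonneg
    rw [Pi.add_apply, Pi.smul_apply, smul_eq_mul, neg_one_mul, ← sub_eq_add_neg]
    by_cases hy : y ∈ B 2
    · have hz := h.deformInv_mem hy
      have hy3 : y ∈ B 3 := by have := mem_B.1 hy; rw [mem_B]; linarith
      have e1 : (linCoeff R V * radMul V ζ) y = -(deriv R ‖y‖ * ζ y) := by
        rw [Pi.mul_apply, radMul, ← mul_assoc, hP.linCoeff_mul]; ring
      have hdiff : ‖deformInv ζ y‖ - ‖y‖ = -ζ (deformInv ζ y) := by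
        rw [h.norm_deformInv hy]; ring
      have h1 := hRt _ (norm_mem_of_mem_B2 hy) _ (h.norm_deformInv_mem hy) (by
        rw [hdiff, abs_neg]
        have := h.abs_le hz
        have := mem_B.1 hz
        nlinarith)
      rw [hdiff, abs_neg] at h1
      have h2 := h.abs_deformInv_le hy
      have h3 : |ζ y - ζ (deformInv ζ y)| ≤ N * (2 * N * ‖y‖) := by
        refine (h.memX.abs_sub_le h.grad_le hy3 hz).trans (mul_le_mul_of_nonneg_left ?_ hN)
        rw [norm_sub_rev]
        exact h.norm_deformInv_sub_self hy
      rw [densityShift, indicator_of_mem hy, e1]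
      have e2 : R ‖deformInv ζ y‖ - R ‖y‖ - -(deriv R ‖y‖ * ζ y) =
          (R ‖deformInv ζ y‖ - R ‖y‖ - deriv R ‖y‖ * -ζ (deformInv ζ y)) +
            deriv R ‖y‖ * (ζ y - ζ (deformInv ζ y)) := by ring
      rw [e2]
      refine (abs_add_le _ _).trans ?_
      rw [abs_mul (deriv R ‖y‖)]
      have h4 : |deriv R ‖y‖| * |ζ y - ζ (deformInv ζ y)| ≤ D * (N * (2 * N * ‖y‖)) :=
        mul_le_mul (hRd _ (norm_mem_of_mem_B2 hy)) h3 (abs_nonneg _) hD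
      have h5 := h1.trans (mul_le_mul_of_nonneg_left h2 hε)
      refine (add_le_add h5 h4).trans_eq ?_
      ring
    · rw [hσ.zero y hy, hq.zero y hy, sub_zero, abs_zero]
      positivity
  zero y hy := by simp [hσ.zero y hy, hq.zero y hy]
  even y := by simp only [Pi.add_apply, Pi.smul_apply, hσ.even y, hq.even y]

/-- The remainder of the linearization of `T(0, ·)` at zero, for the gradient. Composition with
`g_ζ` in the potential of the density shift costs only a term of order `N √N`, since the
shift itself is of order `N`. -/
theorem norm_remainder_le (hP : RadialProfiles ρ₀ U₀ R V C) (h : IsSmall N ζ) {ε D : ℝ}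
    (hε : 0 ≤ ε) (hD : 0 ≤ D)
    (hVt : ∀ a ∈ Icc (0 : ℝ) 4, ∀ b ∈ Icc (0 : ℝ) 4, |b - a| ≤ 3 * N →
      |deriv V b - deriv V a - deriv (deriv V) a * (b - a)| ≤ ε * |b - a|)
    (hVl : ∀ a ∈ Icc (0 : ℝ) 4, ∀ b ∈ Icc (0 : ℝ) 4, |deriv V b - deriv V a| ≤ D * |b - a|)
    (hRt : ∀ a ∈ Icc (0 : ℝ) 4, ∀ b ∈ Icc (0 : ℝ) 4, |b - a| ≤ 3 * N →
      |R b - R a - deriv R a * (b - a)| ≤ ε * |b - a|)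
    (hRd : ∀ a ∈ Icc (0 : ℝ) 4, |deriv R a| ≤ D)
    (hRl : ∀ a ∈ Icc (0 : ℝ) 4, ∀ b ∈ Icc (0 : ℝ) 4, |R b - R a| ≤ D * |b - a|)
    {x : E3} (hx : x ∈ Bdot 3) :
    ‖(radGrad V x - pullGrad ζ (radGrad V) x + pullGrad ζ (field (densityShift R ζ)) x) -
      (field (linCoeff R V * radMul V ζ) x -
        (deriv V ‖x‖ • grad ζ x + (deriv (deriv V) ‖x‖ * ζ x / ‖x‖) • x))‖ ≤
      ((1 + 8 * CJ) * ε + ((1 + 56 * CJ) * D * N + 136 * CJ * D * √N)) * N * ‖x‖ := by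
  have hN := h.nonneg
  have hCJ := CJ_nonneg
  have hσ := h.isLinSource_densityShift hP.contDiff_R.continuous hD hRl
  obtain ⟨K, hK, hmul⟩ := hP.exists_radMul_bound
  obtain ⟨m1, -, m3⟩ := hmul ζ N h.memX hN h.grad_le
  have hq := hP.isLinSource_mul (A := K * N) (by positivity) m1.isCS m3
  have hτ := hP.isLinSource_remainder h hε hD hRt hRd hσ hq
  set σ := densityShift R ζ
  set τ := σ + (-1 : ℝ) • (linCoeff R V * radMul V ζ) with hτdef
  have hx3 := mem_B.1 hx.1
  have hfield : field σ x - field (linCoeff R V * radMul V ζ) x = field τ x := by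
    have : σ = τ + linCoeff R V * radMul V ζ := by
      rw [hτdef]; funext y; simp
    rw [sub_eq_iff_eq_add]
    conv_lhs => rw [this]
    exact field_add hτ.isSource hq.isSource x
  have b1 := norm_radial_remainder_le h hε hD hVt hVl hx
  have b2 := hτ.norm_field_le x
  have b3 := hσ.norm_field_sub_le (η := N) hx3 (by linarith [h.le])
    (h.norm_deform_sub_self hx.1)
  have b4 := norm_pullGrad_sub_le h (P := field σ) hx
  have b5 : ‖field σ (deform ζ x)‖ ≤ 4 * (2 * D * N) * CJ * (2 * ‖x‖) := by
    refine (hσ.norm_field_le _).trans (mul_le_mul_of_nonneg_left ?_ (by positivity))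
    have := h.norm_deform_le hx.1
    nlinarith [h.le, norm_nonneg x]
  have b6 : ‖pullGrad ζ (field σ) x - field σ (deform ζ x)‖ ≤
      48 * CJ * D * N * N * ‖x‖ := by
    refine b4.trans ((mul_le_mul_of_nonneg_left b5 (by positivity)).trans_eq ?_)
    ring
  have e : (radGrad V x - pullGrad ζ (radGrad V) x + pullGrad ζ (field σ) x) -
      (field (linCoeff R V * radMul V ζ) x -
        (deriv V ‖x‖ • grad ζ x + (deriv (deriv V) ‖x‖ * ζ x / ‖x‖) • x)) =
      (radGrad V x - pullGrad ζ (radGrad V) x +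
        (deriv V ‖x‖ • grad ζ x + (deriv (deriv V) ‖x‖ * ζ x / ‖x‖) • x)) +
      (pullGrad ζ (field σ) x - field σ (deform ζ x)) +
      (field σ (deform ζ x) - field σ x) + field τ x := by
    rw [← hfield]; abel
  rw [e]
  refine (norm_add_le _ _).trans ((add_le_add ((norm_add_le _ _).trans (add_le_add
    ((norm_add_le _ _).trans (add_le_add b1 b6)) b3)) b2).trans_eq ?_)
  ring

/-- `T(0, ·)` is differentiable at zero with derivative `linOp`. -/
theorem hasFDerivAt_TMap (hP : RadialProfiles ρ₀ U₀ R V C) (hφ : EnergyProfile φ E₀)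
    (hs : SphericalSteadyState φ f₀ ρ₀ U₀) (hψ : MomentumProfile ψ) (L : X →L[ℝ] Y)
    (hL : ∀ ζ, L ζ = hP.linOpMap ζ) : HasFDerivAt (TMap φ ψ E₀ U₀ 0) L 0 := by
  obtain ⟨D₁, hD₁, -, hVl⟩ := exists_lipschitz hP.contDiff_deriv_V
  obtain ⟨D₂, hD₂, hRd, hRl⟩ := exists_lipschitz hP.contDiff_R
  set D := max D₁ D₂ with hD
  have hCJ := CJ_nonneg
  have hD0 : 0 ≤ D := hD₁.trans (le_max_left _ _)
  have key : ∀ e > 0, ∀ᶠ ζ : X in 𝓝 0, ‖TMap φ ψ E₀ U₀ 0 ζ - L ζ‖ ≤ e * ‖ζ‖ := by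
    intro e he
    set ε := e / (2 * (1 + 8 * CJ)) with hε
    have hε0 : 0 < ε := by positivity
    obtain ⟨δ₁, hδ₁, hVt⟩ := exists_taylor_modulus hP.contDiff_deriv_V hε0
    obtain ⟨δ₂, hδ₂, hRt⟩ := exists_taylor_modulus hP.contDiff_R hε0
    have ev : ∀ {G : ℝ → ℝ}, Continuous G → ∀ a, G 0 < a → ∀ᶠ ζ : X in 𝓝 0, G ‖ζ‖ < a := by
      intro G hG a ha
      have hc : Continuous fun ζ : X => G ‖ζ‖ := hG.comp continuous_norm
      exact hc.continuousAt.eventually_lt continuousAt_const (by simpa using ha)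
    filter_upwards [ev (G := fun t => t) (by fun_prop) (1 / 6) (by norm_num),
      ev (G := fun t => 3 * t) (by fun_prop) δ₁ (by simpa using hδ₁),
      ev (G := fun t => 3 * t) (by fun_prop) δ₂ (by simpa using hδ₂),
      ev (G := fun t => (1 + 56 * CJ) * D * t + 136 * CJ * D * √t) (by fun_prop) (e / 2)
        (by simpa using he)] with ζ h1 h2 h3 h4
    have hsm : IsSmall ‖ζ‖ ζ := ⟨ζ.2, norm_grad_le_X ζ, h1.le⟩
    have hmem := hP.memY_T hφ hs hψ hsm
    have hT : TMap φ ψ E₀ U₀ 0 ζ = ⟨T φ ψ E₀ U₀ 0 ζ, hmem⟩ := dif_pos hmem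
    refine norm_Y_le fun x hx => ?_
    have hsub : ((TMap φ ψ E₀ U₀ 0 ζ - L ζ : Y) : E3 → ℝ) =
        T φ ψ E₀ U₀ 0 ζ - linOp R V ζ := by
      rw [hT, hL]; rfl
    have g3 := (hP.hasGradientWithinAt_T hφ hs hψ hsm hx).hasFDerivWithinAt.sub
      (hP.hasGradientWithinAt_linOp ζ.2 x hx).hasFDerivWithinAt
    rw [← map_sub] at g3
    have hg := grad_eq hx.1 (hasGradientWithinAt_iff_hasFDerivWithinAt.2 g3)
    rw [hsub]
    rw [hg]
    have hle : ∀ a b : ℝ, D₁ * |b - a| ≤ D * |b - a| := fun a b =>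
      mul_le_mul_of_nonneg_right (le_max_left _ _) (abs_nonneg _)
    have hle2 : ∀ a b : ℝ, D₂ * |b - a| ≤ D * |b - a| := fun a b =>
      mul_le_mul_of_nonneg_right (le_max_right _ _) (abs_nonneg _)
    refine (hP.norm_remainder_le hsm hε0.le hD0
      (fun a ha b hb hab => hVt a ha b hb (hab.trans_lt h2))
      (fun a ha b hb => (hVl a ha b hb).trans (hle a b))
      (fun a ha b hb hab => hRt a ha b hb (hab.trans_lt h3))
      (fun a ha => (hRd a ha).trans (le_max_right _ _))
      (fun a ha b hb => (hRl a ha b hb).trans (hle2 a b)) hx).trans ?_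
    have h5 : (1 + 8 * CJ) * ε = e / 2 := by rw [hε]; field_simp
    have h6 : (1 + 8 * CJ) * ε + ((1 + 56 * CJ) * D * ‖ζ‖ + 136 * CJ * D * √‖ζ‖) ≤ e := by
      linarith
    exact mul_le_mul_of_nonneg_right (mul_le_mul_of_nonneg_right h6 (norm_nonneg _))
      (norm_nonneg _)
  -- the estimate itself, at `ζ = 0`
  have h0 : TMap φ ψ E₀ U₀ 0 0 = 0 := by
    have := (key 1 one_pos).self_of_nhds
    rw [map_zero, sub_zero, norm_zero, mul_zero] at this
    exact norm_le_zero_iff.1 this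
  rw [hasFDerivAt_iff_isLittleO_nhds_zero]
  refine Asymptotics.isLittleO_iff.2 fun e he => ?_
  filter_upwards [key e he] with ζ hζ
  rwa [zero_add, h0, sub_zero]

end RadialProfiles

end AxialVP

end

/-- On a small ball about `0` in `X` the deformations are invertible with `B_2` in their range and
`T(0, ·)` has values in `Y`; its Fréchet derivative at `0` exists and is a linear isomorphism
of `X` onto `Y` (bounded, with bounded inverse). -/
theorem proposition4p1 (φ ψ : ℝ → ℝ) (E₀ : ℝ) (f₀ : AxialVP.E3 → AxialVP.E3 → ℝ)
    (ρ₀ U₀ : AxialVP.E3 → ℝ)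
    (hφ : AxialVP.EnergyProfile φ E₀)
    (hs : AxialVP.SphericalSteadyState φ f₀ ρ₀ U₀)
    (hψ : AxialVP.MomentumProfile ψ) :
    (∃ r : ℝ, 0 < r ∧ ∀ ζ : AxialVP.X, ‖ζ‖ < r →
      Set.InjOn (AxialVP.deform ζ) (AxialVP.B 3) ∧
      AxialVP.B 2 ⊆ AxialVP.deform ζ '' AxialVP.B 3 ∧
      AxialVP.MemY (AxialVP.T φ ψ E₀ U₀ 0 ζ)) ∧
    ∃ L : AxialVP.X ≃L[ℝ] AxialVP.Y,
      HasFDerivAt (AxialVP.TMap φ ψ E₀ U₀ 0) (L : AxialVP.X →L[ℝ] AxialVP.Y) 0 := by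
  obtain ⟨R, V, C, hP⟩ := AxialVP.exists_radialProfiles hφ hs
  refine ⟨⟨1 / 6, by norm_num, fun ζ hζ => ?_⟩, ?_⟩
  · have h : AxialVP.IsSmall ‖ζ‖ ζ := ⟨ζ.2, AxialVP.norm_grad_le_X ζ, hζ.le⟩
    exact ⟨h.injOn_deform, h.subset_image_deform, hP.memY_T hφ hs hψ h⟩
  · obtain ⟨L, hL⟩ := hP.exists_linEquiv
    exact ⟨L, hP.hasFDerivAt_TMap hφ hs hψ L hL⟩
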